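/- **Setting.** Let $0\le\delta<c$ be constant integers and $1\le \ell\le k$ integers; put $B=\lceil k/\ell\rceil$, $q=2^\ell$, and assume $q>B+c$. Represent $GF(q)$ as $\mathbb F_2[X]/(f)$ with any irreducible $f$ of degree $\ell$, so that symbols are identified with strings of $\ell$ bits (leftmost bit most significant). Fix a systematic $(B+c,B)$ MDS code over $GF(q)$, given by a $B\times c$ matrix $E$: the message symbols $U\in GF(q)^B$ have the parity symbols $UE\in GF(q)^c$, and the code has minimum distance $c+1$. *Encoder of the Guess & Check (GC) code.* A message $\mathbf u\in\{0,1\}^k$ is padded with zeros and cut into $B$ blocks of $\ell$ bits, i.e. symbols $U$. The codeword $\mathbf x$, of length $n$, is $\mathbf u$ followed by the bits of the $c$ parity symbols $UE$, each parity bit being repeated $\delta+1$ times. *Decoder for insertions.* The received string $\mathbf y$ is read from right to left and the parity bits are recovered from the repetition code (read until one bit value has occurred $\delta+1$ times; this value is the next parity bit). The unread part is the received systematic part, with, say, $\delta''$ insertions. For each distribution $(d_1,\dots,d_B)$ of $\delta''$ insertions among the blocks (a case), the systematic part is chunked with $\ell+\delta'$ bits at each block with $d_j=\delta'$; the blocks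 with $d_j>0$ are erased and recovered from the parities. The case is possible if the decoded string satisfies all parities and each decoded erasure is a subsequence of its chunk of $\ell+\delta'$ bits. If all possible cases lead to the same decoded string, it is output; otherwise the decoder declares a failure. **Theorem 3.** GC codes with this decoder correct up to $\delta$ insertions: for every message and every set of at most $\delta$ insertions, whatever their positions and values, the decoder outputs the transmitted message or declares a failure. The implied constants below are independent of $k$, $\ell$, $f$ and $E$; they depend only on $\delta$ and $c$ (and, in the last sentence, on $A$). 1. Redundancy: $n-k=c(\delta+1)\ell$ bits. 2. The encoder runs in $\mathcal O(k\ell)$ and the decoder in $\mathcal O\!\left(k^{\delta+1}/\ell^{\delta-1}\right)$ steps, counted in bit, list and counter operations (the arithmetic of $GF(q)$ being carried out on bits). 3. For a suitable choice of the MDS code (for all $k,\ell,f$ as above), for at most $\delta$ insertion positions chosen, deterministically or at random, independently of the codeword, and for a uniformly distributed message, the probability that some choice of the values of the inserted bits makes the decoding fail is $$\Pr(F)=\mathcal O\!\left(\frac{(k/\ell)^{\delta}}{2^{\ell(c-\delta)}}\right).$$ Moreover, for every constant $A$, the same bound holds for every systematic MDS code whenever $2^{\ell\delta}\le A\,2^{\ell}(k/\ell)^{\delta}$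 (for instance for $\delta=1$, $A=1$ and all $\ell$, or for $\ell=\log_2 k$ and $A$ large enough depending on $\delta$). -/

import Mathlib

open scoped ENNReal Polynomial

namespace GC

/-! ### Step counting

A `Timed` computation carries its result together with the number of elementary steps it took.
An elementary step is one operation on a bit (test, copy, exclusive or), on a list cell, or on a
counter. Only `tick` produces cost; every pass of every loop below executes a `tick`, and
everything done between two ticks is a bounded number of such operations. In particular the
arithmetic of `GF(2^ℓ)` is not a primitive: it is carried out bit by bit and charged bit by bit. -/

/-- A value together with the number of elementary steps used to compute it. -/
structure Timed (α : Type) where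
  val : α
  cost : ℕ

instance : Monad Timed where
  pure a := ⟨a, 0⟩
  bind x g := ⟨(g x.val).val, x.cost + (g x.val).cost⟩

/-- One elementary step. -/
def tick : Timed Unit := ⟨(), 1⟩

/-! ### List primitives -/

def mapT {α β : Type} (g : α → Timed β) : List α → Timed (List β)
  | [] => do tick; return []
  | a :: as => do tick; let b ← g a; let bs ← mapT g as; return b :: bs

def appendT {α : Type} : List α → List α → Timed (List α)
  | [], bs => do tick; return bs
  | a :: as, bs => do tick; let cs ← appendT as bs; return a :: cs

def flattenT {α : Type} : List (List α) → Timed (List α)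
  | [] => do tick; return []
  | as :: rest => do tick; let bs ← flattenT rest; appendT as bs

def reverseAuxT {α : Type} : List α → List α → Timed (List α)
  | [], acc => do tick; return acc
  | a :: as, acc => do tick; reverseAuxT as (a :: acc)

def reverseT {α : Type} (as : List α) : Timed (List α) := reverseAuxT as []

def replicateT {α : Type} (a : α) : ℕ → Timed (List α)
  | 0 => do tick; return []
  | n + 1 => do tick; let as ← replicateT a n; return a :: as

def lengthT {α : Type} : List α → Timed ℕ
  | [] => do tick; return 0
  | _ :: as => do tick; let n ← lengthT as; return n + 1

def takeT {α : Type} : ℕ → List α → Timed (List α)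
  | 0, _ => do tick; return []
  | _ + 1, [] => do tick; return []
  | n + 1, a :: as => do tick; let bs ← takeT n as; return a :: bs

/-- Equality test of bit strings. -/
def eqT : List Bool → List Bool → Timed Bool
  | [], [] => do tick; return true
  | a :: as, b :: bs => do tick; if a = b then eqT as bs else return false
  | _, _ => do tick; return false

/-- Equality test of lists of symbols. -/
def eqSymbolsT : List (List Bool) → List (List Bool) → Timed Bool
  | [], [] => do tick; return true
  | a :: as, b :: bs => do
      tick
      let e ← eqT a b
      if e then eqSymbolsT as bs else return false
  | _, _ => do tick; return false

/-- Is the first bit string a (not necessarily contiguous) subsequence of the second? -/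
def subseqT : List Bool → List Bool → Timed Bool
  | [], _ => do tick; return true
  | _ :: _, [] => do tick; return false
  | a :: as, b :: bs => do tick; if a = b then subseqT as bs else subseqT (a :: as) bs

/-- Reads the next `n` bits (zeros after the end of the string) and returns them with the rest. -/
def readT : ℕ → List Bool → Timed (List Bool × List Bool)
  | 0, xs => do tick; return ([], xs)
  | n + 1, [] => do tick; let r ← readT n []; return (false :: r.1, r.2)
  | n + 1, x :: xs => do tick; let r ← readT n xs; return (x :: r.1, r.2)

/-- Cuts a string into consecutive pieces of prescribed lengths, padding with zeros at the end. -/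
def chunkT : List ℕ → List Bool → Timed (List (List Bool))
  | [], _ => do tick; return []
  | n :: ns, xs => do
      tick
      let r ← readT n xs
      let cs ← chunkT ns r.2
      return r.1 :: cs

/-! ### Bit-level arithmetic of `GF(2^ℓ)`

A symbol is a list of `ℓ` bits, most significant bit first: the coefficients of a polynomial of
degree less than `ℓ` in a root `α` of an irreducible polynomial `f` of degree `ℓ`. The list `g`
holds the coefficients of `f` below the leading one, most significant first. -/

/-- Addition of two symbols. -/
def xorT : List Bool → List Bool → Timed (List Bool)
  | a :: as, b :: bs => do tick; let r ← xorT as bs; return Bool.xor a b :: r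
  | _, _ => do tick; return []

/-- Multiplication of a symbol by `α`. -/
def mulRootT (g : List Bool) : List Bool → Timed (List Bool)
  | [] => do tick; return []
  | b :: bs => do
      tick
      let s ← appendT bs [false]
      if b then xorT s g else return s

/-- Horner scheme: for a string `as` of `m` bits, `acc * α ^ m + as(α) * b`. -/
def hornerT (g b : List Bool) : List Bool → List Bool → Timed (List Bool)
  | acc, [] => do tick; return acc
  | acc, a :: as => do
      tick
      let s ← mulRootT g acc
      let s' ← if a then xorT s b else pure s
      hornerT g b s' as

/-- The product `a(α) * b`. -/
def mulT (g a b : List Bool) : Timed (List Bool) := do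
  let n ← lengthT g
  let z ← replicateT false n
  hornerT g b z a

/-- Removal of leading zeros. -/
def stripT : List Bool → Timed (List Bool)
  | [] => do tick; return []
  | true :: bs => do tick; return true :: bs
  | false :: bs => do tick; stripT bs

/-- Adds the shorter second string to the leading part of the first one. -/
def xorPrefixT : List Bool → List Bool → Timed (List Bool)
  | as, [] => do tick; return as
  | [], _ :: _ => do tick; return []
  | a :: as, b :: bs => do tick; let r ← xorPrefixT as bs; return Bool.xor a b :: r

/-- `n` steps of polynomial long division by the polynomial with leading coefficient `1` and
remaining coefficients `d`; returns quotient and remainder. -/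
def divT (d : List Bool) : ℕ → List Bool → Timed (List Bool × List Bool)
  | 0, r => do tick; return ([], r)
  | _ + 1, [] => do tick; return ([], [])
  | n + 1, b :: bs => do
      tick
      let r ← if b then xorPrefixT bs d else pure bs
      let qr ← divT d n r
      return (b :: qr.1, qr.2)

/-- Extended Euclidean algorithm. If `r₀(α) = s₀ * a` and `r₁(α) = s₁ * a`, these relations are
kept; when the remainder vanishes, the cofactor of the last nonzero one is returned. -/
def euclidT (g : List Bool) : ℕ → List Bool → List Bool → List Bool → List Bool →
    Timed (List Bool)
  | 0, _, s₀, _, _ => do tick; return s₀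
  | n + 1, r₀, s₀, r₁, s₁ => do
      tick
      let r ← stripT r₁
      match r with
      | [] => return s₀
      | b :: d => do
          let m₀ ← lengthT r₀
          let m₁ ← lengthT d
          let qr ← divT d (m₀ - m₁) r₀
          let m ← lengthT g
          let z ← replicateT false m
          let t ← hornerT g s₁ z qr.1
          let s ← xorT s₀ t
          euclidT g n (b :: d) s₁ qr.2 s

/-- The inverse of a nonzero symbol. -/
def invT (g a : List Bool) : Timed (List Bool) := do
  let m ← lengthT g
  let z ← replicateT false m
  let z' ← replicateT false (m - 1)
  let one ← appendT z' [true]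
  euclidT g (m + 1) (true :: g) z a one

/-- The inner product `∑ vⱼ uⱼ` of two vectors of symbols. -/
def dotT (g : List Bool) : List (List Bool) → List (List Bool) → Timed (List Bool)
  | v :: vs, u :: us => do
      tick
      let p ← mulT g v u
      let s ← dotT g vs us
      xorT p s
  | _, _ => do tick; let m ← lengthT g; replicateT false m

/-- One elimination step: from the equation `(b, bs | t)` subtracts `b` times the normalized
equation `(1, as | s)`, and drops the first unknown. -/
def elimT (g : List Bool) (as : List (List Bool)) (s : List Bool) :
    List (List Bool) × List Bool → Timed (List (List Bool) × List Bool)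
  | ([], t) => do tick; return ([], t)
  | (b :: bs, t) => do
      tick
      let row ← go b as bs
      let p ← mulT g b s
      let t' ← xorT t p
      return (row, t')
where
  go (b : List Bool) : List (List Bool) → List (List Bool) → Timed (List (List Bool))
    | a :: as, x :: xs => do
        tick
        let p ← mulT g b a
        let y ← xorT x p
        let ys ← go b as xs
        return y :: ys
    | _, _ => do tick; return []

/-- Gaussian elimination and back substitution for a square linear system over `GF(2^ℓ)`, given as
a list of equations `(coefficients, right-hand side)`. No pivoting takes place: every square
submatrix of the parity part of a systematic MDS code is invertible. -/
def solveT (g : List Bool) : ℕ → List (List (List Bool) × List Bool) → Timed (List (List Bool))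
  | n + 1, (a :: as, s) :: rows => do
      tick
      let i ← invT g a
      let as' ← mapT (fun x => mulT g i x) as
      let s' ← mulT g i s
      let rows' ← mapT (elimT g as' s') rows
      let xs ← solveT g n rows'
      let p ← dotT g as' xs
      let x ← xorT s' p
      return x :: xs
  | _, _ => do tick; return []

/-! ### The encoding algorithm -/

/-- The number `⌈k / ℓ⌉` of blocks of length `ℓ` of a message of `k` bits. -/
def numBlocks (k ℓ : ℕ) : ℕ := (k + ℓ - 1) / ℓ

/-- Repeats every bit `δ + 1` times. -/
def repeatT (δ : ℕ) (bits : List Bool) : Timed (List Bool) := do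
  let r ← mapT (fun b => replicateT b (δ + 1)) bits
  flattenT r

/-- The encoder. `G` holds, for each of the `c` parities, the list of the `⌈k / ℓ⌉` coefficients
by which the message symbols are multiplied. -/
def encodeT (δ k ℓ : ℕ) (g : List Bool) (G : List (List (List Bool))) (u : List Bool) :
    Timed (List Bool) := do
  let sizes ← replicateT ℓ (numBlocks k ℓ)
  let U ← chunkT sizes u
  let P ← mapT (fun row => dotT g row U) G
  let p ← flattenT P
  let r ← repeatT δ p
  appendT u r

/-! ### The decoding algorithm -/

/-- Decoding of the repetition code in the presence of insertions. The input is read from one end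
until one of the two bit values has been seen `δ + 1` times; this value is the next decoded bit,
the bits read so far are discarded, and the procedure is repeated until `N` bits are decoded.
`zeros` and `ones` count the bits read since the last decoded bit. The decoded bits are collected
in reverse order of decoding. Returns them and the unread part, or nothing if the input ends
prematurely. -/
def repDecodeT (δ : ℕ) : ℕ → ℕ → ℕ → List Bool → List Bool →
    Timed (Option (List Bool × List Bool))
  | 0, _, _, acc, z => do tick; return some (acc, z)
  | _ + 1, _, _, _, [] => do tick; return none
  | N + 1, zeros, ones, acc, true :: z => do
      tick
      if ones = δ then repDecodeT δ N 0 0 (true :: acc) z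
      else repDecodeT δ (N + 1) zeros (ones + 1) acc z
  | N + 1, zeros, ones, acc, false :: z => do
      tick
      if zeros = δ then repDecodeT δ N 0 0 (false :: acc) z
      else repDecodeT δ (N + 1) (zeros + 1) ones acc z

def incHead : List ℕ → List ℕ
  | [] => []
  | d :: ds => (d + 1) :: ds

/-- All ways to distribute `m` insertions among `B` blocks: the lists of length `B` and sum `m`. -/
def casesT : ℕ → ℕ → Timed (List (List ℕ))
  | 0, 0 => do tick; return [[]]
  | 0, _ + 1 => do tick; return []
  | B + 1, 0 => do
      tick
      let xs ← casesT B 0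
      mapT (fun ds => do tick; return 0 :: ds) xs
  | B + 1, m + 1 => do
      tick
      let xs ← casesT B (m + 1)
      let xs' ← mapT (fun ds => do tick; return 0 :: ds) xs
      let ys ← casesT (B + 1) m
      let ys' ← mapT (fun ds => do tick; return incHead ds) ys
      appendT xs' ys'
termination_by B m => (B, m)

/-- Keeps the entries at the positions of the blocks assumed to be affected. -/
def affectedT {α : Type} : List ℕ → List α → Timed (List α)
  | d :: ds, a :: as => do
      tick
      let r ← affectedT ds as
      return if d = 0 then r else a :: r
  | _, _ => do tick; return []

/-- Replaces the affected blocks by zero symbols. -/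
def maskT (z : List Bool) : List ℕ → List (List Bool) → Timed (List (List Bool))
  | d :: ds, a :: as => do
      tick
      let r ← maskT z ds as
      return (if d = 0 then a else z) :: r
  | _, _ => do tick; return []

/-- Replaces the affected blocks by the decoded erasures. -/
def fillT : List ℕ → List (List Bool) → List (List Bool) → Timed (List (List Bool))
  | d :: ds, a :: as, xs => do
      tick
      if d = 0 then
        let r ← fillT ds as xs
        return a :: r
      else
        match xs with
        | [] => return []
        | x :: xs' =>
          let r ← fillT ds as xs'
          return x :: r
  | _, _, _ => do tick; return []

/-- The linear equations for the erased symbols, one for each parity. -/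
def equationsT (g : List Bool) (ds : List ℕ) (known : List (List Bool)) :
    List (List (List Bool)) → List (List Bool) → Timed (List (List (List Bool) × List Bool))
  | row :: G, p :: P => do
      tick
      let co ← affectedT ds row
      let v ← dotT g row known
      let s ← xorT p v
      let r ← equationsT g ds known G P
      return (co, s) :: r
  | _, _ => do tick; return []

/-- Do the symbols `Y` satisfy all parities? -/
def checkParitiesT (g : List Bool) (Y : List (List Bool)) :
    List (List (List Bool)) → List (List Bool) → Timed Bool
  | row :: G, p :: P => do
      tick
      let v ← dotT g row Y
      let e ← eqT v p
      if e then checkParitiesT g Y G P else return false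
  | _, _ => do tick; return true

/-- Is every symbol a subsequence of the corresponding chunk? -/
def checkSubseqT : List (List Bool) → List (List Bool) → Timed Bool
  | y :: ys, b :: bs => do
      tick
      let e ← subseqT y b
      if e then checkSubseqT ys bs else return false
  | _, _ => do tick; return true

/-- The treatment of one case: the received systematic part `s` is cut according to the assumption
that block `j` has suffered `dⱼ` insertions, the affected blocks are erased and recovered from as
many parities as there are erasures, and the result is tested against the parities and against the
chunks. -/
def tryCaseT (ℓ : ℕ) (g : List Bool) (G : List (List (List Bool))) (P : List (List Bool))
    (s : List Bool) (ds : List ℕ) : Timed (Option (List (List Bool))) := do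
  let sizes ← mapT (fun d => do tick; return ℓ + d) ds
  let chunks ← chunkT sizes s
  let z ← replicateT false ℓ
  let known ← maskT z ds chunks
  let eqs ← equationsT g ds known G P
  let er ← affectedT ds chunks
  let w ← lengthT er
  let sys ← takeT w eqs
  let xs ← solveT g w sys
  let Y ← fillT ds chunks xs
  let c₁ ← checkParitiesT g Y G P
  let c₂ ← checkSubseqT Y chunks
  return if c₁ && c₂ then some Y else none

/-- The decoded strings found so far: none, exactly one, or at least two different ones. -/
inductive Verdict
  | nothing
  | unique (Y : List (List Bool))
  | conflict

def updateT : Verdict → Option (List (List Bool)) → Timed Verdict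
  | v, none => do tick; return v
  | .nothing, some Y => do tick; return .unique Y
  | .unique Y₀, some Y => do
      tick
      let e ← eqSymbolsT Y₀ Y
      return if e then .unique Y₀ else .conflict
  | .conflict, some _ => do tick; return .conflict

def tryAllT (ℓ : ℕ) (g : List Bool) (G : List (List (List Bool))) (P : List (List Bool))
    (s : List Bool) : List (List ℕ) → Verdict → Timed Verdict
  | [], v => do tick; return v
  | ds :: rest, v => do
      tick
      let o ← tryCaseT ℓ g G P s ds
      let v' ← updateT v o
      tryAllT ℓ g G P s rest v'

/-- The decoder; `none` is the message "failure to decode". -/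
def decodeT (δ k ℓ c : ℕ) (g : List Bool) (G : List (List (List Bool))) (y : List Bool) :
    Timed (Option (List Bool)) := do
  let z ← reverseT y
  let o ← repDecodeT δ (c * ℓ) 0 0 [] z
  match o with
  | none => return none
  | some (p, rest) => do
      let s ← reverseT rest
      let len ← lengthT s
      if k ≤ len ∧ len ≤ k + δ then
        let sizes ← replicateT ℓ c
        let P ← chunkT sizes p
        let cs ← casesT (numBlocks k ℓ) (len - k)
        let v ← tryAllT ℓ g G P s cs .nothing
        match v with
        | .unique Y => do
            let bits ← flattenT Y
            let u ← takeT k bits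
            return some u
        | _ => return none
      else return none

/-! ### The code -/

noncomputable section

/-- The element of `GF(2^ℓ)`, realized as `𝔽₂[X] / (f)` with `deg f = ℓ`, with a given binary
representation; the leftmost bit is the most significant one. -/
def symbol (f : (ZMod 2)[X]) {ℓ : ℕ} (b : Fin ℓ → Bool) : AdjoinRoot f :=
  ∑ i : Fin ℓ, if b i then AdjoinRoot.root f ^ (ℓ - 1 - (i : ℕ)) else 0

/-- The binary representation of a field element, the inverse of `symbol`. -/
def bits (f : (ZMod 2)[X]) (ℓ : ℕ) (x : AdjoinRoot f) : Fin ℓ → Bool :=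
  Function.invFun (symbol f) x

open scoped Classical in
/-- The systematic code `{(U, U E)}` with `B` message symbols and `c` parity symbols is MDS: its
minimum distance attains the Singleton bound `c + 1`. -/
def IsSystematicMDS {F : Type*} [CommRing F] {B c : ℕ} (E : Matrix (Fin B) (Fin c) F) : Prop :=
  ∀ U : Fin B → F, U ≠ 0 → c + 1 ≤ hammingNorm U + hammingNorm (Matrix.vecMul U E)

/-- Block `j` of a message, padded with zeros after its end. -/
def block {k : ℕ} (ℓ : ℕ) (u : Fin k → Bool) (j : ℕ) : Fin ℓ → Bool :=
  fun i => (List.ofFn u).getD (j * ℓ + i) false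

/-- The codeword of `u`: the message bits, followed by the bits of the `c` MDS parity symbols, each
bit repeated `δ + 1` times. -/
def encode (δ k ℓ c : ℕ) (f : (ZMod 2)[X])
    (E : Matrix (Fin (numBlocks k ℓ)) (Fin c) (AdjoinRoot f)) (u : Fin k → Bool) : List Bool :=
  let U : Fin (numBlocks k ℓ) → AdjoinRoot f := fun j => symbol f (block ℓ u j)
  List.ofFn u ++
    (List.ofFn fun r : Fin c =>
      (List.ofFn (bits f ℓ (Matrix.vecMul U E r))).flatMap
        (List.replicate (δ + 1))).flatten

/-- Chunk `j` of the received systematic part `s` if block `i` is assumed to have suffered `d i`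
insertions: `ℓ + d j` consecutive bits (zeros after the end of `s`). -/
def chunk {B : ℕ} (ℓ : ℕ) (s : List Bool) (d : Fin B → ℕ) (j : Fin B) : List Bool :=
  List.ofFn fun i : Fin (ℓ + d j) =>
    s.getD ((j : ℕ) * ℓ + (∑ a ∈ Finset.univ.filter (fun a : Fin B => a < j), d a) + i) false

/-- The case `d` is possible and leads to the decoded string `Y`: the unaffected symbols are read
off their chunks, the parities `p` are satisfied (those used for decoding the erasures as well as
the remaining ones), and the affected symbols are subsequences of their chunks. -/
def IsPossible {ℓ c B : ℕ} (f : (ZMod 2)[X]) (E : Matrix (Fin B) (Fin c) (AdjoinRoot f))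
    (p : Fin c → AdjoinRoot f) (s : List Bool) (d : Fin B → ℕ) (Y : Fin B → Fin ℓ → Bool) : Prop :=
  (∀ j, d j = 0 → List.ofFn (Y j) = chunk ℓ s d j) ∧
  Matrix.vecMul (fun j => symbol f (Y j)) E = p ∧
  (∀ j, d j ≠ 0 → (List.ofFn (Y j)).Sublist (chunk ℓ s d j))

/-- The strings decoded in the possible cases, over all distributions of the insertions among the
blocks. -/
def decodedStrings (k ℓ c : ℕ) (f : (ZMod 2)[X])
    (E : Matrix (Fin (numBlocks k ℓ)) (Fin c) (AdjoinRoot f))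
    (p : Fin c → AdjoinRoot f) (s : List Bool) : Set (Fin (numBlocks k ℓ) → Fin ℓ → Bool) :=
  {Y | ∃ d : Fin (numBlocks k ℓ) → ℕ, ∑ j, d j = s.length - k ∧ IsPossible f E p s d Y}

open scoped Classical in
/-- The decoder. The parities are recovered from right to left through the repetition code, which
leaves the received systematic part `s`. If all possible cases lead to the same decoded string, its
first `k` bits are returned; otherwise the decoder declares a failure, `none`. -/
def decode (δ k ℓ c : ℕ) (f : (ZMod 2)[X])
    (E : Matrix (Fin (numBlocks k ℓ)) (Fin c) (AdjoinRoot f)) (y : List Bool) :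
    Option (List Bool) :=
  match (repDecodeT δ (c * ℓ) 0 0 [] y.reverse).val with
  | none => none
  | some (pbits, rest) =>
      let s := rest.reverse
      let p : Fin c → AdjoinRoot f :=
        fun r => symbol f fun i : Fin ℓ => pbits.getD ((r : ℕ) * ℓ + i) false
      if h : k ≤ s.length ∧ s.length ≤ k + δ ∧ ∃! Y, Y ∈ decodedStrings k ℓ c f E p s then
        some ((List.ofFn fun j => List.ofFn (h.2.2.choose j)).flatten.take k)
      else none

/-- The coefficients of `f` below `X ^ ℓ`, most significant first. -/
def lowBits (f : (ZMod 2)[X]) (ℓ : ℕ) : List Bool :=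
  List.ofFn fun i : Fin ℓ => decide (f.coeff (ℓ - 1 - (i : ℕ)) = 1)

/-- The parity part of the generator matrix in binary, one list of symbols for each parity. -/
def matrixBits {B c : ℕ} (f : (ZMod 2)[X]) (ℓ : ℕ) (E : Matrix (Fin B) (Fin c) (AdjoinRoot f)) :
    List (List (List Bool)) :=
  List.ofFn fun r : Fin c => List.ofFn fun j : Fin B => List.ofFn (bits f ℓ (E j r))

/-! ### Insertions and decoding failure -/

/-- `y` arises from `x` by insertions: the inserted bits are those at the positions `S` of `y`,
their values are arbitrary, and deleting them leaves `x`. -/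
def InsertedAt (S : Finset ℕ) (x y : List Bool) : Prop :=
  S ⊆ Finset.range y.length ∧ (y.zipIdx.filter fun b => b.2 ∉ S).map Prod.fst = x

/-- The probability that, for a uniformly distributed message and for insertion positions with
distribution `π` chosen independently of the message, some choice of the values of the inserted
bits makes the decoder fail. -/
def failureProb (δ k ℓ c : ℕ) (f : (ZMod 2)[X])
    (E : Matrix (Fin (numBlocks k ℓ)) (Fin c) (AdjoinRoot f)) (π : PMF (Finset ℕ)) : ℝ≥0∞ :=
  ((PMF.uniformOfFintype (Fin k → Bool)).bind fun u => π.map fun S => (u, S)).toOuterMeasure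
    {ω | ∃ y, InsertedAt ω.2 (encode δ k ℓ c f E ω.1) y ∧ decode δ k ℓ c f E y = none}

end

end GC

/-! ### The step-counting monad -/

namespace GC

/-! Write `B` for the number of blocks and `q = 2 ^ ℓ`.

Correctness. Read from the right, the received string contains the repeated parity bits as a
subsequence with at most `δ` extra bits. So a wrong value never occurs `δ + 1` times before the
right one does, and all parities are recovered (`repDecodeT_of_sublist`). The unread part contains
the message as a subsequence and has at most `k + δ` bits (`exists_received`). It can be cut into
supersequences of the blocks, so some case yields the transmitted blocks
(`message_mem_decodedStrings`). The decoder therefore returns the message or fails, and it fails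
only if some case yields a second string with the same parities.

Complexity. Bit strings are values of polynomials at the root of `f`; products and inverses cost
`O(ℓ²)`. An inner product of length `B` costs `O(B ℓ²) = O(k ℓ)`, and so does a whole case: at most
`δ` unknowns are solved for, without pivoting, because the code is MDS (`tryCaseT_spec`). There are
at most `B ^ δ` cases.

Failure for an arbitrary MDS code. Fix the insertion positions, the inserted values and a case `d`
with `m` insertions. In an unaffected block the decoded symbol is read from the received string at a
shifted place, so the difference between decoded and sent blocks depends affinely on the message
there; as a whole it is annihilated by `E`. On a set `M` of displaced blocks these differences can
be prescribed at will, since the shift is a strictly increasing partial map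
(`exists_shift_solution`). If `M` and the erasures together number at most `c`, the MDS property
makes the translates of the set of bad messages by `q ^ |M|` such prescriptions disjoint
(`card_wrongSet_mul_le`). Hence a case with many displaced blocks has at most `2 ^ k / q ^ (c - m)`
bad messages. In a case with few displaced blocks, every erasure is close to a true insertion or to
the first block (`near_of_card_lt`), so there are boundedly many such cases. If they have bad
messages at all, `c + 1 - 2 m` blocks are displaced (`card_moved_ge`). Their total `O(2 ^ k / q ^ (c
+ 1 - 2 δ))` is absorbed if `q ^ δ ≤ A q (k / ℓ) ^ δ`.

Failure for a suitable code. If `q (k / ℓ) ^ δ < q ^ δ`, the code is found by averaging. Whatever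
the code, the decoded strings are among the `O(k ^ (2 δ))` strings obtained from the padded message
by at most `δ` insertions and equally many deletions (`mem_candidates_of_mem_decodedStrings`). When
the rows of a Cauchy code are multiplied by random units, a given nonzero difference has zero
parities with probability at most `(q - 1) ^ (-c)` (`card_scale_mul_le`). So for some scaling the
fraction of bad messages, for all positions at once, is `O(k ^ (2 δ) / q ^ c)`, and `k ^ (2 δ) =
O((k / ℓ) ^ (2 δ) q) = O((k / ℓ) ^ δ q ^ δ)`. -/

@[simp] theorem Timed.bind_val {α β : Type} (x : Timed α) (g : α → Timed β) :
    (x >>= g).val = (g x.val).val := rfl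

@[simp] theorem Timed.bind_cost {α β : Type} (x : Timed α) (g : α → Timed β) :
    (x >>= g).cost = x.cost + (g x.val).cost := rfl

@[simp] theorem Timed.pure_val {α : Type} (a : α) : (pure a : Timed α).val = a := rfl

@[simp] theorem Timed.pure_cost {α : Type} (a : α) : (pure a : Timed α).cost = 0 := rfl

@[simp] theorem tick_cost : tick.cost = 1 := rfl

@[simp] theorem Timed.ite_val {α : Type} (p : Prop) [Decidable p] (x y : Timed α) :
    (if p then x else y).val = if p then x.val else y.val := by split <;> rfl

@[simp] theorem Timed.ite_cost {α : Type} (p : Prop) [Decidable p] (x y : Timed α) :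
    (if p then x else y).cost = if p then x.cost else y.cost := by split <;> rfl

/-! ### List primitives: values and costs -/

@[simp] theorem mapT_val {α β : Type} (g : α → Timed β) (as : List α) :
    (mapT g as).val = as.map fun a => (g a).val := by
  induction as with
  | nil => simp [mapT]
  | cons a as ih => simp [mapT, ih]

theorem mapT_cost_le {α β : Type} (g : α → Timed β) (as : List α) (K : ℕ)
    (h : ∀ a ∈ as, (g a).cost ≤ K) : (mapT g as).cost ≤ as.length * (K + 1) + 1 := by
  induction as with
  | nil => simp [mapT]
  | cons a as ih =>
    have h1 := h a (by simp)
    have h2 := ih fun b hb => h b (by simp [hb])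
    simp only [mapT, Timed.bind_cost, tick_cost, Timed.pure_cost, List.length_cons]
    nlinarith

@[simp] theorem appendT_val {α : Type} (as bs : List α) : (appendT as bs).val = as ++ bs := by
  induction as with
  | nil => simp [appendT]
  | cons a as ih => simp [appendT, ih]

@[simp] theorem appendT_cost {α : Type} (as bs : List α) :
    (appendT as bs).cost = as.length + 1 := by
  induction as with
  | nil => simp [appendT]
  | cons a as ih => simp [appendT, ih]; omega

@[simp] theorem flattenT_val {α : Type} (L : List (List α)) : (flattenT L).val = L.flatten := by
  induction L with
  | nil => simp [flattenT]
  | cons a as ih => simp [flattenT, ih]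

theorem flattenT_cost_le {α : Type} (L : List (List α)) (K : ℕ) (h : ∀ as ∈ L, as.length ≤ K) :
    (flattenT L).cost ≤ L.length * (K + 2) + 1 := by
  induction L with
  | nil => simp [flattenT]
  | cons a as ih =>
    have h1 := h a (by simp)
    have h2 := ih fun b hb => h b (by simp [hb])
    simp only [flattenT, Timed.bind_cost, tick_cost, List.length_cons, appendT_cost]
    nlinarith

theorem reverseAuxT_spec {α : Type} (as acc : List α) :
    (reverseAuxT as acc).val = as.reverse ++ acc ∧
      (reverseAuxT as acc).cost = as.length + 1 := by
  induction as generalizing acc with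
  | nil => simp [reverseAuxT]
  | cons a as ih => simp [reverseAuxT, ih]; omega

@[simp] theorem reverseT_val {α : Type} (as : List α) : (reverseT as).val = as.reverse := by
  simp [reverseT, reverseAuxT_spec]

@[simp] theorem reverseT_cost {α : Type} (as : List α) : (reverseT as).cost = as.length + 1 := by
  simp [reverseT, reverseAuxT_spec]

@[simp] theorem replicateT_val {α : Type} (a : α) (n : ℕ) :
    (replicateT a n).val = List.replicate n a := by
  induction n with
  | zero => simp [replicateT]
  | succ n ih => simp [replicateT, ih, List.replicate_succ]

@[simp] theorem replicateT_cost {α : Type} (a : α) (n : ℕ) :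
    (replicateT a n).cost = n + 1 := by
  induction n with
  | zero => simp [replicateT]
  | succ n ih => simp [replicateT, ih]; omega

@[simp] theorem lengthT_val {α : Type} (as : List α) : (lengthT as).val = as.length := by
  induction as with
  | nil => simp [lengthT]
  | cons a as ih => simp [lengthT, ih]

@[simp] theorem lengthT_cost {α : Type} (as : List α) : (lengthT as).cost = as.length + 1 := by
  induction as with
  | nil => simp [lengthT]
  | cons a as ih => simp [lengthT, ih]; omega

@[simp] theorem takeT_val {α : Type} (n : ℕ) (as : List α) : (takeT n as).val = as.take n := by
  induction n generalizing as with
  | zero => simp [takeT]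
  | succ n ih => cases as <;> simp [takeT, ih]

theorem takeT_cost_le {α : Type} (n : ℕ) (as : List α) : (takeT n as).cost ≤ n + 1 := by
  induction n generalizing as with
  | zero => simp [takeT]
  | succ n ih =>
    cases as with
    | nil => simp [takeT]
    | cons a as => simp [takeT]; have := ih as; omega

@[simp] theorem eqT_val (as bs : List Bool) : (eqT as bs).val = decide (as = bs) := by
  induction as generalizing bs with
  | nil => cases bs <;> simp [eqT]
  | cons a as ih =>
    cases bs with
    | nil => simp [eqT]
    | cons b bs => by_cases h : a = b <;> simp [eqT, ih, h]

theorem eqT_cost_le (as bs : List Bool) : (eqT as bs).cost ≤ as.length + 1 := by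
  induction as generalizing bs with
  | nil => cases bs <;> simp [eqT]
  | cons a as ih =>
    cases bs with
    | nil => simp [eqT]
    | cons b bs => by_cases h : a = b <;> simp [eqT, h]; have := ih bs; omega

@[simp] theorem eqSymbolsT_val (as bs : List (List Bool)) :
    (eqSymbolsT as bs).val = decide (as = bs) := by
  induction as generalizing bs with
  | nil => cases bs <;> simp [eqSymbolsT]
  | cons a as ih =>
    cases bs with
    | nil => simp [eqSymbolsT]
    | cons b bs => by_cases h : a = b <;> simp [eqSymbolsT, ih, h]

theorem eqSymbolsT_cost_le (as bs : List (List Bool)) (K : ℕ) (h : ∀ a ∈ as, a.length ≤ K) :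
    (eqSymbolsT as bs).cost ≤ as.length * (K + 2) + 1 := by
  induction as generalizing bs with
  | nil => cases bs <;> simp [eqSymbolsT]
  | cons a as ih =>
    cases bs with
    | nil => simp [eqSymbolsT]
    | cons b bs =>
      have h1 := h a (by simp)
      have h2 := ih bs fun b hb => h b (by simp [hb])
      have h3 := eqT_cost_le a b
      simp only [eqSymbolsT, Timed.bind_cost, tick_cost, List.length_cons, Timed.ite_cost,
        Timed.pure_cost]
      split <;> nlinarith

/-- Greedy matching loses nothing: if the first letters agree, they may be matched with each other;
if not, the first letter of `bs` is useless. -/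
theorem subseqT_val (as bs : List Bool) : (subseqT as bs).val = true ↔ as.Sublist bs := by
  induction bs generalizing as with
  | nil => cases as <;> simp [subseqT]
  | cons b bs ih =>
    cases as with
    | nil => simp [subseqT]
    | cons a as =>
      by_cases h : a = b
      · subst h; simp [subseqT, ih]
      · simp only [subseqT, Timed.bind_val, if_neg h, ih]
        constructor
        · exact fun hs => hs.cons b
        · intro hs
          cases hs with
          | cons _ h' => exact h'
          | cons_cons _ h' => exact absurd rfl h

theorem subseqT_cost_le (as bs : List Bool) : (subseqT as bs).cost ≤ bs.length + 1 := by
  induction bs generalizing as with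
  | nil => cases as <;> simp [subseqT]
  | cons b bs ih =>
    cases as with
    | nil => simp [subseqT]
    | cons a as =>
      have h1 := ih as
      have h2 := ih (a :: as)
      simp only [subseqT, Timed.bind_cost, Timed.ite_cost, tick_cost, List.length_cons]
      split <;> omega

theorem readT_val (n : ℕ) (xs : List Bool) :
    (readT n xs).val = (List.ofFn fun i : Fin n => xs.getD i false, xs.drop n) := by
  induction n generalizing xs with
  | zero => simp [readT]
  | succ n ih => cases xs <;> simp [readT, ih, List.ofFn_succ]

@[simp] theorem readT_cost (n : ℕ) (xs : List Bool) : (readT n xs).cost = n + 1 := by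
  induction n generalizing xs with
  | zero => simp [readT]
  | succ n ih => cases xs <;> simp [readT, ih] <;> omega

/-- The piece of length `n` of `xs` that starts at position `o`, padded with zeros. -/
def piece (xs : List Bool) (o n : ℕ) : List Bool :=
  List.ofFn fun i : Fin n => xs.getD (o + i) false

@[simp] theorem length_piece (xs : List Bool) (o n : ℕ) : (piece xs o n).length = n := by
  simp [piece]

theorem chunkT_val_aux (ns : List ℕ) (xs : List Bool) (o : ℕ) :
    (chunkT ns (xs.drop o)).val =
      List.ofFn fun j : Fin ns.length => piece xs (o + (ns.take j).sum) ns[j] := by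
  induction ns generalizing o with
  | nil => simp [chunkT]
  | cons n ns ih =>
    have := ih (o + n)
    simp only [chunkT, Timed.bind_val, Timed.pure_val, readT_val, List.drop_drop, List.length_cons,
      List.ofFn_succ, this]
    congr 1
    · simp [piece, List.getD_eq_getElem?_getD, List.getElem?_drop]
      rfl
    · congr 1; ext1 j; simp [Nat.add_assoc]

theorem chunkT_val (ns : List ℕ) (xs : List Bool) :
    (chunkT ns xs).val =
      List.ofFn fun j : Fin ns.length => piece xs ((ns.take j).sum) ns[j] := by
  simpa using chunkT_val_aux ns xs 0

theorem chunkT_cost_le (ns : List ℕ) (xs : List Bool) (K : ℕ) (h : ∀ n ∈ ns, n ≤ K) :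
    (chunkT ns xs).cost ≤ ns.length * (K + 2) + 1 := by
  induction ns generalizing xs with
  | nil => simp [chunkT]
  | cons n ns ih =>
    have h1 := h n (by simp)
    simp only [chunkT, Timed.bind_cost, tick_cost, List.length_cons, Timed.pure_cost, readT_cost]
    have h2 := ih (readT n xs).val.2 fun b hb => h b (by simp [hb])
    nlinarith

theorem take_ofFn_sum {B : ℕ} (a : Fin B → ℕ) (j : Fin B) :
    ((List.ofFn a).take j).sum = ∑ i ∈ Finset.univ.filter (fun i : Fin B => i < j), a i := by
  induction B with
  | zero => exact j.elim0
  | succ B ih =>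
    rw [List.ofFn_succ]
    refine Fin.cases ?_ (fun j => ?_) j
    · simp
    · simp [ih, Finset.sum_filter, Fin.sum_univ_succ]

theorem chunkT_ofFn {B : ℕ} (ℓ : ℕ) (d : Fin B → ℕ) (s : List Bool) :
    (chunkT (List.ofFn fun j => ℓ + d j) s).val = List.ofFn (chunk ℓ s d) := by
  rw [chunkT_val]
  apply List.ext_getElem
  · simp
  intro j h1 h2
  have hj : j < B := by simpa using h2
  simp only [List.getElem_ofFn, Fin.getElem_fin]
  have := take_ofFn_sum (fun j => ℓ + d j) ⟨j, hj⟩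
  simp only at this
  rw [this, Finset.sum_add_distrib]
  have hc : (Finset.univ.filter fun i : Fin B => i < ⟨j, hj⟩).card = j := by
    have := Fin.card_Iio (⟨j, hj⟩ : Fin B)
    rwa [show Finset.Iio (⟨j, hj⟩ : Fin B) = Finset.univ.filter fun i => i < ⟨j, hj⟩ by
      ext; simp] at this
  simp [piece, chunk, hc]

theorem chunkT_replicate (ℓ B : ℕ) (s : List Bool) :
    (chunkT (List.replicate B ℓ) s).val = List.ofFn fun j : Fin B => piece s (j * ℓ) ℓ := by
  have := chunkT_ofFn (B := B) ℓ (fun _ => 0) s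
  simp only [add_zero, List.ofFn_const] at this
  rw [this]
  congr 1
  ext1 j
  simp [chunk, piece]

end GC

namespace GC

noncomputable section

open Polynomial

/-! ### Bit strings as polynomials and field elements -/

/-- The polynomial with a given coefficient string, most significant coefficient first. -/
def pol : List Bool → (ZMod 2)[X]
  | [] => 0
  | b :: bs => (if b then X ^ bs.length else 0) + pol bs

/-- The value of a bit string at the root of `f`. -/
def ev (f : (ZMod 2)[X]) (l : List Bool) : AdjoinRoot f := AdjoinRoot.mk f (pol l)

theorem pol_append (as bs : List Bool) : pol (as ++ bs) = pol as * X ^ bs.length + pol bs := by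
  induction as with
  | nil => simp [pol]
  | cons a as ih => cases a <;> simp [pol, ih, pow_add]; ring

@[simp] theorem pol_replicate (n : ℕ) : pol (List.replicate n false) = 0 := by
  induction n with
  | zero => simp [pol]
  | succ n ih => simp [pol, List.replicate_succ, ih]

theorem pol_coeff (l : List Bool) (m : ℕ) :
    (pol l).coeff m = if l.reverse.getD m false then 1 else 0 := by
  induction l with
  | nil => simp [pol]
  | cons b bs ih =>
    rw [pol, coeff_add, ih, List.reverse_cons]
    rcases lt_trichotomy m bs.length with h | h | h
    · rw [List.getD_append _ _ _ _ (by simpa using h)]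
      cases b <;> simp [coeff_X_pow, h.ne]
    · subst h
      rw [List.getD_append_right _ _ _ _ (by simp)]
      cases b <;> simp
    · rw [List.getD_append_right _ _ _ _ (by simpa using h.le),
        List.getD_eq_default (d := false) bs.reverse (by simpa using h.le),
        List.getD_eq_default _ _ (by simp; omega)]
      cases b <;> simp [coeff_X_pow, h.ne']

theorem degree_pol_lt (l : List Bool) : (pol l).degree < l.length := by
  rw [degree_lt_iff_coeff_zero]
  intro m hm
  rw [pol_coeff, List.getD_eq_default _ _ (by simpa using hm)]
  simp

theorem pol_injective {l l' : List Bool} (hl : l.length = l'.length) (h : pol l = pol l') :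
    l = l' := by
  rw [← List.reverse_inj]
  apply List.ext_getElem (by simpa using hl)
  intro i h1 h2
  have := congrArg (fun p => coeff p i) h
  simp only [pol_coeff, List.getD_eq_getElem _ _ h1, List.getD_eq_getElem _ _ h2] at this
  revert this
  cases l.reverse[i] <;> cases l'.reverse[i] <;> simp

theorem zmod2_ite (a : ZMod 2) : (if a = 1 then (1 : ZMod 2) else 0) = a := by
  revert a; decide

theorem pol_ofFn_coeff (p : (ZMod 2)[X]) (n : ℕ) (m : ℕ) :
    (pol (List.ofFn fun i : Fin n => decide (p.coeff (n - 1 - (i : ℕ)) = 1))).coeff m =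
      if m < n then p.coeff m else 0 := by
  rw [pol_coeff]
  split_ifs with h1 h2 h2
  · rw [List.getD_eq_getElem _ _ (by simpa using h2)] at h1
    simp only [List.getElem_reverse, List.length_ofFn, List.getElem_ofFn, decide_eq_true_eq] at h1
    rw [show n - 1 - (n - 1 - m) = m by omega] at h1
    exact h1.symm
  · rw [List.getD_eq_default _ _ (by simpa using h2)] at h1
    simp at h1
  · rw [List.getD_eq_getElem _ _ (by simpa using h2)] at h1
    simp only [List.getElem_reverse, List.length_ofFn, List.getElem_ofFn, decide_eq_true_eq] at h1
    rw [show n - 1 - (n - 1 - m) = m by omega] at h1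
    have := zmod2_ite (p.coeff m)
    rwa [if_neg h1] at this
  · rfl

theorem exists_pol_eq (p : (ZMod 2)[X]) (n : ℕ) (h : p.degree < n) :
    ∃ l : List Bool, l.length = n ∧ pol l = p := by
  refine ⟨List.ofFn fun i : Fin n => decide (p.coeff (n - 1 - (i : ℕ)) = 1), by simp, ?_⟩
  ext m
  rw [pol_ofFn_coeff]
  split_ifs with hm
  · rfl
  · exact ((degree_lt_iff_coeff_zero _ _).1 h m (not_lt.1 hm)).symm

theorem monic_of_irreducible {f : (ZMod 2)[X]} (hf : Irreducible f) : f.Monic := by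
  have h : f.leadingCoeff ≠ 0 := leadingCoeff_ne_zero.2 hf.ne_zero
  rw [Monic]
  revert h
  generalize f.leadingCoeff = a
  revert a; decide

theorem pol_lowBits {f : (ZMod 2)[X]} {ℓ : ℕ} (hf : Irreducible f) (hd : f.natDegree = ℓ) :
    pol (true :: lowBits f ℓ) = f := by
  ext m
  have hm := monic_of_irreducible hf
  rw [pol, coeff_add, lowBits, pol_ofFn_coeff, List.length_ofFn]
  simp only [if_true, coeff_X_pow]
  rcases lt_trichotomy m ℓ with h | h | h
  · simp [h, h.ne]
  · subst h
    simp only [lt_irrefl, if_true, if_false, add_zero]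
    rw [← hd]
    exact hm.symm
  · simp [h.not_gt, h.ne', coeff_eq_zero_of_natDegree_lt (hd ▸ h)]

@[simp] theorem length_lowBits (f : (ZMod 2)[X]) (ℓ : ℕ) : (lowBits f ℓ).length = ℓ := by
  simp [lowBits]

theorem symbol_eq_ev (f : (ZMod 2)[X]) {ℓ : ℕ} (b : Fin ℓ → Bool) :
    symbol f b = ev f (List.ofFn b) := by
  induction ℓ with
  | zero => simp [symbol, ev, pol]
  | succ n ih =>
    have := ih fun i => b i.succ
    simp only [symbol, ev] at this
    simp only [symbol, ev, Fin.sum_univ_succ, List.ofFn_succ, pol, map_add, ← this]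
    congr 1
    · simp; split <;> simp
    · refine Finset.sum_congr rfl fun i _ => ?_
      rw [show n + 1 - 1 - (i.succ : ℕ) = n - 1 - (i : ℕ) by simp; omega]

section field

variable {f : (ZMod 2)[X]}

/-- Equality in the quotient makes `f` divide a difference of degree less than that of `f`. This is
how equalities of symbols are later lifted to equalities of bit strings. -/
theorem ev_injective (hf : Irreducible f) {l l' : List Bool} (hl : l.length = f.natDegree)
    (hl' : l'.length = f.natDegree) (h : ev f l = ev f l') : l = l' := by
  apply pol_injective (hl.trans hl'.symm)
  rw [ev, ev, AdjoinRoot.mk_eq_mk] at h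
  have hdeg : (pol l - pol l').degree < f.degree := by
    rw [degree_eq_natDegree hf.ne_zero]
    refine (degree_sub_le _ _).trans_lt (max_lt ?_ ?_)
    · rw [← hl]; exact degree_pol_lt l
    · rw [← hl']; exact degree_pol_lt l'
  exact sub_eq_zero.1 (eq_zero_of_dvd_of_degree_lt h hdeg)

theorem exists_ev_eq (hf : Irreducible f) (x : AdjoinRoot f) :
    ∃ l : List Bool, l.length = f.natDegree ∧ ev f l = x := by
  obtain ⟨p, rfl⟩ := AdjoinRoot.mk_surjective x
  have hm := monic_of_irreducible hf
  obtain ⟨l, hl, h⟩ := exists_pol_eq (p %ₘ f) f.natDegree (by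
    rw [← degree_eq_natDegree hf.ne_zero]; exact degree_modByMonic_lt p hm)
  refine ⟨l, hl, ?_⟩
  rw [ev, h, AdjoinRoot.mk_eq_mk]
  refine ⟨-(p /ₘ f), ?_⟩
  have := modByMonic_add_div p f
  linear_combination this

theorem symbol_bijective (hf : Irreducible f) {ℓ : ℕ} (hd : f.natDegree = ℓ) :
    Function.Bijective (symbol f : (Fin ℓ → Bool) → AdjoinRoot f) := by
  constructor
  · intro b b' h
    rw [symbol_eq_ev, symbol_eq_ev] at h
    exact List.ofFn_injective (ev_injective hf (by simp [hd]) (by simp [hd]) h)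
  · intro x
    obtain ⟨l, hl, rfl⟩ := exists_ev_eq hf x
    have hl' : l.length = ℓ := hl.trans hd
    subst hl'
    exact ⟨l.get, by rw [symbol_eq_ev, List.ofFn_get]⟩

theorem symbol_bits (hf : Irreducible f) {ℓ : ℕ} (hd : f.natDegree = ℓ) (x : AdjoinRoot f) :
    symbol f (bits f ℓ x) = x :=
  Function.rightInverse_invFun (symbol_bijective hf hd).2 x

theorem ev_ofFn_bits (hf : Irreducible f) {ℓ : ℕ} (hd : f.natDegree = ℓ) (x : AdjoinRoot f) :
    ev f (List.ofFn (bits f ℓ x)) = x := by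
  rw [← symbol_eq_ev, symbol_bits hf hd]

@[simp] theorem ev_replicate (n : ℕ) : ev f (List.replicate n false) = 0 := by simp [ev]

theorem add_self_adjoinRoot (x : AdjoinRoot f) : x + x = 0 := by
  obtain ⟨p, rfl⟩ := AdjoinRoot.mk_surjective x
  rw [← map_add, CharTwo.add_self_eq_zero, map_zero]

/-! ### Correctness and cost of the arithmetic of symbols -/

theorem xorT_spec (as bs : List Bool) (h : as.length = bs.length) :
    (xorT as bs).val.length = as.length ∧ pol (xorT as bs).val = pol as + pol bs := by
  induction as generalizing bs with
  | nil => cases bs <;> simp_all [xorT, pol]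
  | cons a as ih =>
    cases bs with
    | nil => simp at h
    | cons b bs =>
      obtain ⟨h1, h2⟩ := ih bs (by simpa using h)
      have h' : as.length = bs.length := by simpa using h
      refine ⟨by simp [xorT, h1], ?_⟩
      simp only [xorT, Timed.bind_val, Timed.pure_val, pol, h1, h2, h']
      have h2 : (X ^ bs.length + X ^ bs.length : (ZMod 2)[X]) = 0 := CharTwo.add_self_eq_zero _
      cases a <;> cases b <;> simp
      · ring
      · ring
      · linear_combination -h2

theorem length_xorT {as bs : List Bool} (h : as.length = bs.length) :
    (xorT as bs).val.length = as.length := (xorT_spec as bs h).1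

theorem ev_xorT {as bs : List Bool} (h : as.length = bs.length) :
    ev f (xorT as bs).val = ev f as + ev f bs := by simp [ev, (xorT_spec as bs h).2]

theorem xorT_cost_le (as bs : List Bool) : (xorT as bs).cost ≤ as.length + 1 := by
  induction as generalizing bs with
  | nil => cases bs <;> simp [xorT]
  | cons a as ih =>
    cases bs with
    | nil => simp [xorT]
    | cons b bs => simp [xorT]; have := ih bs; omega

variable {g : List Bool}

/-- The reduction rule of the field arithmetic. No sign appears since the characteristic is two. -/
theorem root_pow_length (hg : pol (true :: g) = f) : AdjoinRoot.root f ^ g.length = ev f g := by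
  have h : AdjoinRoot.mk f (pol (true :: g)) = 0 := by rw [hg]; simp
  simp only [pol, if_true, map_add, map_pow, AdjoinRoot.mk_X] at h
  have := add_self_adjoinRoot (ev f g)
  rw [ev] at *
  linear_combination h - this

theorem ev_cons (b : Bool) (bs : List Bool) :
    ev f (b :: bs) = (if b then AdjoinRoot.root f ^ bs.length else 0) + ev f bs := by
  cases b <;> simp [ev, pol]

theorem mulRootT_spec (hg : pol (true :: g) = f) (b : List Bool) (hb : b.length = g.length) :
    (mulRootT g b).val.length = g.length ∧
      ev f (mulRootT g b).val = AdjoinRoot.root f * ev f b ∧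
      (mulRootT g b).cost ≤ 2 * g.length + 2 := by
  cases b with
  | nil => simp [mulRootT, ev, pol] at hb ⊢; exact hb
  | cons b bs =>
    have hl : (bs ++ [false]).length = g.length := by simpa using hb
    have he : ev f (bs ++ [false]) = AdjoinRoot.root f * ev f bs := by
      simp [ev, pol_append, pol]; ring
    have hr := root_pow_length hg
    have hc := xorT_cost_le (bs ++ [false]) g
    rw [List.length_cons] at hb
    cases b
    · simp [mulRootT, ev_cons, he, hb]; omega
    · simp only [mulRootT, Timed.bind_val, Timed.bind_cost, appendT_val, appendT_cost, tick_cost,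
        if_true, ev_cons, length_xorT hl, ev_xorT hl]
      refine ⟨hl, ?_, by omega⟩
      rw [he, ← hr, ← hb, pow_succ]
      ring

theorem hornerT_spec (hg : pol (true :: g) = f) (b : List Bool) (hb : b.length = g.length)
    (acc as : List Bool) (ha : acc.length = g.length) :
    (hornerT g b acc as).val.length = g.length ∧
      ev f (hornerT g b acc as).val =
        ev f acc * AdjoinRoot.root f ^ as.length + ev f as * ev f b ∧
      (hornerT g b acc as).cost ≤ as.length * (3 * g.length + 4) + 1 := by
  induction as generalizing acc with
  | nil => simp [hornerT, ev, pol, ha]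
  | cons a as ih =>
    obtain ⟨h1, h2, h3⟩ := mulRootT_spec hg acc ha
    have h4 : (mulRootT g acc).val.length = b.length := h1.trans hb.symm
    have h5 := xorT_cost_le (mulRootT g acc).val b
    cases a
    · obtain ⟨h6, h7, h8⟩ := ih _ h1
      simp only [hornerT, Timed.bind_val, Timed.bind_cost, tick_cost,
        Bool.false_eq_true, if_false, Timed.pure_val, Timed.pure_cost, ev_cons, List.length_cons]
      refine ⟨h6, ?_, by nlinarith⟩
      rw [h7, h2, pow_succ]; ring
    · obtain ⟨h6, h7, h8⟩ := ih _ ((length_xorT h4).trans h1)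
      simp only [hornerT, Timed.bind_val, Timed.bind_cost, tick_cost,
        if_true, ev_cons, List.length_cons]
      refine ⟨h6, ?_, by nlinarith⟩
      rw [h7, ev_xorT h4, h2, pow_succ]; ring

theorem mulT_spec (hg : pol (true :: g) = f) (a b : List Bool) (ha : a.length = g.length)
    (hb : b.length = g.length) :
    (mulT g a b).val.length = g.length ∧ ev f (mulT g a b).val = ev f a * ev f b ∧
      (mulT g a b).cost ≤ 3 * g.length ^ 2 + 6 * g.length + 3 := by
  obtain ⟨h1, h2, h3⟩ := hornerT_spec hg b hb (List.replicate g.length false) a (by simp)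
  simp only [mulT, Timed.bind_val, Timed.bind_cost, lengthT_val, lengthT_cost, replicateT_val,
    replicateT_cost]
  refine ⟨h1, by simp [h2], ?_⟩
  rw [ha] at h3
  nlinarith

theorem stripT_spec (r : List Bool) :
    pol (stripT r).val = pol r ∧ (stripT r).val.length ≤ r.length ∧
      (∀ b bs, (stripT r).val = b :: bs → b = true) ∧ (stripT r).cost ≤ r.length + 1 := by
  induction r with
  | nil => simp [stripT]
  | cons b bs ih =>
    cases b
    · obtain ⟨h1, h2, h3, h4⟩ := ih
      simp only [stripT, Timed.bind_val, Timed.bind_cost, tick_cost, List.length_cons]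
      exact ⟨by simp [h1, pol], by omega, h3, by omega⟩
    · simp [stripT]

theorem xorPrefixT_spec (as bs : List Bool) (h : bs.length ≤ as.length) :
    (xorPrefixT as bs).val.length = as.length ∧
      pol (xorPrefixT as bs).val = pol as + pol bs * X ^ (as.length - bs.length) ∧
      (xorPrefixT as bs).cost ≤ bs.length + 1 := by
  induction as generalizing bs with
  | nil => cases bs <;> simp_all [xorPrefixT, pol]
  | cons a as ih =>
    cases bs with
    | nil => simp [xorPrefixT, pol]
    | cons b bs =>
      obtain ⟨h1, h2, h3⟩ := ih bs (by simpa using h)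
      have h' : bs.length ≤ as.length := by simpa using h
      refine ⟨by simp [xorPrefixT, h1], ?_, by simp [xorPrefixT]; omega⟩
      obtain ⟨t, ht⟩ := Nat.exists_eq_add_of_le h'
      simp only [xorPrefixT, Timed.bind_val, Timed.pure_val, pol, h1, h2, List.length_cons]
      rw [show as.length + 1 - (bs.length + 1) = t by omega, show as.length - bs.length = t by omega,
        ht]
      have h2 : (X ^ (bs.length + t) + X ^ (bs.length + t) : (ZMod 2)[X]) = 0 :=
        CharTwo.add_self_eq_zero _
      cases a <;> cases b <;> simp
      · ring
      · ring
      · linear_combination -h2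

/-- Each step cancels the current leading bit with a multiple of the divisor. The power of `X`
occurs because only the leading `n` quotient bits are produced; in the Euclidean algorithm `n` is
such that its exponent is zero. -/
theorem divT_spec (d : List Bool) (n : ℕ) (r : List Bool) (h : n + d.length ≤ r.length) :
    (divT d n r).val.1.length = n ∧ (divT d n r).val.2.length = r.length - n ∧
      pol r = pol (divT d n r).val.1 * X ^ (r.length - n - d.length) * pol (true :: d) +
        pol (divT d n r).val.2 ∧
      (divT d n r).cost ≤ n * (d.length + 2) + 1 := by
  induction n generalizing r with
  | zero => simp [divT, pol]
  | succ n ih =>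
    cases r with
    | nil => simp at h
    | cons b bs =>
      rw [List.length_cons] at h
      obtain ⟨h1, h2, h3⟩ := xorPrefixT_spec bs d (by omega)
      obtain ⟨t, ht⟩ := Nat.exists_eq_add_of_le h
      cases b
      · obtain ⟨h4, h5, h6, h7⟩ := ih bs (by omega)
        simp only [divT, Timed.bind_val, Timed.bind_cost, tick_cost, Bool.false_eq_true, if_false,
          Timed.pure_val, Timed.pure_cost, List.length_cons, h4, h5]
        refine ⟨trivial, by omega, ?_, by nlinarith⟩
        rw [show bs.length + 1 - (n + 1) = bs.length - n by omega, pol]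
        nth_rw 1 [h6]
        simp [pol]
      · obtain ⟨h4, h5, h6, h7⟩ := ih (xorPrefixT bs d).val (by omega)
        simp only [divT, Timed.bind_val, Timed.bind_cost, tick_cost, if_true,
          Timed.pure_val, Timed.pure_cost, List.length_cons, h4, h5, h1]
        refine ⟨trivial, by omega, ?_, by nlinarith⟩
        rw [h1, h2, show bs.length - n - d.length = t by omega,
          show bs.length - d.length = n + t by omega] at h6
        rw [show bs.length + 1 - (n + 1) - d.length = t by omega]
        simp only [pol, if_true, h4] at h6 ⊢
        rw [show bs.length = n + t + d.length by omega]
        have h8 : (pol d * X ^ (n + t) + pol d * X ^ (n + t) : (ZMod 2)[X]) = 0 :=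
          CharTwo.add_self_eq_zero _
        linear_combination h6 - h8

theorem pol_eq_one_of_isUnit {p : (ZMod 2)[X]} (h : IsUnit p) : p = 1 := by
  obtain ⟨r, hr, rfl⟩ := isUnit_iff.1 h
  have : r = 1 := by
    have := hr.ne_zero
    revert this; clear hr h; revert r; decide
  rw [this, C_1]

/-- The invariants are the two cofactor relations and the coprimality of the remainders. The fuel
`n` suffices because the second remainder gets shorter in each round. In the cost, a round with `m`
quotient bits spends about `m * (4 * g.length + 5)`: all but one of these `m` portions are paid by
the shrinking of `r₀`, the last one by the round itself. Thus the total is quadratic, not cubic. -/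
theorem euclidT_spec (hg : pol (true :: g) = f) (a : AdjoinRoot f) (n : ℕ)
    (r₀ s₀ r₁ s₁ : List Bool) (hr : r₁.length < r₀.length) (hr₀ : r₀.length ≤ g.length + 1)
    (hn : r₁.length < n) (h₀ : s₀.length = g.length) (h₁ : s₁.length = g.length)
    (e₀ : ev f r₀ = ev f s₀ * a) (e₁ : ev f r₁ = ev f s₁ * a)
    (hco : IsCoprime (pol r₀) (pol r₁)) :
    (euclidT g n r₀ s₀ r₁ s₁).val.length = g.length ∧
      ev f (euclidT g n r₀ s₀ r₁ s₁).val * a = 1 ∧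
      (euclidT g n r₀ s₀ r₁ s₁).cost ≤
        n * (10 * g.length + 14) + r₀.length * (4 * g.length + 5) + 1 := by
  induction n generalizing r₀ s₀ r₁ s₁ with
  | zero => omega
  | succ n ih =>
    obtain ⟨p1, p2, p3, p4⟩ := stripT_spec r₁
    rcases hs : (stripT r₁).val with _ | ⟨b, d⟩
    · simp only [euclidT, Timed.bind_val, Timed.bind_cost, tick_cost, hs, Timed.pure_val,
        Timed.pure_cost]
      refine ⟨h₀, ?_, by nlinarith⟩
      -- A vanishing second remainder makes the first one a unit by coprimality, hence `1` over
      -- `𝔽₂`, so its cofactor is the inverse.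
      rw [hs] at p1
      rw [← p1, pol, isCoprime_zero_right] at hco
      rw [← e₀, ev, pol_eq_one_of_isUnit hco, map_one]
    · obtain rfl := p3 b d hs
      rw [hs] at p1 p2
      rw [List.length_cons] at p2
      obtain ⟨m, hm⟩ := Nat.exists_eq_add_of_le (show d.length ≤ r₀.length by omega)
      obtain ⟨q1, q2, q3, q4⟩ := divT_spec d m r₀ (by omega)
      obtain ⟨t1, t2, t3⟩ := hornerT_spec hg s₁ h₁ (List.replicate g.length false)
        (divT d m r₀).val.1 (by simp)
      have t4 : s₀.length = (hornerT g s₁ (List.replicate g.length false)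
        (divT d m r₀).val.1).val.length := by rw [t1, h₀]
      rw [show r₀.length - m - d.length = 0 by omega, pow_zero, mul_one] at q3
      have x1 := xorT_cost_le s₀ (hornerT g s₁ (List.replicate g.length false)
        (divT d m r₀).val.1).val
      rw [ev_replicate, zero_mul, zero_add] at t2
      have e₂ : ev f (divT d m r₀).val.2 = ev f (xorT s₀ (hornerT g s₁
          (List.replicate g.length false) (divT d m r₀).val.1).val).val * a := by
        rw [ev_xorT t4, t2]
        have h := congrArg (AdjoinRoot.mk f) q3
        rw [map_add, map_mul, p1] at h
        change ev f r₀ = ev f _ * ev f r₁ + ev f _ at h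
        have h2 := add_self_adjoinRoot (ev f (divT d m r₀).val.1 * ev f s₁ * a)
        rw [e₀, e₁] at h
        linear_combination -h - h2
      obtain ⟨i1, i2, i3⟩ := ih (true :: d) s₁ (divT d m r₀).val.2 _ (by simp; omega)
        (by simp; omega) (by omega) h₁ ((length_xorT t4).trans h₀)
        (by rw [ev, p1]; exact e₁) e₂ (by
          rw [← p1] at hco
          rw [q3] at hco
          have := hco.symm
          rwa [add_comm, IsCoprime.add_mul_right_right_iff] at this)
      simp only [euclidT, Timed.bind_val, Timed.bind_cost, tick_cost, hs, lengthT_val,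
        lengthT_cost, replicateT_val, replicateT_cost, show r₀.length - d.length = m by omega]
      refine ⟨i1, i2, ?_⟩
      rw [List.length_cons] at i3
      rw [q1] at t3
      have k1 : m * (d.length + 2) ≤ m * (g.length + 1) := Nat.mul_le_mul_left _ (by omega)
      rw [hm]
      rw [h₀] at x1
      nlinarith

/-- Euclid starts from `f = 0 * a` and `a = 1 * a` at the root; coprimality holds since the
irreducible `f` does not divide `a`. -/
theorem invT_spec (hf : Irreducible f) (hg : pol (true :: g) = f) (h0 : 1 ≤ g.length)
    (a : List Bool) (ha : a.length = g.length) (hne : ev f a ≠ 0) :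
    (invT g a).val.length = g.length ∧ ev f (invT g a).val * ev f a = 1 ∧
      (invT g a).cost ≤ 14 * g.length ^ 2 + 40 * g.length + 30 := by
  have hone : (List.replicate (g.length - 1) false ++ [true]).length = g.length := by
    simp; omega
  have hco : IsCoprime (pol (true :: g)) (pol a) := by
    rw [hg, hf.coprime_iff_not_dvd]
    intro h
    exact hne (AdjoinRoot.mk_eq_zero.2 h)
  obtain ⟨i1, i2, i3⟩ := euclidT_spec hg (ev f a) (g.length + 1) (true :: g)
    (List.replicate g.length false) a (List.replicate (g.length - 1) false ++ [true])
    (by simp [ha]) (by simp) (by omega) (by simp) hone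
    (by rw [ev, hg]; simp) (by simp [ev, pol_append, pol]) hco
  simp only [invT, Timed.bind_val, Timed.bind_cost, lengthT_val,
    lengthT_cost, replicateT_val, replicateT_cost, appendT_val, appendT_cost, List.length_replicate]
  refine ⟨i1, i2, ?_⟩
  rw [List.length_cons] at i3
  have : g.length - 1 ≤ g.length := Nat.sub_le _ _
  nlinarith

end field

end

end GC

/-! ### Linear algebra over the field, on bit strings -/

namespace GC

noncomputable section

section field

variable {f : (ZMod 2)[X]} {g : List Bool}

theorem mulT_cost_le (hg : pol (true :: g) = f) (h0 : 1 ≤ g.length) {a b : List Bool}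
    (ha : a.length = g.length) (hb : b.length = g.length) :
    (mulT g a b).cost ≤ 12 * g.length ^ 2 := by
  have := (mulT_spec hg a b ha hb).2.2
  nlinarith

theorem length_mulT (hg : pol (true :: g) = f) {a b : List Bool}
    (ha : a.length = g.length) (hb : b.length = g.length) :
    (mulT g a b).val.length = g.length := (mulT_spec hg a b ha hb).1

theorem ev_mulT (hg : pol (true :: g) = f) {a b : List Bool}
    (ha : a.length = g.length) (hb : b.length = g.length) :
    ev f (mulT g a b).val = ev f a * ev f b := (mulT_spec hg a b ha hb).2.1

/-- The inner product of two lists; surplus entries are ignored. -/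
def dot {F : Type*} [CommRing F] (xs ys : List F) : F := (List.zipWith (· * ·) xs ys).sum

@[simp] theorem dot_cons {F : Type*} [CommRing F] (x y : F) (xs ys : List F) :
    dot (x :: xs) (y :: ys) = x * y + dot xs ys := by simp [dot]

@[simp] theorem dot_nil_left {F : Type*} [CommRing F] (ys : List F) : dot [] ys = 0 := by
  simp [dot]

@[simp] theorem dot_nil_right {F : Type*} [CommRing F] (xs : List F) : dot xs [] = 0 := by
  simp [dot]

theorem dot_map_mul {F : Type*} [CommRing F] (a : F) (xs ys : List F) :
    dot (xs.map (a * ·)) ys = a * dot xs ys := by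
  induction xs generalizing ys with
  | nil => simp
  | cons x xs ih => cases ys <;> simp [ih]; ring

theorem dot_zipWith {F : Type*} [CommRing F] (b : F) (as xs ys : List F)
    (h : as.length = xs.length) :
    dot (List.zipWith (fun a x => x + b * a) as xs) ys = dot xs ys + b * dot as ys := by
  induction as generalizing xs ys with
  | nil =>
    cases xs with
    | nil => simp
    | cons => simp at h
  | cons a as ih =>
    cases xs with
    | nil => simp at h
    | cons x xs =>
      cases ys with
      | nil => simp
      | cons y ys =>
        simp only [List.zipWith_cons_cons, dot_cons, ih xs ys (by simpa using h)]
        ring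

theorem dot_ofFn {F : Type*} [CommRing F] {n : ℕ} (x y : Fin n → F) :
    dot (List.ofFn x) (List.ofFn y) = ∑ i, x i * y i := by
  induction n with
  | zero => simp
  | succ n ih => simp [List.ofFn_succ, ih, Fin.sum_univ_succ]

theorem dotT_spec (hg : pol (true :: g) = f) (h0 : 1 ≤ g.length) (vs us : List (List Bool))
    (hv : ∀ v ∈ vs, v.length = g.length) (hu : ∀ u ∈ us, u.length = g.length) :
    (dotT g vs us).val.length = g.length ∧
      ev f (dotT g vs us).val = dot (vs.map (ev f)) (us.map (ev f)) ∧
      (dotT g vs us).cost ≤ (vs.length + 1) * (15 * g.length ^ 2) := by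
  induction vs generalizing us with
  | nil => simp [dotT]; nlinarith
  | cons v vs ih =>
    cases us with
    | nil => simp [dotT]; nlinarith
    | cons u us =>
      have hv1 := hv v (by simp)
      have hu1 := hu u (by simp)
      obtain ⟨h1, h2, h3⟩ := ih us (fun v h => hv v (by simp [h])) (fun u h => hu u (by simp [h]))
      have h4 : (mulT g v u).val.length = (dotT g vs us).val.length := by
        rw [h1, length_mulT hg hv1 hu1]
      have h5 := xorT_cost_le (mulT g v u).val (dotT g vs us).val
      have h6 := mulT_cost_le hg h0 hv1 hu1
      rw [h4, h1] at h5
      simp only [dotT, Timed.bind_val, Timed.bind_cost, tick_cost, List.map_cons, dot_cons,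
        List.length_cons]
      refine ⟨(length_xorT h4).trans (h4.trans h1), ?_, by nlinarith⟩
      rw [ev_xorT h4, h2, ev_mulT hg hv1 hu1]

theorem elimT_go_spec (hg : pol (true :: g) = f) (h0 : 1 ≤ g.length) (b : List Bool)
    (hb : b.length = g.length) (as xs : List (List Bool))
    (ha : ∀ v ∈ as, v.length = g.length) (hx : ∀ u ∈ xs, u.length = g.length) :
    (∀ v ∈ (elimT.go g b as xs).val, v.length = g.length) ∧
      (elimT.go g b as xs).val.map (ev f) =
        List.zipWith (fun a x => x + ev f b * a) (as.map (ev f)) (xs.map (ev f)) ∧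
      (elimT.go g b as xs).cost ≤ as.length * (15 * g.length ^ 2) + 1 := by
  induction as generalizing xs with
  | nil => simp [elimT.go]
  | cons a as ih =>
    cases xs with
    | nil => simp [elimT.go]
    | cons x xs =>
      have ha1 := ha a (by simp)
      have hx1 := hx x (by simp)
      obtain ⟨h1, h2, h3⟩ := ih xs (fun v h => ha v (by simp [h])) (fun u h => hx u (by simp [h]))
      have h4 : x.length = (mulT g b a).val.length := by rw [hx1, length_mulT hg hb ha1]
      have h5 := xorT_cost_le x (mulT g b a).val
      have h6 := mulT_cost_le hg h0 hb ha1
      rw [hx1] at h5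
      simp only [elimT.go, Timed.bind_val, Timed.bind_cost, tick_cost, List.map_cons,
        List.length_cons, Timed.pure_val, Timed.pure_cost, List.zipWith_cons_cons, List.mem_cons]
      refine ⟨?_, ?_, by nlinarith⟩
      · rintro v (rfl | hv)
        · exact (length_xorT h4).trans hx1
        · exact h1 v hv
      · rw [ev_xorT h4, h2, ev_mulT hg hb ha1]

/-- A linear equation all of whose symbols have the right length. -/
def WellFormed (g : List Bool) (n : ℕ) (row : List (List Bool) × List Bool) : Prop :=
  row.1.length = n ∧ (∀ v ∈ row.1, v.length = g.length) ∧ row.2.length = g.length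

theorem elimT_spec (hg : pol (true :: g) = f) (h0 : 1 ≤ g.length) (n : ℕ)
    (as : List (List Bool)) (s : List Bool) (hrow : WellFormed g n (as, s))
    (row : List (List Bool) × List Bool) (hrow' : WellFormed g (n + 1) row) :
    WellFormed g n (elimT g as s row).val ∧
      (∃ b bs, row.1.map (ev f) = b :: bs ∧ bs.length = n ∧
        (elimT g as s row).val.1.map (ev f) =
          List.zipWith (fun a x => x + b * a) (as.map (ev f)) bs ∧
        ev f (elimT g as s row).val.2 = ev f row.2 + b * ev f s) ∧
      (elimT g as s row).cost ≤ (n + 2) * (15 * g.length ^ 2) := by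
  obtain ⟨_ | ⟨b, bs⟩, t⟩ := row
  · simp [WellFormed] at hrow'
  obtain ⟨a1, a2, a3⟩ := hrow
  obtain ⟨b1, b2, b3⟩ := hrow'
  simp only [List.length_cons, Nat.add_right_cancel_iff] at b1
  simp only at a1 a2 a3 b2 b3
  have hb := b2 b (by simp)
  obtain ⟨c1, c2, c3⟩ := elimT_go_spec hg h0 b hb as bs a2 fun u h => b2 u (by simp [h])
  have h4 : t.length = (mulT g b s).val.length := by rw [b3, length_mulT hg hb a3]
  have h5 := xorT_cost_le t (mulT g b s).val
  have h6 := mulT_cost_le hg h0 hb a3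
  rw [b3] at h5
  simp only [elimT, Timed.bind_val, Timed.bind_cost, tick_cost, Timed.pure_val, Timed.pure_cost]
  refine ⟨⟨?_, c1, (length_xorT h4).trans b3⟩, ⟨ev f b, bs.map (ev f), rfl, by simpa using b1, c2,
    ?_⟩, ?_⟩
  · have := congrArg List.length c2
    simpa [a1, b1] using this
  · rw [ev_xorT h4, ev_mulT hg hb a3]
  · rw [a1] at c3
    nlinarith

/-- All leading square subsystems of a linear system have only the trivial solution. -/
def LeadingNonsingular {F : Type*} [CommRing F] (n : ℕ) (A : List (List F)) : Prop :=
  ∀ r ≤ n, ∀ x : List F, x.length = r → (∀ row ∈ A.take r, dot row x = 0) → ∀ c ∈ x, c = 0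

/-- Nonsingular leading subsystems give a nonzero pivot and are inherited by the eliminated system,
so no row exchange is needed. Only uniqueness is claimed: every solution equals the output. This is
enough, as the decoder checks all parities afterwards. `N` is a fixed upper bound for the number of
unknowns, so that the cost per unknown stays uniform in the induction. -/
theorem solveT_spec (hf : Irreducible f) (hg : pol (true :: g) = f) (h0 : 1 ≤ g.length) (N n : ℕ)
    (hn : n ≤ N) (rows : List (List (List Bool) × List Bool)) (hl : rows.length = n)
    (hw : ∀ row ∈ rows, WellFormed g n row)
    (hns : LeadingNonsingular n (rows.map fun row => row.1.map (ev f))) :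
    (solveT g n rows).val.length = n ∧ (∀ x ∈ (solveT g n rows).val, x.length = g.length) ∧
      (∀ xs : List (AdjoinRoot f), xs.length = n →
        (∀ row ∈ rows, dot (row.1.map (ev f)) xs = ev f row.2) →
          (solveT g n rows).val.map (ev f) = xs) ∧
      (solveT g n rows).cost ≤ n * (200 * (N + 1) ^ 2 * g.length ^ 2) + 1 := by
  have : Fact (Irreducible f) := ⟨hf⟩
  induction n generalizing rows with
  | zero =>
    obtain rfl := List.length_eq_zero_iff.1 hl
    simp [solveT]
  | succ n ih =>
    obtain _ | ⟨⟨_ | ⟨a, as⟩, s⟩, rows⟩ := rows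
    · simp at hl
    · have := (hw ([], s) (by simp)).1
      simp at this
    obtain ⟨a1, a2, a3⟩ := hw (a :: as, s) (by simp)
    simp only [List.length_cons, Nat.add_right_cancel_iff] at a1 hl
    simp only at a2 a3
    have ha := a2 a (by simp)
    have has : ∀ v ∈ as, v.length = g.length := fun v h => a2 v (by simp [h])
    have hne : ev f a ≠ 0 := by
      intro h
      -- The leading `1 × 1` subsystem has no nontrivial solution, so the pivot does not vanish.
      have := hns 1 (by omega) [1] rfl (by simp [h]) 1 (by simp)
      exact one_ne_zero this
    obtain ⟨i1, i2, i3⟩ := invT_spec hf hg h0 a ha hne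
    set i := (invT g a).val with hi
    have hs' := length_mulT hg i1 a3
    have es' := ev_mulT hg i1 a3
    set s' := (mulT g i s).val with hs
    set as' := as.map fun x => (mulT g i x).val with has'
    have eas : as'.map (ev f) = (as.map (ev f)).map (ev f i * ·) := by
      rw [has', List.map_map, List.map_map]
      refine List.map_congr_left fun x hx => ?_
      simpa using ev_mulT hg i1 (has x hx)
    have hwas : WellFormed g n (as', s') := by
      refine ⟨by simp [has', a1], fun v hv => ?_, hs'⟩
      obtain ⟨x, hx, rfl⟩ := List.mem_map.1 hv
      exact length_mulT hg i1 (has x hx)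
    have helim : ∀ row ∈ rows, _ := fun row hrow =>
      elimT_spec hg h0 n as' s' hwas row (hw row (by simp [hrow]))
    set rows' := rows.map fun row => (elimT g as' s' row).val with hrows'
    have hchar : ∀ x : AdjoinRoot f, x + x = 0 := add_self_adjoinRoot
    -- A null vector `x` of a leading part of the eliminated system extends to one of the original
    -- system: put the value forced by the normalized first equation in front.
    have hns' : LeadingNonsingular n (rows'.map fun row => row.1.map (ev f)) := by
      intro r hr x hx hrow c hc
      refine hns (r + 1) (by omega) (dot (as'.map (ev f)) x :: x) (by simp [hx]) ?_ c
        (by simp [hc])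
      intro row hrw
      rw [List.map_cons, List.take_succ_cons, List.mem_cons] at hrw
      rcases hrw with rfl | hrw
      · rw [List.map_cons, dot_cons, eas, dot_map_mul]
        linear_combination dot (as.map (ev f)) x * i2 + hchar (dot (as.map (ev f)) x)
      · rw [← List.map_take, List.mem_map] at hrw
        obtain ⟨rw', hrw', rfl⟩ := hrw
        obtain ⟨-, ⟨b, bs, e1, e2, e3, e4⟩, -⟩ := helim rw' (List.mem_of_mem_take hrw')
        rw [e1, dot_cons]
        have h := hrow (List.zipWith (fun a x => x + b * a) (as'.map (ev f)) bs) (by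
          rw [← e3, ← List.map_take, hrows', ← List.map_take, List.map_map]
          exact List.mem_map_of_mem (f := (fun row => row.1.map (ev f)) ∘ fun row =>
            (elimT g as' s' row).val) hrw')
        rw [dot_zipWith _ _ _ _ (by simp [has', a1, e2])] at h
        linear_combination h
    obtain ⟨j1, j2, j3, j4⟩ := ih (by omega) rows' (by simp [hrows', hl])
      (by
        intro row hrow
        obtain ⟨rw', hrw', rfl⟩ := List.mem_map.1 hrow
        exact (helim rw' hrw').1) hns'
    obtain ⟨k1, k2, k3⟩ := dotT_spec hg h0 as' (solveT g n rows').val hwas.2.1 j2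
    have k4 : s'.length = (dotT g as' (solveT g n rows').val).val.length := by rw [k1, hs']
    have k5 := xorT_cost_le s' (dotT g as' (solveT g n rows').val).val
    have c1 := mapT_cost_le (fun x => mulT g i x) as (12 * g.length ^ 2)
      fun x hx => mulT_cost_le hg h0 i1 (has x hx)
    have c2 := mulT_cost_le hg h0 i1 a3
    have c3 := mapT_cost_le (elimT g as' s') rows ((n + 2) * (15 * g.length ^ 2))
      fun row hrow => (helim row hrow).2.2
    have hval : (solveT g (n + 1) ((a :: as, s) :: rows)).val =
        (xorT s' (dotT g as' (solveT g n rows').val).val).val :: (solveT g n rows').val := by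
      simp only [solveT, Timed.bind_val, mapT_val, Timed.pure_val]
      rfl
    have hcost : (solveT g (n + 1) ((a :: as, s) :: rows)).cost =
        1 + ((invT g a).cost + ((mapT (fun x => mulT g i x) as).cost + ((mulT g i s).cost +
        ((mapT (elimT g as' s') rows).cost + ((solveT g n rows').cost +
        ((dotT g as' (solveT g n rows').val).cost +
          (xorT s' (dotT g as' (solveT g n rows').val).val).cost)))))) := by
      simp only [solveT, Timed.bind_cost, mapT_val, Timed.pure_cost, tick_cost, add_zero]
      rfl
    rw [hval, hcost]
    refine ⟨by simp [j1], ?_, ?_, ?_⟩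
    · intro x hx
      rcases List.mem_cons.1 hx with rfl | hx
      · exact (length_xorT k4).trans hs'
      · exact j2 x hx
    · intro xs hxs heq
      obtain _ | ⟨x, xs⟩ := xs
      · simp at hxs
      have h1 := heq (a :: as, s) (by simp)
      simp only [List.map_cons, dot_cons] at h1
      have hx : x = ev f s' + dot (as'.map (ev f)) xs := by
        rw [es', eas, dot_map_mul]
        have := hchar (ev f i * dot (as.map (ev f)) xs)
        linear_combination (-x) * i2 + ev f i * h1 - this
      have hsol : (solveT g n rows').val.map (ev f) = xs := by
        refine j3 xs (by simpa using hxs) fun row hrow => ?_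
        obtain ⟨rw', hrw', rfl⟩ := List.mem_map.1 hrow
        obtain ⟨-, ⟨b, bs, e1, e2, e3, e4⟩, -⟩ := helim rw' hrw'
        have h2 := heq rw' (by simp [hrw'])
        rw [e1, dot_cons] at h2
        rw [e3, e4, dot_zipWith _ _ _ _ (by simp [has', a1, e2])]
        have := hchar (b * ev f s')
        linear_combination h2 + b * (-hx) - this
      rw [List.map_cons, hsol, ev_xorT k4, k2, hsol, ← hx]
    · rw [hs'] at k5
      rw [a1] at c1
      rw [hl] at c3
      have : as'.length = n := hwas.1
      rw [this] at k3
      have hN : n * n ≤ N * N := Nat.mul_le_mul (by omega) (by omega)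
      have hg1 : g.length ≤ g.length ^ 2 := by nlinarith
      have hg2 : 1 ≤ g.length ^ 2 := by nlinarith
      generalize g.length ^ 2 = G at *
      have e1 : n * (n * G) ≤ N * (N * G) := by
        rw [← mul_assoc, ← mul_assoc]; exact Nat.mul_le_mul_right _ hN
      have e2 : n * G ≤ N * G := Nat.mul_le_mul_right _ (by omega)
      have e3 : n ≤ n * G := Nat.le_mul_of_pos_right _ hg2
      have e4 : (n + 1) * (200 * (N + 1) ^ 2 * G) =
        n * (200 * (N + 1) ^ 2 * G) + 200 * (N * (N * G)) + 400 * (N * G) + 200 * G := by ring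
      rw [e4]
      generalize n * (200 * (N + 1) ^ 2 * G) = R at *
      have z1 := Nat.zero_le (N * (N * G))
      have z2 := Nat.zero_le (N * G)
      linarith

end field

end

end GC

namespace GC

noncomputable section

section field

variable {f : (ZMod 2)[X]} {ℓ : ℕ}

/-! ### The encoder -/

theorem numBlocks_mul_le {k ℓ : ℕ} (h1 : 1 ≤ ℓ) (hk : ℓ ≤ k) : numBlocks k ℓ * ℓ ≤ 2 * k := by
  have := Nat.div_mul_le_self (k + ℓ - 1) ℓ
  rw [numBlocks]; omega

theorem le_numBlocks_mul {k ℓ : ℕ} (h1 : 1 ≤ ℓ) : k ≤ numBlocks k ℓ * ℓ := by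
  have := Nat.lt_div_mul_add (a := k + ℓ - 1) (b := ℓ) (by omega)
  rw [numBlocks]; omega

theorem numBlocks_mul_lt {k ℓ : ℕ} (h1 : 1 ≤ ℓ) : numBlocks k ℓ * ℓ < k + ℓ := by
  have := Nat.div_mul_le_self (k + ℓ - 1) ℓ
  rw [numBlocks]; omega

theorem one_le_numBlocks {k ℓ : ℕ} (h1 : 1 ≤ ℓ) (hk : ℓ ≤ k) : 1 ≤ numBlocks k ℓ :=
  (Nat.one_le_div_iff (by omega)).2 (by omega)

theorem encode_length (δ k ℓ c : ℕ) (f : (ZMod 2)[X])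
    (E : Matrix (Fin (numBlocks k ℓ)) (Fin c) (AdjoinRoot f)) (u : Fin k → Bool) :
    (encode δ k ℓ c f E u).length = k + c * (δ + 1) * ℓ := by
  simp [encode, List.length_flatten, List.length_flatMap, List.map_ofFn, Function.comp_def]
  ring

/-- Row `r` of the list `matrixBits f ℓ E`. -/
def rowBits {B c : ℕ} (f : (ZMod 2)[X]) (ℓ : ℕ) (E : Matrix (Fin B) (Fin c) (AdjoinRoot f))
    (r : Fin c) : List (List Bool) := List.ofFn fun j => List.ofFn (bits f ℓ (E j r))

theorem matrixBits_eq {B c : ℕ} (f : (ZMod 2)[X]) (ℓ : ℕ)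
    (E : Matrix (Fin B) (Fin c) (AdjoinRoot f)) :
    matrixBits f ℓ E = List.ofFn (rowBits f ℓ E) := rfl

@[simp] theorem length_rowBits {B c : ℕ} (f : (ZMod 2)[X]) (ℓ : ℕ)
    (E : Matrix (Fin B) (Fin c) (AdjoinRoot f)) (r : Fin c) : (rowBits f ℓ E r).length = B := by
  simp [rowBits]

theorem length_of_mem_rowBits {B c : ℕ} (E : Matrix (Fin B) (Fin c) (AdjoinRoot f)) (r : Fin c) :
    ∀ v ∈ rowBits f ℓ E r, v.length = (lowBits f ℓ).length := by
  intro v hv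
  rw [rowBits, List.mem_ofFn] at hv
  obtain ⟨j, rfl⟩ := hv
  simp

theorem dotT_rowBits (hf : Irreducible f) (hd : f.natDegree = ℓ) (h0 : 1 ≤ ℓ) {B c : ℕ}
    (E : Matrix (Fin B) (Fin c) (AdjoinRoot f)) (r : Fin c) (Y : Fin B → List Bool)
    (hY : ∀ j, (Y j).length = ℓ) :
    (dotT (lowBits f ℓ) (rowBits f ℓ E r) (List.ofFn Y)).val.length = ℓ ∧
      ev f (dotT (lowBits f ℓ) (rowBits f ℓ E r) (List.ofFn Y)).val =
        Matrix.vecMul (fun j => ev f (Y j)) E r ∧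
      (dotT (lowBits f ℓ) (rowBits f ℓ E r) (List.ofFn Y)).cost ≤ (B + 1) * (15 * ℓ ^ 2) := by
  obtain ⟨h1, h2, h3⟩ := dotT_spec (pol_lowBits hf hd) (by simpa using h0) (rowBits f ℓ E r)
    (List.ofFn Y) (length_of_mem_rowBits E r) (by
      intro v hv
      rw [List.mem_ofFn] at hv
      obtain ⟨j, rfl⟩ := hv
      simp [hY])
  refine ⟨by simpa using h1, ?_, by simpa using h3⟩
  rw [h2, rowBits, List.map_ofFn, List.map_ofFn, dot_ofFn, Matrix.vecMul, dotProduct]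
  refine Finset.sum_congr rfl fun j _ => ?_
  simp [ev_ofFn_bits hf hd, mul_comm]

theorem repeatT_val (δ : ℕ) (b : List Bool) :
    (repeatT δ b).val = b.flatMap (List.replicate (δ + 1)) := by
  simp [repeatT, List.flatMap]

theorem repeatT_cost_le (δ : ℕ) (b : List Bool) :
    (repeatT δ b).cost ≤ b.length * (2 * δ + 6) + 2 := by
  have h1 := mapT_cost_le (fun b => replicateT b (δ + 1)) b (δ + 2) fun _ _ => by simp
  have h2 := flattenT_cost_le (b.map (List.replicate (δ + 1))) (δ + 1) fun l hl => by
    obtain ⟨a, -, rfl⟩ := List.mem_map.1 hl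
    simp
  simp only [repeatT, Timed.bind_cost, mapT_val, replicateT_val]
  rw [List.length_map] at h2
  nlinarith

theorem encodeT_spec (hf : Irreducible f) (hd : f.natDegree = ℓ) (h0 : 1 ≤ ℓ) {k : ℕ} (hk : ℓ ≤ k)
    (δ c : ℕ) (E : Matrix (Fin (numBlocks k ℓ)) (Fin c) (AdjoinRoot f)) (u : Fin k → Bool) :
    (encodeT δ k ℓ (lowBits f ℓ) (matrixBits f ℓ E) (List.ofFn u)).val = encode δ k ℓ c f E u ∧
      (encodeT δ k ℓ (lowBits f ℓ) (matrixBits f ℓ E) (List.ofFn u)).cost ≤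
        ((100 + 2 * δ) * (c + 1)) * (k * ℓ) := by
  set U : Fin (numBlocks k ℓ) → List Bool := fun j => List.ofFn (block ℓ u j) with hU
  have hchunk : (chunkT (List.replicate (numBlocks k ℓ) ℓ) (List.ofFn u)).val = List.ofFn U := by
    rw [chunkT_replicate]; rfl
  have hdot := fun r => dotT_rowBits hf hd h0 E r U fun j => by simp [hU]
  set P : Fin c → List Bool := fun r => (dotT (lowBits f ℓ) (rowBits f ℓ E r) (List.ofFn U)).val
    with hP
  have hP' : ∀ r, P r =
      List.ofFn (bits f ℓ (Matrix.vecMul (fun j : Fin (numBlocks k ℓ) => symbol f (block ℓ u j)) E r)) := by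
    intro r
    refine ev_injective hf ((hdot r).1.trans hd.symm) (by simp [hd]) ?_
    rw [ev_ofFn_bits hf hd, (hdot r).2.1]
    simp [symbol_eq_ev, hU]
  have hmap : (matrixBits f ℓ E).map (fun row => (dotT (lowBits f ℓ) row (List.ofFn U)).val) =
      List.ofFn P := by
    rw [matrixBits_eq, List.map_ofFn]; rfl
  constructor
  · simp only [encodeT, Timed.bind_val, replicateT_val, hchunk, mapT_val, hmap, flattenT_val,
      repeatT_val, appendT_val, encode]
    congr 1
    simp_rw [← hP']
    rw [List.flatMap, List.map_flatten, List.flatten_flatten, List.map_ofFn, List.map_ofFn]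
    rfl
  · have c1 := chunkT_cost_le (List.replicate (numBlocks k ℓ) ℓ) (List.ofFn u) ℓ
      fun n hn => (List.eq_of_mem_replicate hn).le
    have c2 := mapT_cost_le (fun row => dotT (lowBits f ℓ) row (List.ofFn U)) (matrixBits f ℓ E)
      ((numBlocks k ℓ + 1) * (15 * ℓ ^ 2)) fun row hrow => by
        rw [matrixBits_eq, List.mem_ofFn] at hrow
        obtain ⟨r, rfl⟩ := hrow
        exact (hdot r).2.2
    have c3 := flattenT_cost_le (List.ofFn P) ℓ fun l hl => by
      rw [List.mem_ofFn] at hl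
      obtain ⟨r, rfl⟩ := hl
      exact (hdot r).1.le
    have c4 := repeatT_cost_le δ (List.ofFn P).flatten
    have hlen : (List.ofFn P).flatten.length = c * ℓ := by
      rw [List.length_flatten, List.map_ofFn, List.sum_ofFn]
      simp [hP, (hdot _).1]
    rw [hlen] at c4
    rw [matrixBits_eq, List.length_ofFn] at c2
    rw [List.length_ofFn] at c3
    rw [List.length_replicate] at c1
    simp only [encodeT, Timed.bind_cost, replicateT_val, replicateT_cost, hchunk, mapT_val, hmap,
      flattenT_val, repeatT_val, appendT_cost, List.length_ofFn]
    rw [matrixBits_eq]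
    have b1 := numBlocks_mul_le h0 hk
    have b2 : numBlocks k ℓ ≤ numBlocks k ℓ * ℓ := Nat.le_mul_of_pos_right _ h0
    have b3 : k ≤ k * ℓ := Nat.le_mul_of_pos_right _ h0
    have b4 : numBlocks k ℓ * ℓ ^ 2 ≤ 2 * (k * ℓ) := by nlinarith
    have b5 : ℓ ^ 2 ≤ k * ℓ := by nlinarith
    have b6 : ℓ ≤ k * ℓ := by nlinarith
    have b7 : 1 ≤ k * ℓ := by nlinarith
    generalize k * ℓ = X at *
    have d1 : c * ((numBlocks k ℓ + 1) * (15 * ℓ ^ 2) + 1) ≤ c * (46 * X) :=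
      Nat.mul_le_mul_left _ (by nlinarith)
    have d2 : c * ℓ * (2 * δ + 6) ≤ c * X * (2 * δ + 6) :=
      Nat.mul_le_mul_right _ (Nat.mul_le_mul_left _ b6)
    have d3 : c * (ℓ + 2) ≤ c * (3 * X) := Nat.mul_le_mul_left _ (by omega)
    have d4 : 0 ≤ δ * X := Nat.zero_le _
    have d5 : 0 ≤ c * X := Nat.zero_le _
    nlinarith

end field

end

end GC

namespace GC

noncomputable section

/-! ### The treatment of one case -/

-- Otherwise the codeword of `U` would have weight at most `Z.card + (c - R.card) ≤ c`, less than
-- the minimum distance. All uses of the MDS property of `E` in the decoding and counting arguments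
-- go through this.
open scoped Classical in
theorem IsSystematicMDS.eq_zero {F : Type*} [CommRing F] {B c : ℕ} {E : Matrix (Fin B) (Fin c) F}
    (hE : IsSystematicMDS E) (U : Fin B → F) (Z : Finset (Fin B)) (R : Finset (Fin c))
    (hZ : ∀ j ∉ Z, U j = 0) (hR : ∀ r ∈ R, Matrix.vecMul U E r = 0) (hc : Z.card ≤ R.card) :
    U = 0 := by
  by_contra hU
  have h := hE U hU
  have h1 : hammingNorm U ≤ Z.card := Finset.card_le_card fun j hj => by
    by_contra hjZ
    exact (Finset.mem_filter.1 hj).2 (hZ j hjZ)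
  have h2 : hammingNorm (Matrix.vecMul U E) ≤ Rᶜ.card := Finset.card_le_card fun r hr => by
    rw [Finset.mem_compl]
    exact fun hrR => (Finset.mem_filter.1 hr).2 (hR r hrR)
  have h3 := Finset.card_compl_add_card R
  rw [Fintype.card_fin] at h3
  have h4 : @hammingNorm (Fin B) (fun _ => F) _ _ _ U = hammingNorm U := rfl
  omega

/-- The entries at the positions where `d` does not vanish. -/
def affected {α : Type} {B : ℕ} (d : Fin B → ℕ) (a : Fin B → α) : List α :=
  ((List.finRange B).filter fun j => d j ≠ 0).map a

theorem affected_succ {α : Type} {B : ℕ} (d : Fin (B + 1) → ℕ) (a : Fin (B + 1) → α) :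
    affected d a = if d 0 = 0 then affected (fun j => d j.succ) (fun j => a j.succ)
      else a 0 :: affected (fun j => d j.succ) (fun j => a j.succ) := by
  have h : (List.filter (fun j => decide (d j ≠ 0)) (List.map Fin.succ (List.finRange B))) =
      ((List.finRange B).filter fun j => d j.succ ≠ 0).map Fin.succ := by
    rw [List.filter_map]; rfl
  split_ifs with h0
  · simp only [affected, List.finRange_succ, List.filter_cons, h]
    simp [h0, Function.comp_def]
  · simp only [affected, List.finRange_succ, List.filter_cons, h]
    simp [h0, Function.comp_def]

theorem map_affected {α β : Type} {B : ℕ} (d : Fin B → ℕ) (a : Fin B → α) (h : α → β) :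
    (affected d a).map h = affected d fun j => h (a j) := by
  simp [affected]

theorem mem_affected {α : Type} {B : ℕ} (d : Fin B → ℕ) (a : Fin B → α) (x : α) :
    x ∈ affected d a ↔ ∃ j, d j ≠ 0 ∧ a j = x := by
  simp [affected]

theorem length_affected {α : Type} {B : ℕ} (d : Fin B → ℕ) (a : Fin B → α) :
    (affected d a).length = (Finset.univ.filter fun j => d j ≠ 0).card := by
  rw [affected, List.length_map]
  rw [← List.toFinset_card_of_nodup ((List.nodup_finRange B).filter _)]
  congr 1
  ext j
  simp

theorem affected_injective {α : Type} {B : ℕ} {d : Fin B → ℕ} {a b : Fin B → α}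
    (h : affected d a = affected d b) (j : Fin B) (hj : d j ≠ 0) : a j = b j := by
  rw [affected, affected, List.map_inj_left] at h
  exact h j (by simp [hj])

theorem affectedT_val {α : Type} {B : ℕ} (d : Fin B → ℕ) (a : Fin B → α) :
    (affectedT (List.ofFn d) (List.ofFn a)).val = affected d a := by
  induction B with
  | zero => simp [affectedT, affected]
  | succ B ih => rw [affected_succ]; simp [List.ofFn_succ, affectedT, ih]

theorem affectedT_cost_le {α : Type} (ds : List ℕ) (as : List α) :
    (affectedT ds as).cost ≤ ds.length + 1 := by
  induction ds generalizing as with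
  | nil => cases as <;> simp [affectedT]
  | cons d ds ih =>
    cases as with
    | nil => simp [affectedT]
    | cons a as => simp [affectedT]; have := ih as; omega

theorem dot_affected {F : Type} [CommRing F] {B : ℕ} (d : Fin B → ℕ) (x y : Fin B → F) :
    dot (affected d x) (affected d y) = ∑ j, if d j = 0 then 0 else x j * y j := by
  induction B with
  | zero => simp [affected]
  | succ B ih =>
    rw [affected_succ, affected_succ d y, Fin.sum_univ_succ]
    split_ifs <;> simp [ih]

/-- A vector of coefficients for the leading affected positions, extended by zeros. -/
theorem exists_dot_affected {F : Type} [CommRing F] {B : ℕ} (d : Fin B → ℕ) (xs : List F)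
    (h : xs.length ≤ (affected d (fun _ => ())).length) :
    ∃ (y : Fin B → F) (Z : Finset (Fin B)), (∀ j ∉ Z, y j = 0) ∧ Z.card ≤ xs.length ∧
      (∀ x : Fin B → F, dot (affected d x) xs = ∑ j, x j * y j) ∧ (y = 0 → ∀ c ∈ xs, c = 0) := by
  induction B generalizing xs with
  | zero =>
    refine ⟨0, ∅, by simp, by simp, by simp [affected], fun _ => ?_⟩
    simp [affected] at h
    simp [h]
  | succ B ih =>
    rw [affected_succ] at h
    split_ifs at h with h0
    · obtain ⟨y, Z, h1, h2, h3, h4⟩ := ih (fun j => d j.succ) xs h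
      refine ⟨Fin.cons 0 y, Z.map (Fin.succEmb B), ?_, by simpa using h2, ?_, ?_⟩
      · intro j
        refine Fin.cases (by simp) (fun j hj => ?_) j
        rw [Fin.cons_succ]
        exact h1 j fun hjZ => hj (by simpa using hjZ)
      · intro x
        rw [affected_succ, if_pos h0, h3, Fin.sum_univ_succ]
        simp
      · intro hy
        exact h4 (funext fun j => by simpa using congrFun hy j.succ)
    · obtain _ | ⟨x₀, xs⟩ := xs
      · exact ⟨0, ∅, by simp, by simp, by simp, by simp⟩
      obtain ⟨y, Z, h1, h2, h3, h4⟩ := ih (fun j => d j.succ) xs (by simpa using h)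
      refine ⟨Fin.cons x₀ y, Finset.cons 0 (Z.map (Fin.succEmb B)) (by simp),
        ?_, by simpa using h2, ?_, ?_⟩
      · intro j
        refine Fin.cases (by simp) (fun j hj => ?_) j
        rw [Fin.cons_succ]
        exact h1 j fun hjZ => hj (by simpa using hjZ)
      · intro x
        rw [affected_succ, if_neg h0, dot_cons, h3, Fin.sum_univ_succ]
        simp
      · intro hy c hc
        rcases List.mem_cons.1 hc with rfl | hc
        · simpa using congrFun hy 0
        · exact h4 (funext fun j => by simpa using congrFun hy j.succ) c hc

theorem maskT_val (z : List Bool) {B : ℕ} (d : Fin B → ℕ) (a : Fin B → List Bool) :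
    (maskT z (List.ofFn d) (List.ofFn a)).val = List.ofFn fun j => if d j = 0 then a j else z := by
  induction B with
  | zero => simp [maskT]
  | succ B ih => simp [List.ofFn_succ, maskT, ih]

theorem maskT_cost_le (z : List Bool) (ds : List ℕ) (as : List (List Bool)) :
    (maskT z ds as).cost ≤ ds.length + 1 := by
  induction ds generalizing as with
  | nil => cases as <;> simp [maskT]
  | cons d ds ih =>
    cases as with
    | nil => simp [maskT]
    | cons a as => simp [maskT]; have := ih as; omega

theorem fillT_spec {B : ℕ} (d : Fin B → ℕ) (a : Fin B → List Bool) (xs : List (List Bool))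
    (h : xs.length = (affected d (fun _ => ())).length) :
    ∃ Y : Fin B → List Bool, (fillT (List.ofFn d) (List.ofFn a) xs).val = List.ofFn Y ∧
      (∀ j, d j = 0 → Y j = a j) ∧ affected d Y = xs := by
  induction B generalizing xs with
  | zero =>
    refine ⟨a, by simp [fillT], fun j => j.elim0, ?_⟩
    simp [affected] at h
    simp [affected, h]
  | succ B ih =>
    rw [affected_succ] at h
    split_ifs at h with h0
    · obtain ⟨Y, h1, h2, h3⟩ := ih (fun j => d j.succ) (fun j => a j.succ) xs h
      refine ⟨Fin.cons (a 0) Y, ?_, ?_, ?_⟩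
      · simp [List.ofFn_succ, fillT, h0, h1]
      · intro j
        refine Fin.cases (by simp) (fun j hj => ?_) j
        simpa using h2 j hj
      · rw [affected_succ, if_pos h0]
        simpa using h3
    · obtain _ | ⟨x, xs⟩ := xs
      · simp at h
      obtain ⟨Y, h1, h2, h3⟩ := ih (fun j => d j.succ) (fun j => a j.succ) xs (by simpa using h)
      refine ⟨Fin.cons x Y, ?_, ?_, ?_⟩
      · simp [List.ofFn_succ, fillT, h0, h1]
      · intro j
        refine Fin.cases (fun h => absurd h h0) (fun j hj => ?_) j
        simpa using h2 j hj
      · rw [affected_succ, if_neg h0]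
        simpa using h3

theorem fillT_cost_le (ds : List ℕ) (as xs : List (List Bool)) :
    (fillT ds as xs).cost ≤ ds.length + 1 := by
  induction ds generalizing as xs with
  | nil => cases as <;> simp [fillT]
  | cons d ds ih =>
    cases as with
    | nil => simp [fillT]
    | cons a as =>
      have := ih as xs
      by_cases h0 : d = 0
      · simp [fillT, h0]; omega
      · obtain _ | ⟨x, xs⟩ := xs
        · simp [fillT, h0]
        · have := ih as xs
          simp [fillT, h0]; omega

theorem equationsT_val (g : List Bool) {c : ℕ} (ds : List ℕ) (known : List (List Bool))
    (rows : Fin c → List (List Bool)) (P : Fin c → List Bool) :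
    (equationsT g ds known (List.ofFn rows) (List.ofFn P)).val =
      List.ofFn fun r => ((affectedT ds (rows r)).val,
        (xorT (P r) (dotT g (rows r) known).val).val) := by
  induction c with
  | zero => simp [equationsT]
  | succ c ih => simp [List.ofFn_succ, equationsT, ih]

theorem equationsT_cost_le (g : List Bool) {c : ℕ} (ds : List ℕ) (known : List (List Bool))
    (rows : Fin c → List (List Bool)) (P : Fin c → List Bool) (K ℓ : ℕ)
    (hK : ∀ r, (dotT g (rows r) known).cost ≤ K) (hP : ∀ r, (P r).length = ℓ) :
    (equationsT g ds known (List.ofFn rows) (List.ofFn P)).cost ≤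
      c * (ds.length + K + ℓ + 3) + 1 := by
  induction c with
  | zero => simp [equationsT]
  | succ c ih =>
    have h1 := ih (fun r => rows r.succ) (fun r => P r.succ) (fun r => hK _) (fun r => hP _)
    have h2 := affectedT_cost_le ds (rows 0)
    have h3 := hK 0
    have h4 := xorT_cost_le (P 0) (dotT g (rows 0) known).val
    rw [hP] at h4
    simp only [List.ofFn_succ, equationsT, Timed.bind_cost, tick_cost, Timed.pure_cost]
    linarith

theorem checkParitiesT_val (g : List Bool) {c : ℕ} (Y : List (List Bool))
    (rows : Fin c → List (List Bool)) (P : Fin c → List Bool) :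
    (checkParitiesT g Y (List.ofFn rows) (List.ofFn P)).val = true ↔
      ∀ r, (dotT g (rows r) Y).val = P r := by
  induction c with
  | zero => simp [checkParitiesT]
  | succ c ih =>
    simp only [List.ofFn_succ, checkParitiesT, Timed.bind_val, Timed.ite_val, Timed.pure_val,
      eqT_val, decide_eq_true_eq, Fin.forall_fin_succ]
    split_ifs with h
    · simp [ih, h]
    · simp [h]

theorem checkParitiesT_cost_le (g : List Bool) {c : ℕ} (Y : List (List Bool))
    (rows : Fin c → List (List Bool)) (P : Fin c → List Bool) (K ℓ : ℕ)
    (hK : ∀ r, (dotT g (rows r) Y).cost ≤ K) (hP : ∀ r, (dotT g (rows r) Y).val.length = ℓ) :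
    (checkParitiesT g Y (List.ofFn rows) (List.ofFn P)).cost ≤ c * (K + ℓ + 2) + 1 := by
  induction c with
  | zero => simp [checkParitiesT]
  | succ c ih =>
    have h1 := ih (fun r => rows r.succ) (fun r => P r.succ) (fun r => hK _) (fun r => hP _)
    have h3 := hK 0
    have h4 := eqT_cost_le (dotT g (rows 0) Y).val (P 0)
    rw [hP] at h4
    simp only [List.ofFn_succ, checkParitiesT, Timed.bind_cost, tick_cost, Timed.ite_cost,
      Timed.pure_cost]
    split_ifs <;> nlinarith

theorem checkSubseqT_val {B : ℕ} (Y C : Fin B → List Bool) :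
    (checkSubseqT (List.ofFn Y) (List.ofFn C)).val = true ↔ ∀ j, (Y j).Sublist (C j) := by
  induction B with
  | zero => simp [checkSubseqT]
  | succ B ih =>
    simp only [List.ofFn_succ, checkSubseqT, Timed.bind_val, Timed.ite_val, Timed.pure_val,
      Fin.forall_fin_succ, ← subseqT_val (Y 0)]
    split_ifs with h
    · simp [ih, h]
    · simp [h]

theorem checkSubseqT_cost_le (ys bs : List (List Bool)) (K : ℕ) (h : ∀ b ∈ bs, b.length ≤ K) :
    (checkSubseqT ys bs).cost ≤ bs.length * (K + 2) + 1 := by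
  induction bs generalizing ys with
  | nil => cases ys <;> simp [checkSubseqT]
  | cons b bs ih =>
    cases ys with
    | nil => simp [checkSubseqT]
    | cons y ys =>
      have h1 := ih ys fun b hb => h b (by simp [hb])
      have h2 := subseqT_cost_le y b
      have h3 := h b (by simp)
      simp only [checkSubseqT, Timed.bind_cost, tick_cost, Timed.ite_cost,
        Timed.pure_cost, List.length_cons]
      split_ifs <;> nlinarith

@[simp] theorem length_chunk {B : ℕ} (ℓ : ℕ) (s : List Bool) (d : Fin B → ℕ) (j : Fin B) :
    (chunk ℓ s d j).length = ℓ + d j := by simp [chunk]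

section field

variable {f : (ZMod 2)[X]} {ℓ : ℕ}

/-- Success implies a possible case because of the two final checks. Conversely, the affected
symbols of any possible decoding solve the linear system, and the solver returns every solution. The
cost is dominated by `2 c` inner products of length `B` and by solving for at most `δ` unknowns. -/
theorem tryCaseT_spec (hf : Irreducible f) (hd : f.natDegree = ℓ) (h0 : 1 ≤ ℓ) {B c δ : ℕ}
    (hc : δ < c) (hB : 1 ≤ B) (E : Matrix (Fin B) (Fin c) (AdjoinRoot f)) (hE : IsSystematicMDS E)
    (P : Fin c → List Bool) (hP : ∀ r, (P r).length = ℓ) (s : List Bool) (d : Fin B → ℕ)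
    (hsum : ∑ j, d j ≤ δ) :
    (∀ Z, (tryCaseT ℓ (lowBits f ℓ) (matrixBits f ℓ E) (List.ofFn P) s (List.ofFn d)).val = some Z ↔
      ∃ Y : Fin B → Fin ℓ → Bool, Z = List.ofFn (fun j => List.ofFn (Y j)) ∧
        IsPossible f E (fun r => ev f (P r)) s d Y) ∧
    (tryCaseT ℓ (lowBits f ℓ) (matrixBits f ℓ E) (List.ofFn P) s (List.ofFn d)).cost ≤
      (100 * (c + 1) + 300 * (δ + 1) ^ 3) * (B * ℓ ^ 2) := by
  have hg := pol_lowBits hf hd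
  have hdle : ∀ j, d j ≤ δ := fun j =>
    (Finset.single_le_sum (fun _ _ => Nat.zero_le _) (Finset.mem_univ j)).trans hsum
  set w := (affected d (fun _ => ())).length with hw
  have hwlen : ∀ {α : Type} (a : Fin B → α), (affected d a).length = w := by
    intro α a; rw [hw, length_affected, length_affected]
  have hwδ : w ≤ δ := by
    rw [hw, length_affected, Finset.card_eq_sum_ones]
    refine le_trans ?_ hsum
    rw [Finset.sum_filter]
    refine Finset.sum_le_sum fun j _ => ?_
    split_ifs <;> omega
  set C : Fin B → List Bool := chunk ℓ s d with hC
  have hClen : ∀ j, (C j).length = ℓ + d j := length_chunk ℓ s d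
  set z : List Bool := List.replicate ℓ false with hz
  set known : Fin B → List Bool := fun j => if d j = 0 then C j else z with hknown
  have hkl : ∀ j, (known j).length = ℓ := by
    intro j
    simp only [hknown]
    split_ifs with h
    · rw [hClen, h, add_zero]
    · simp [hz]
  have hsizes : (mapT (fun d => do tick; return ℓ + d) (List.ofFn d)).val =
      List.ofFn fun j => ℓ + d j := by
    rw [mapT_val, List.map_ofFn]; rfl
  have hchunks : (chunkT (List.ofFn fun j => ℓ + d j) s).val = List.ofFn C := chunkT_ofFn ℓ d s
  have hmask : (maskT z (List.ofFn d) (List.ofFn C)).val = List.ofFn known := maskT_val z d C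
  have hdk := fun r => dotT_rowBits hf hd h0 E r known hkl
  set eq : Fin c → List (List Bool) × List Bool := fun r =>
    (affected d fun j => List.ofFn (bits f ℓ (E j r)),
      (xorT (P r) (dotT (lowBits f ℓ) (rowBits f ℓ E r) (List.ofFn known)).val).val) with heq
  have heqs : (equationsT (lowBits f ℓ) (List.ofFn d) (List.ofFn known)
      (List.ofFn (rowBits f ℓ E)) (List.ofFn P)).val = List.ofFn eq := by
    rw [equationsT_val]
    congr 1
    funext r
    rw [rowBits, affectedT_val, heq]
    rfl
  have hmem : ∀ {r : ℕ} {row}, row ∈ (List.ofFn eq).take r → ∃ i : Fin c, row = eq i := by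
    intro r row h
    obtain ⟨i, hi⟩ := (List.mem_ofFn' _ _).1 (List.mem_of_mem_take h)
    exact ⟨i, hi.symm⟩
  have hxl : ∀ r, (P r).length =
      (dotT (lowBits f ℓ) (rowBits f ℓ E r) (List.ofFn known)).val.length := by
    intro r; rw [hP, (hdk r).1]
  have hwf : ∀ row ∈ (List.ofFn eq).take w, WellFormed (lowBits f ℓ) w row := by
    intro row h
    obtain ⟨r, rfl⟩ := hmem h
    refine ⟨hwlen _, ?_, ?_⟩
    · intro v hv
      obtain ⟨j, -, rfl⟩ := (mem_affected _ _ _).1 hv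
      simp
    · rw [length_lowBits, heq]
      exact (length_xorT (hxl r)).trans (hP r)
  have hcoef : ∀ r, (eq r).1.map (ev f) = affected d fun j => E j r := by
    intro r
    rw [heq, map_affected]
    simp [ev_ofFn_bits hf hd]
  -- A null vector of the first `r` equations in the first `r` unknowns, extended by zeros, is a
  -- message with at most `r` nonzero symbols and `r` vanishing parities.
  have hns : LeadingNonsingular w (((List.ofFn eq).take w).map fun row => row.1.map (ev f)) := by
    intro r hr x hx hrow
    obtain ⟨y, Z, y1, y2, y3, y4⟩ := exists_dot_affected d x (by omega)
    apply y4
    refine hE.eq_zero y Z (Finset.univ.filter fun i : Fin c => (i : ℕ) < r) y1 ?_ ?_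
    · intro i hi
      have hi : (i : ℕ) < r := by simpa using hi
      have := hrow (affected d fun j => E j i) (by
        rw [← List.map_take, List.take_take, min_eq_left hr, List.mem_map]
        refine ⟨eq i, ?_, hcoef i⟩
        rw [List.mem_take_iff_getElem]
        exact ⟨i, by simp [hi], by simp⟩)
      rw [y3] at this
      rw [Matrix.vecMul, dotProduct, ← this]
      exact Finset.sum_congr rfl fun j _ => mul_comm _ _
    · have : (Finset.univ.filter fun i : Fin c => (i : ℕ) < r).card = r := by
        rw [Fin.card_filter_val_lt]; omega
      omega
  obtain ⟨s1, s2, s3, s4⟩ := solveT_spec hf hg (by simpa using h0) δ w hwδ ((List.ofFn eq).take w)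
    (by simp; omega) hwf hns
  set xs := (solveT (lowBits f ℓ) w ((List.ofFn eq).take w)).val with hxs
  obtain ⟨Y, f1, f2, f3⟩ := fillT_spec d C xs (by rw [s1])
  have hYl : ∀ j, (Y j).length = ℓ := by
    intro j
    by_cases h : d j = 0
    · rw [f2 j h, hClen, h, add_zero]
    · have := s2 (Y j) (by rw [← f3, mem_affected]; exact ⟨j, h, rfl⟩)
      simpa using this
  have hdY := fun r => dotT_rowBits hf hd h0 E r Y hYl
  have hpar := checkParitiesT_val (lowBits f ℓ) (List.ofFn Y) (rowBits f ℓ E) P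
  have hsub := checkSubseqT_val Y C
  have hsys : (takeT w (List.ofFn eq)).val = (List.ofFn eq).take w := takeT_val _ _
  have hval : (tryCaseT ℓ (lowBits f ℓ) (matrixBits f ℓ E) (List.ofFn P) s (List.ofFn d)).val =
      if (checkParitiesT (lowBits f ℓ) (List.ofFn Y) (List.ofFn (rowBits f ℓ E))
        (List.ofFn P)).val && (checkSubseqT (List.ofFn Y) (List.ofFn C)).val
      then some (List.ofFn Y) else none := by
    simp only [tryCaseT, Timed.bind_val, hsizes, hchunks, replicateT_val, ← hz, hmask, heqs,
      affectedT_val, lengthT_val, hwlen, hsys, f1, Timed.pure_val, matrixBits_eq, ← hxs]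
  constructor
  · intro Z
    rw [hval]
    constructor
    · intro h
      split_ifs at h with hcond
      rw [Bool.and_eq_true, hpar, hsub] at hcond
      obtain ⟨h1, h2⟩ := hcond
      have hYof : ∀ j, List.ofFn (fun i : Fin ℓ => (Y j)[(i : ℕ)]'(by rw [hYl]; exact i.2)) =
          Y j := by
        intro j
        apply List.ext_getElem
        · simp [hYl]
        · simp
      refine ⟨fun j i => (Y j)[(i : ℕ)]'(by rw [hYl]; exact i.2), ?_, ?_, ?_, ?_⟩
      · simp only [hYof]
        exact (Option.some.inj h).symm
      · intro j hj
        rw [hYof, f2 j hj]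
      · funext r
        simp only [symbol_eq_ev, hYof]
        rw [← (hdY r).2.1, h1]
      · intro j hj
        rw [hYof]
        exact h2 j
    · rintro ⟨Y', rfl, p1, p2, p3⟩
      -- The right-hand sides are the parities plus the contribution of the known blocks; in
      -- characteristic two that contribution cancels and the erased blocks remain.
      have hsol := s3 (affected d fun j => symbol f (Y' j)) (hwlen _) (by
        intro row h
        obtain ⟨r, rfl⟩ := hmem h
        rw [hcoef, dot_affected, heq]
        simp only
        rw [ev_xorT (hxl r), (hdk r).2.1, ← congrFun p2 r, Matrix.vecMul, Matrix.vecMul, dotProduct,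
          dotProduct, ← Finset.sum_add_distrib]
        refine Finset.sum_congr rfl fun j _ => ?_
        simp only [hknown]
        split_ifs with hj
        · rw [show C j = List.ofFn (Y' j) from (p1 j hj).symm, ← symbol_eq_ev, add_self_adjoinRoot]
        · rw [hz, ev_replicate]; ring)
      have hYY : ∀ j, Y j = List.ofFn (Y' j) := by
        intro j
        by_cases hj : d j = 0
        · rw [f2 j hj, p1 j hj]
        · rw [← f3, map_affected] at hsol
          have := affected_injective hsol j hj
          rw [symbol_eq_ev] at this
          exact ev_injective hf (by rw [hYl, hd]) (by simp [hd]) this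
      have h1 : ∀ r, (dotT (lowBits f ℓ) (rowBits f ℓ E r) (List.ofFn Y)).val = P r := by
        intro r
        refine ev_injective hf (by rw [(hdY r).1, hd]) (by rw [hP, hd]) ?_
        rw [(hdY r).2.1, ← congrFun p2 r]
        simp only [hYY, ← symbol_eq_ev]
      have h2 : ∀ j, (Y j).Sublist (C j) := by
        intro j
        by_cases hj : d j = 0
        · rw [f2 j hj]
        · rw [hYY]; exact p3 j hj
      rw [if_pos (by rw [Bool.and_eq_true, hpar, hsub]; exact ⟨h1, h2⟩)]
      rw [show Y = fun j => List.ofFn (Y' j) from funext hYY]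
  · have hCle : ∀ b ∈ List.ofFn C, b.length ≤ ℓ + δ := by
      intro b hb
      obtain ⟨j, rfl⟩ := (List.mem_ofFn' _ _).1 hb
      rw [hClen]; have := hdle j; omega
    have c1 := mapT_cost_le (fun d => do tick; return ℓ + d) (List.ofFn d) 1 fun _ _ => by simp
    have c2 := chunkT_cost_le (List.ofFn fun j => ℓ + d j) s (ℓ + δ) fun b hb => by
      obtain ⟨j, rfl⟩ := (List.mem_ofFn' _ _).1 hb
      exact Nat.add_le_add_left (hdle j) ℓ
    have c3 := maskT_cost_le z (List.ofFn d) (List.ofFn C)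
    have c4 := equationsT_cost_le (lowBits f ℓ) (List.ofFn d) (List.ofFn known) (rowBits f ℓ E) P _
      ℓ (fun r => (hdk r).2.2) hP
    have c5 := affectedT_cost_le (List.ofFn d) (List.ofFn C)
    have c6 := takeT_cost_le w (List.ofFn eq)
    have c7 := fillT_cost_le (List.ofFn d) (List.ofFn C) xs
    have c8 := checkParitiesT_cost_le (lowBits f ℓ) (List.ofFn Y) (rowBits f ℓ E) P _
      ℓ (fun r => (hdY r).2.2) (fun r => (hdY r).1)
    have c9 := checkSubseqT_cost_le (List.ofFn Y) (List.ofFn C) (ℓ + δ) hCle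
    simp only [tryCaseT, Timed.bind_cost, hsizes, hchunks, replicateT_val, replicateT_cost, ← hz,
      hmask, heqs, affectedT_val, lengthT_val, lengthT_cost, hwlen, hsys, f1, Timed.pure_cost, ← hxs,
      matrixBits_eq]
    simp only [List.length_ofFn, length_lowBits] at c1 c2 c3 c4 c5 c6 c7 c8 c9 s4
    have b0 : 1 ≤ ℓ ^ 2 := Nat.one_le_pow _ _ h0
    have b1 : B * ℓ ≤ B * ℓ ^ 2 := Nat.mul_le_mul_left _ (Nat.le_self_pow two_ne_zero _)
    have b2 : B ≤ B * ℓ ^ 2 := Nat.le_mul_of_pos_right _ b0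
    have b3 : ℓ ^ 2 ≤ B * ℓ ^ 2 := Nat.le_mul_of_pos_left _ hB
    have b4 : ℓ ≤ ℓ ^ 2 := Nat.le_self_pow two_ne_zero _
    have a1 : w * (200 * (δ + 1) ^ 2 * ℓ ^ 2) ≤ δ * (200 * (δ + 1) ^ 2 * (B * ℓ ^ 2)) :=
      Nat.mul_le_mul hwδ (Nat.mul_le_mul_left _ b3)
    have a2 : (B + 1) * (15 * ℓ ^ 2) ≤ 30 * (B * ℓ ^ 2) := by nlinarith
    generalize (B + 1) * (15 * ℓ ^ 2) = D at *
    have b5 : δ * B ≤ δ * (B * ℓ ^ 2) := Nat.mul_le_mul_left _ b2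
    generalize ℓ ^ 2 = L at *
    have a3 : c * (B + D + ℓ + 3) ≤ c * (35 * (B * L)) := Nat.mul_le_mul_left _ (by omega)
    have a4 : c * (D + ℓ + 2) ≤ c * (33 * (B * L)) := Nat.mul_le_mul_left _ (by omega)
    have a5 : B * (ℓ + δ + 2) = B * ℓ + δ * B + 2 * B := by ring
    rw [a5] at c2 c9
    generalize B * ℓ = R at *
    have b6 : δ ≤ δ * (B * L) := Nat.le_mul_of_pos_right _ (by omega)
    generalize B * L = X at *
    have z1 : (δ + 1) ^ 3 * X = δ * ((δ + 1) ^ 2 * X) + (δ * (δ * X)) + 2 * (δ * X) + X := by ring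
    have z2 : δ * (200 * (δ + 1) ^ 2 * X) = 200 * (δ * ((δ + 1) ^ 2 * X)) := by ring
    have z3 : c * (35 * X) = 35 * (c * X) := by ring
    have z4 : c * (33 * X) = 33 * (c * X) := by ring
    have z5 : (100 * (c + 1) + 300 * (δ + 1) ^ 3) * X =
      100 * (c * X) + 100 * X + 300 * ((δ + 1) ^ 3 * X) := by ring
    rw [z5, z1]
    rw [z2] at a1
    rw [z3] at a3
    rw [z4] at a4
    generalize δ * ((δ + 1) ^ 2 * X) = T1 at *
    generalize δ * (δ * X) = T2 at *
    generalize δ * X = T3 at *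
    generalize c * X = T4 at *
    generalize δ * B = T5 at *
    omega

end field

end

end GC

namespace GC

noncomputable section

/-! ### The decoder -/

theorem mem_casesT (B m : ℕ) (ds : List ℕ) :
    ds ∈ (casesT B m).val ↔ ds.length = B ∧ ds.sum = m := by
  induction B, m using casesT.induct generalizing ds with
  | case1 => simp [casesT]; rintro rfl; simp
  | case2 m =>
    simp [casesT]; rintro rfl; simp
  | case3 B ih =>
    simp only [casesT, Timed.bind_val, mapT_val, Timed.pure_val, List.mem_map, ih]
    constructor
    · rintro ⟨ds, ⟨h1, h2⟩, rfl⟩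
      simp [h1, h2]
    · rintro ⟨h1, h2⟩
      obtain _ | ⟨d, ds⟩ := ds
      · simp at h1
      · simp only [List.length_cons, List.sum_cons] at h1 h2
        obtain rfl : d = 0 := by omega
        exact ⟨ds, ⟨by omega, by omega⟩, rfl⟩
  | case4 B m ih1 ih2 =>
    simp only [casesT, Timed.bind_val, mapT_val, Timed.pure_val, List.mem_map, ih1, ih2,
      appendT_val, List.mem_append]
    constructor
    · rintro (⟨ds, ⟨h1, h2⟩, rfl⟩ | ⟨ds, ⟨h1, h2⟩, rfl⟩)
      · simp [h1, h2]
      · obtain _ | ⟨d, ds⟩ := ds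
        · simp at h1
        · simp only [List.length_cons, List.sum_cons, incHead] at h1 h2 ⊢
          omega
    · rintro ⟨h1, h2⟩
      obtain _ | ⟨_ | d, ds⟩ := ds
      · simp at h1
      · simp only [List.length_cons, List.sum_cons] at h1 h2
        exact Or.inl ⟨ds, ⟨by omega, by omega⟩, rfl⟩
      · simp only [List.length_cons, List.sum_cons] at h1 h2
        exact Or.inr ⟨d :: ds, ⟨by simpa using h1, by simp; omega⟩, rfl⟩

/-- By Pascal's recursion, whose two terms satisfy `B ^ (m + 1) + (B + 1) ^ m ≤ (B + 1) ^ (m + 1)`.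
-/
theorem casesT_length_le (B m : ℕ) : (casesT B m).val.length ≤ B ^ m := by
  induction B, m using casesT.induct with
  | case1 => simp [casesT]
  | case2 m => simp [casesT]
  | case3 B ih => simpa [casesT] using ih
  | case4 B m ih1 ih2 =>
    simp only [casesT, Timed.bind_val, mapT_val, Timed.pure_val, List.length_map,
      appendT_val, List.length_append]
    have h : B * B ^ m ≤ B * (B + 1) ^ m :=
      Nat.mul_le_mul_left _ (Nat.pow_le_pow_left (by omega) _)
    calc _ ≤ B ^ (m + 1) + (B + 1) ^ m := Nat.add_le_add ih1 ih2
      _ ≤ (B + 1) ^ (m + 1) := by rw [pow_succ, pow_succ]; linarith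

/-- The exponent is one more than in the number of cases: the recursion also pays for the
intermediate lists. The inductive bounds leave a slack of `16 * (B + 1) ^ (m + 1)`, which covers the
current maps and the append. -/
theorem casesT_cost_le (B m : ℕ) : (casesT B m).cost ≤ 16 * (B + 1) ^ (m + 1) := by
  induction B, m using casesT.induct with
  | case1 => simp [casesT]
  | case2 m => simp [casesT]
  | case3 B ih =>
    have h1 := mapT_cost_le (fun ds => do tick; return 0 :: ds) (casesT B 0).val 1 fun _ _ => by
      simp
    have h2 := casesT_length_le B 0
    simp only [casesT, Timed.bind_cost, tick_cost]
    rw [pow_zero] at h2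
    rw [zero_add, pow_one] at ih ⊢
    omega
  | case4 B m ih1 ih2 =>
    have h1 := mapT_cost_le (fun ds => do tick; return 0 :: ds) (casesT B (m + 1)).val 1
      fun _ _ => by simp
    have h2 := casesT_length_le B (m + 1)
    have h3 := mapT_cost_le (fun ds => do tick; return incHead ds) (casesT (B + 1) m).val 1
      fun _ _ => by simp
    have h4 := casesT_length_le (B + 1) m
    simp only [casesT, Timed.bind_cost, tick_cost, mapT_val, appendT_cost, List.length_map,
      Nat.succ_eq_add_one]
    have e1 : B ^ (m + 1) ≤ (B + 1) ^ (m + 1) := Nat.pow_le_pow_left (by omega) _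
    have e2 : (B + 1) ^ m ≤ (B + 1) ^ (m + 1) := Nat.pow_le_pow_right (by omega) (by omega)
    have e3 : 1 ≤ (B + 1) ^ (m + 1) := Nat.one_le_pow _ _ (by omega)
    have e4 : (B + 1) ^ m ≤ (B + 1 + 1) ^ m := Nat.pow_le_pow_left (by omega) _
    have e5 : (B + 1) ^ (m + 1) + (B + 1) ^ m ≤ (B + 1 + 1) ^ (m + 1) := by
      rw [pow_succ, pow_succ]; nlinarith
    have e6 : (B + 1 + 1) ^ (m + 1 + 1) =
        (B + 1 + 1) ^ (m + 1) + (B + 1) * (B + 1 + 1) ^ (m + 1) := by ring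
    have e7 : (B + 1) ^ (m + 1 + 1) + (B + 1) ^ (m + 1) ≤ (B + 1) * (B + 1 + 1) ^ (m + 1) := by
      have := Nat.mul_le_mul_left (B + 1) e5
      refine le_trans (le_of_eq ?_) this
      ring
    omega

/-- A verdict describes a set of decoded strings. -/
def Verdict.Describes : Verdict → Set (List (List Bool)) → Prop
  | .nothing, S => S = ∅
  | .unique Y, S => S = {Y}
  | .conflict, S => ∃ a ∈ S, ∃ b ∈ S, a ≠ b

theorem updateT_spec (v : Verdict) (S : Set (List (List Bool))) (h : v.Describes S)
    (o : Option (List (List Bool))) :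
    (updateT v o).val.Describes (S ∪ {Y | o = some Y}) := by
  obtain _ | Y := o
  · have : (updateT v none).val = v := by cases v <;> rfl
    simpa [this] using h
  have hY : {Z | some Y = some Z} = {Y} := by ext; simp [eq_comm]
  rw [hY]
  cases v with
  | nothing =>
    obtain rfl : S = ∅ := h
    simp [updateT, Verdict.Describes]
  | unique Y₀ =>
    obtain rfl : S = {Y₀} := h
    by_cases he : Y₀ = Y
    · simp [updateT, Verdict.Describes, he]
    · simp [updateT, Verdict.Describes, he, Ne.symm he]
  | conflict =>
    obtain ⟨a, ha, b, hb, hab⟩ := h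
    exact ⟨a, Or.inl ha, b, Or.inl hb, hab⟩

theorem updateT_cost_le (v : Verdict) (o : Option (List (List Bool))) (B ℓ : ℕ)
    (h : ∀ Y, v = .unique Y → Y.length = B ∧ ∀ a ∈ Y, a.length ≤ ℓ) :
    (updateT v o).cost ≤ B * (ℓ + 2) + 2 := by
  obtain _ | Z := o
  · cases v <;> simp [updateT]
  cases v with
  | nothing => simp [updateT]
  | unique Y =>
    obtain ⟨h1, h2⟩ := h Y rfl
    have := eqSymbolsT_cost_le Y Z ℓ h2
    rw [h1] at this
    simp [updateT]; omega
  | conflict => simp [updateT]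

theorem tryAllT_spec (ℓ : ℕ) (g : List Bool) (G : List (List (List Bool))) (P : List (List Bool))
    (s : List Bool) (B K : ℕ) (cs : List (List ℕ)) (v : Verdict) (S : Set (List (List Bool)))
    (hv : v.Describes S) (hS : ∀ Y ∈ S, Y.length = B ∧ ∀ a ∈ Y, a.length ≤ ℓ)
    (hcs : ∀ ds ∈ cs, (tryCaseT ℓ g G P s ds).cost ≤ K ∧
      ∀ Y, (tryCaseT ℓ g G P s ds).val = some Y → Y.length = B ∧ ∀ a ∈ Y, a.length ≤ ℓ) :
    (tryAllT ℓ g G P s cs v).val.Describes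
        (S ∪ {Y | ∃ ds ∈ cs, (tryCaseT ℓ g G P s ds).val = some Y}) ∧
      (tryAllT ℓ g G P s cs v).cost ≤ cs.length * (K + B * (ℓ + 2) + 3) + 1 := by
  induction cs generalizing v S with
  | nil => simpa [tryAllT] using hv
  | cons ds cs ih =>
    obtain ⟨h1, h2⟩ := hcs ds (by simp)
    have h3 := updateT_spec v S hv (tryCaseT ℓ g G P s ds).val
    have h4 := updateT_cost_le v (tryCaseT ℓ g G P s ds).val B ℓ (by
      rintro Y rfl
      obtain rfl : S = {Y} := hv
      exact hS Y rfl)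
    obtain ⟨i1, i2⟩ := ih _ _ h3 (by
      rintro Y (hY | hY)
      · exact hS Y hY
      · exact h2 Y hY) fun ds hds => hcs ds (by simp [hds])
    simp only [tryAllT, Timed.bind_val, Timed.bind_cost, tick_cost, List.length_cons]
    refine ⟨?_, by nlinarith⟩
    convert i1 using 1
    rw [Set.union_assoc]
    congr 1
    ext Y
    simp

theorem repDecodeT_cost_le (δ N a b : ℕ) (acc z : List Bool) :
    (repDecodeT δ N a b acc z).cost ≤ z.length + 1 := by
  induction z generalizing N a b acc with
  | nil => cases N <;> simp [repDecodeT]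
  | cons x z ih =>
    obtain _ | N := N
    · simp [repDecodeT]
    · have h1 := ih N 0 0 (x :: acc)
      have h2 := ih (N + 1) (a + 1) b acc
      have h3 := ih (N + 1) a (b + 1) acc
      cases x <;> simp only [repDecodeT, Timed.bind_cost, tick_cost, Timed.ite_cost,
        List.length_cons] <;> split_ifs <;> omega

theorem repDecodeT_length_le (δ N a b : ℕ) (acc z : List Bool) (r : List Bool × List Bool)
    (h : (repDecodeT δ N a b acc z).val = some r) : r.2.length ≤ z.length := by
  induction z generalizing N a b acc with
  | nil =>
    obtain _ | N := N
    · simp only [repDecodeT, Timed.bind_val, Timed.pure_val, Option.some.injEq] at h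
      simp [← h]
    · simp [repDecodeT] at h
  | cons x z ih =>
    obtain _ | N := N
    · simp only [repDecodeT, Timed.bind_val, Timed.pure_val, Option.some.injEq] at h
      simp [← h]
    · cases x <;> simp only [repDecodeT, Timed.bind_val, Timed.ite_val] at h <;> split_ifs at h <;>
        exact (ih _ _ _ _ h).trans (by simp)

section field

variable {f : (ZMod 2)[X]} {ℓ : ℕ}

theorem decode_eq_none {δ k c : ℕ} {E : Matrix (Fin (numBlocks k ℓ)) (Fin c) (AdjoinRoot f)}
    {y p rest : List Bool} (hr : (repDecodeT δ (c * ℓ) 0 0 [] y.reverse).val = some (p, rest))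
    (h : ¬ (k ≤ rest.length ∧ rest.length ≤ k + δ ∧ ∃! Y, Y ∈ decodedStrings k ℓ c f E
      (fun r => ev f (piece p (r * ℓ) ℓ)) rest.reverse)) : decode δ k ℓ c f E y = none := by
  have hPe : (fun r : Fin c => symbol f fun i : Fin ℓ => p.getD ((r : ℕ) * ℓ + i) false) =
      fun r : Fin c => ev f (piece p (r * ℓ) ℓ) := by
    funext r; rw [symbol_eq_ev]; rfl
  simp only [decode, hr]
  rw [dif_neg]
  rwa [hPe, List.length_reverse]

theorem decode_eq_some {δ k c : ℕ} {E : Matrix (Fin (numBlocks k ℓ)) (Fin c) (AdjoinRoot f)}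
    {y p rest : List Bool} (hr : (repDecodeT δ (c * ℓ) 0 0 [] y.reverse).val = some (p, rest))
    (h1 : k ≤ rest.length) (h2 : rest.length ≤ k + δ) {Y : Fin (numBlocks k ℓ) → Fin ℓ → Bool}
    (hY : Y ∈ decodedStrings k ℓ c f E (fun r => ev f (piece p (r * ℓ) ℓ)) rest.reverse)
    (huniq : ∀ Y' ∈ decodedStrings k ℓ c f E (fun r => ev f (piece p (r * ℓ) ℓ)) rest.reverse,
      Y' = Y) :
    decode δ k ℓ c f E y = some ((List.ofFn fun j => List.ofFn (Y j)).flatten.take k) := by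
  have hPe : (fun r : Fin c => symbol f fun i : Fin ℓ => p.getD ((r : ℕ) * ℓ + i) false) =
      fun r : Fin c => ev f (piece p (r * ℓ) ℓ) := by
    funext r; rw [symbol_eq_ev]; rfl
  have h : k ≤ rest.reverse.length ∧ rest.reverse.length ≤ k + δ ∧
      ∃! Y, Y ∈ decodedStrings k ℓ c f E (fun r : Fin c => symbol f fun i : Fin ℓ =>
        p.getD ((r : ℕ) * ℓ + i) false) rest.reverse := by
    rw [hPe, List.length_reverse]
    exact ⟨h1, h2, Y, hY, huniq⟩
  simp only [decode, hr]
  rw [dif_pos h]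
  have hch : h.2.2.choose = Y := huniq _ (by rw [← hPe]; exact h.2.2.choose_spec.1)
  rw [hch]

/-- The final verdict describes the image of the set of decoded strings under the injective passage
to lists, so `unique` occurs exactly when there is one decoded string. -/
theorem decodeT_val_cost (hf : Irreducible f) (hd : f.natDegree = ℓ) (h0 : 1 ≤ ℓ) {k : ℕ}
    (hk : ℓ ≤ k) {c δ : ℕ} (hc : δ < c) (E : Matrix (Fin (numBlocks k ℓ)) (Fin c) (AdjoinRoot f))
    (hE : IsSystematicMDS E) (y : List Bool) :
    (decodeT δ k ℓ c (lowBits f ℓ) (matrixBits f ℓ E) y).val = decode δ k ℓ c f E y ∧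
      (decodeT δ k ℓ c (lowBits f ℓ) (matrixBits f ℓ E) y).cost ≤
        4 * y.length + c * (ℓ + 2) + c + 16 * (numBlocks k ℓ + 1) ^ (δ + 1) +
          numBlocks k ℓ ^ δ * ((100 * (c + 1) + 300 * (δ + 1) ^ 3) * (numBlocks k ℓ * ℓ ^ 2) +
            numBlocks k ℓ * (ℓ + 2) + 3) + numBlocks k ℓ * (ℓ + 2) + k + 9 := by
  have hB := one_le_numBlocks h0 hk
  have r1 := repDecodeT_cost_le δ (c * ℓ) 0 0 [] y.reverse
  rcases hr : (repDecodeT δ (c * ℓ) 0 0 [] y.reverse).val with _ | ⟨p, rest⟩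
  · have hv : decode δ k ℓ c f E y = none := by
      simp only [decode, hr]
    rw [hv]
    simp only [decodeT, Timed.bind_val, Timed.bind_cost, reverseT_val, reverseT_cost, hr,
      Timed.pure_val, Timed.pure_cost, true_and]
    rw [List.length_reverse] at r1
    omega
  have r2 := repDecodeT_length_le _ _ _ _ _ _ _ hr
  simp only [List.length_reverse] at r1 r2
  simp only [decodeT, Timed.bind_val, Timed.bind_cost, reverseT_val, reverseT_cost, hr,
    lengthT_val, lengthT_cost, List.length_reverse, Timed.ite_val, Timed.ite_cost]
  by_cases hlen : k ≤ rest.length ∧ rest.length ≤ k + δ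
  swap
  · rw [if_neg hlen, if_neg hlen, decode_eq_none hr fun h => hlen ⟨h.1, h.2.1⟩]
    simp only [Timed.pure_val, Timed.pure_cost, true_and]
    omega
  obtain ⟨hl1, hl2⟩ := hlen
  set P : Fin c → List Bool := fun r => piece p (r * ℓ) ℓ with hP
  have htry := fun (d : Fin (numBlocks k ℓ) → ℕ) => tryCaseT_spec hf hd h0 hc hB E hE P
    (fun r => by simp [hP]) rest.reverse d
  have hcase : ∀ ds ∈ (casesT (numBlocks k ℓ) (rest.length - k)).val,
      ∃ d : Fin (numBlocks k ℓ) → ℕ, ds = List.ofFn d ∧ ∑ j, d j = rest.length - k := by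
    intro ds hds
    obtain ⟨h1, h2⟩ := (mem_casesT _ _ _).1 hds
    refine ⟨fun j => ds.get (j.cast h1.symm), ?_, ?_⟩
    · apply List.ext_getElem <;> simp [h1]
    · rw [← List.sum_ofFn, ← h2]
      congr 1
      apply List.ext_getElem <;> simp [h1]
  obtain ⟨t1, t2⟩ := tryAllT_spec ℓ (lowBits f ℓ) (matrixBits f ℓ E) (List.ofFn P) rest.reverse
    (numBlocks k ℓ) ((100 * (c + 1) + 300 * (δ + 1) ^ 3) * (numBlocks k ℓ * ℓ ^ 2))
    (casesT (numBlocks k ℓ) (rest.length - k)).val .nothing ∅ rfl (by simp) (by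
      intro ds hds
      obtain ⟨d, rfl, hsum⟩ := hcase ds hds
      obtain ⟨h1, h2⟩ := htry d (by omega)
      refine ⟨h2, fun Z hZ => ?_⟩
      obtain ⟨Y, rfl, -⟩ := (h1 Z).1 hZ
      refine ⟨by simp, fun a ha => ?_⟩
      obtain ⟨j, rfl⟩ := (List.mem_ofFn' _ _).1 ha
      simp)
  have hset : (∅ ∪ {Z | ∃ ds ∈ (casesT (numBlocks k ℓ) (rest.length - k)).val,
      (tryCaseT ℓ (lowBits f ℓ) (matrixBits f ℓ E) (List.ofFn P) rest.reverse ds).val = some Z}) =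
      (fun Y : Fin (numBlocks k ℓ) → Fin ℓ → Bool => List.ofFn fun j => List.ofFn (Y j)) ''
        decodedStrings k ℓ c f E (fun r => ev f (P r)) rest.reverse := by
    ext Z
    simp only [Set.empty_union, Set.mem_ofPred_eq, Set.mem_image, decodedStrings,
      List.length_reverse]
    constructor
    · rintro ⟨ds, hds, h⟩
      obtain ⟨d, rfl, hsum⟩ := hcase ds hds
      obtain ⟨Y, rfl, hY⟩ := ((htry d (by omega)).1 Z).1 h
      exact ⟨Y, ⟨d, hsum, hY⟩, rfl⟩
    · rintro ⟨Y, ⟨d, hsum, hY⟩, rfl⟩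
      refine ⟨List.ofFn d, (mem_casesT _ _ _).2 ⟨by simp, by simpa [List.sum_ofFn] using hsum⟩,
        ((htry d (by omega)).1 _).2 ⟨Y, rfl, hY⟩⟩
  have hinj : Function.Injective
      (fun Y : Fin (numBlocks k ℓ) → Fin ℓ → Bool => List.ofFn fun j => List.ofFn (Y j)) := by
    intro Y Y' h
    funext j
    exact List.ofFn_injective (congrFun (List.ofFn_injective h) j)
  rw [hset] at t1
  have c1 := chunkT_cost_le (List.replicate c ℓ) p ℓ fun n hn => (List.eq_of_mem_replicate hn).le
  have c2 := casesT_cost_le (numBlocks k ℓ) (rest.length - k)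
  have c3 := casesT_length_le (numBlocks k ℓ) (rest.length - k)
  have c4 : (numBlocks k ℓ + 1) ^ (rest.length - k + 1) ≤ (numBlocks k ℓ + 1) ^ (δ + 1) :=
    Nat.pow_le_pow_right (by omega) (by omega)
  have c5 : numBlocks k ℓ ^ (rest.length - k) ≤ numBlocks k ℓ ^ δ :=
    Nat.pow_le_pow_right (by omega) (by omega)
  have c6 : (tryAllT ℓ (lowBits f ℓ) (matrixBits f ℓ E)
      (List.ofFn fun j : Fin c => piece p (j * ℓ) ℓ) rest.reverse _ _).cost ≤ _ :=
    t2.trans (Nat.add_le_add_right (Nat.mul_le_mul_right _ (c3.trans c5)) 1)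
  rw [List.length_replicate] at c1
  rw [if_pos ⟨hl1, hl2⟩, if_pos ⟨hl1, hl2⟩]
  simp only [replicateT_val, replicateT_cost, chunkT_replicate]
  change Verdict.Describes (tryAllT ℓ (lowBits f ℓ) (matrixBits f ℓ E)
    (List.ofFn fun j : Fin c => piece p (j * ℓ) ℓ) rest.reverse _ _).val _ at t1
  cases hv : (tryAllT ℓ (lowBits f ℓ) (matrixBits f ℓ E)
    (List.ofFn fun j : Fin c => piece p (j * ℓ) ℓ) rest.reverse
      (casesT (numBlocks k ℓ) (rest.length - k)).val .nothing).val with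
  | nothing =>
    rw [hv] at t1
    rw [decode_eq_none hr]
    · simp only [Timed.pure_val, Timed.pure_cost, true_and]
      omega
    · rintro ⟨-, -, Y, hY, -⟩
      have h : _ = (∅ : Set _) := t1
      rw [Set.image_eq_empty] at h
      exact (Set.eq_empty_iff_forall_notMem.1 h) Y hY
  | conflict =>
    rw [hv] at t1
    rw [decode_eq_none hr]
    · simp only [Timed.pure_val, Timed.pure_cost, true_and]
      omega
    · rintro ⟨-, -, Y, hY, huniq⟩
      obtain ⟨_, ⟨a, ha, rfl⟩, _, ⟨b, hb, rfl⟩, hab⟩ := t1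
      exact hab (by rw [huniq a ha, huniq b hb])
  | unique Z =>
    rw [hv] at t1
    have h : _ = {Z} := t1
    have hZ : Z ∈ ({Z} : Set (List (List Bool))) := rfl
    rw [← h] at hZ
    obtain ⟨Y, hY, rfl⟩ := hZ
    have huniq : ∀ Y', Y' ∈ decodedStrings k ℓ c f E (fun r => ev f (P r)) rest.reverse →
        Y' = Y := by
      intro Y' hY'
      have : _ ∈ _ := Set.mem_image_of_mem (fun Y : Fin (numBlocks k ℓ) → Fin ℓ → Bool =>
        List.ofFn fun j => List.ofFn (Y j)) hY'
      rw [h] at this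
      exact hinj this
    rw [decode_eq_some hr hl1 hl2 hY huniq]
    have c7 := flattenT_cost_le (List.ofFn fun j => List.ofFn (Y j)) ℓ fun a ha => by
      obtain ⟨j, rfl⟩ := (List.mem_ofFn' _ _).1 ha
      simp
    have c8 := takeT_cost_le k (List.ofFn fun j => List.ofFn (Y j)).flatten
    rw [List.length_ofFn] at c7
    simp only [Timed.bind_val, Timed.bind_cost, flattenT_val, takeT_val, Timed.pure_val,
      Timed.pure_cost]
    refine ⟨trivial, by omega⟩

end field

end

end GC

namespace GC

noncomputable section

/-! ### Decoding of the repetition code -/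

/-- Here `p` right and `q` wrong values have been read for the current bit `b`, and `w` is the
repeated remainder of the parities. The length hypothesis says that at most `δ` extra bits,
including the `q` wrong ones, are present. Bits left unread from this block stay in `z'`; the budget
for them is again `δ`. -/
theorem repDecodeT_block (δ N : ℕ) (b : Bool) (w t z acc : List Bool) (p q : ℕ)
    (hp : p ≤ δ) (hz : (List.replicate (δ + 1 - p) b ++ w).Sublist z)
    (hl : z.length + q ≤ δ + 1 - p + w.length + δ) :
    ∃ z', (repDecodeT δ (N + 1) (if b then q else p) (if b then p else q) acc (z ++ t)).val =
        (repDecodeT δ N 0 0 (b :: acc) (z' ++ t)).val ∧ w.Sublist z' ∧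
      z'.length + (δ + 1 - p) + q ≤ z.length + q ∧ z'.length ≤ w.length + δ := by
  induction z generalizing p q with
  | nil =>
    have := hz.length_le
    simp at this
    omega
  | cons x z ih =>
    have hrep : List.replicate (δ + 1 - p) b = b :: List.replicate (δ - p) b := by
      rw [show δ + 1 - p = δ - p + 1 by omega, List.replicate_succ]
    have hlen := hz.length_le
    rw [List.length_cons] at hl hlen
    by_cases hx : x = b
    · subst hx
      rw [hrep, List.cons_append, List.cons_sublist_cons] at hz
      by_cases hpδ : p = δ
      · subst hpδ
        refine ⟨z, ?_, by simpa using hz, by simp, by omega⟩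
        cases x <;> simp [repDecodeT]
      · obtain ⟨z', h1, h2, h3, h4⟩ := ih (p + 1) q (by omega)
          (by rwa [show δ + 1 - (p + 1) = δ - p by omega]) (by omega)
        refine ⟨z', ?_, h2, by simp; omega, h4⟩
        rw [← h1]
        cases x <;> simp [repDecodeT, hpδ]
    · have hz' : (List.replicate (δ + 1 - p) b ++ w).Sublist z := by
        rw [hrep, List.cons_append] at hz ⊢
        cases hz with
        | cons _ h => exact h
        | cons_cons _ h => exact absurd rfl hx
      have hlen' := hz'.length_le
      rw [List.length_append, List.length_replicate] at hlen'
      obtain ⟨z', h1, h2, h3, h4⟩ := ih p (q + 1) hp hz' (by omega)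
      -- Skipping the wrong bit keeps all of the required subsequence in `z`, so the budget leaves
      -- room for `q + 1` wrong bits.
      have hq : q ≠ δ := by omega
      refine ⟨z', ?_, h2, by simp; omega, h4⟩
      rw [← h1]
      obtain rfl : x = !b := by cases x <;> cases b <;> simp_all
      cases b <;> simp [repDecodeT, hq]

/-- Block after block is decoded while the supersequence property and the budget of `δ` extra bits
persist. The leftover `e` of the parity part ends up next to the systematic part `t`, which is never
read. -/
theorem repDecodeT_of_sublist (δ : ℕ) (b t z acc : List Bool)
    (hz : (b.flatMap (List.replicate (δ + 1))).Sublist z)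
    (hl : z.length ≤ (b.flatMap (List.replicate (δ + 1))).length + δ) :
    ∃ e, (repDecodeT δ b.length 0 0 acc (z ++ t)).val = some (b.reverse ++ acc, e ++ t) ∧
      e.length + (b.flatMap (List.replicate (δ + 1))).length ≤ z.length := by
  induction b generalizing z acc with
  | nil =>
    refine ⟨z, ?_, by simp⟩
    simp [repDecodeT]
  | cons b bs ih =>
    rw [List.flatMap_cons] at hz hl ⊢
    rw [List.length_append, List.length_replicate] at hl ⊢
    obtain ⟨z', h1, h2, h3, h4⟩ := repDecodeT_block δ bs.length b _ t z acc 0 0 (by omega)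
      (by simpa using hz) (by omega)
    obtain ⟨e, e1, e2⟩ := ih z' (b :: acc) h2 h4
    refine ⟨e, ?_, by omega⟩
    simp only [ite_self] at h1
    rw [List.length_cons, h1, e1]
    simp

/-! ### Pieces of strings -/

theorem piece_add (l : List Bool) (o a b : ℕ) :
    piece l o (a + b) = piece l o a ++ piece l (o + a) b := by
  apply List.ext_getElem
  · simp
  · intro i h1 h2
    by_cases h : i < a
    · rw [List.getElem_append_left (by simpa using h)]
      simp [piece]
    · rw [List.getElem_append_right (by simpa using h)]
      simp only [piece, List.getElem_ofFn, List.length_ofFn]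
      congr 1; omega

theorem piece_zero (l : List Bool) (n : ℕ) (h : l.length ≤ n) :
    piece l 0 n = l ++ List.replicate (n - l.length) false := by
  apply List.ext_getElem
  · simp; omega
  · intro i h1 h2
    by_cases h : i < l.length
    · simp [piece, h]
    · rw [List.getElem_append_right (by simpa using h)]
      simp [piece, h]

theorem flatten_piece (l : List Bool) (o ℓ B : ℕ) :
    (List.ofFn fun j : Fin B => piece l (o + j * ℓ) ℓ).flatten = piece l o (B * ℓ) := by
  induction B generalizing o with
  | zero => simp [piece]
  | succ B ih =>
    rw [show (B + 1) * ℓ = ℓ + B * ℓ by ring, piece_add, ← ih, List.ofFn_succ]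
    simp only [Fin.val_zero, zero_mul, add_zero, Fin.val_succ, List.flatten_cons]
    congr 4
    funext j
    congr 1
    ring

theorem flatten_getElem? {α : Type} (L : List (List α)) (j i : ℕ) (hj : j < L.length)
    (hi : i < L[j].length) : L.flatten[((L.take j).map List.length).sum + i]? = L[j][i]? := by
  induction L generalizing j with
  | nil => simp at hj
  | cons a L ih =>
    obtain _ | j := j
    · simp only [List.getElem_cons_zero] at hi
      simp [List.getElem?_append_left hi]
    · simp only [List.getElem_cons_succ] at hi
      have := ih j (by simpa using hj) hi
      simp only [List.take_succ_cons, List.map_cons, List.sum_cons, List.flatten_cons,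
        List.getElem_cons_succ]
      rw [List.getElem?_append_right (by omega), ← this]
      congr 1; omega

theorem flatten_ofFn_getD {B : ℕ} (C : Fin B → List Bool) (j : Fin B) (i : ℕ)
    (hi : i < (C j).length) :
    (List.ofFn C).flatten.getD
      ((∑ a ∈ Finset.univ.filter (fun a : Fin B => a < j), (C a).length) + i) false =
        (C j)[i] := by
  have h := flatten_getElem? (List.ofFn C) j i (by simp) (by simpa using hi)
  rw [List.map_take, List.map_ofFn, take_ofFn_sum] at h
  rw [List.getD_eq_getElem?_getD]
  simp only [Function.comp_def, List.getElem_ofFn, Fin.eta] at h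
  rw [h]
  simp [hi]

theorem piece_flatten {c ℓ : ℕ} (Q : Fin c → List Bool) (hQ : ∀ r, (Q r).length = ℓ) (r : Fin c) :
    piece (List.ofFn Q).flatten (r * ℓ) ℓ = Q r := by
  apply List.ext_getElem
  · simp [hQ]
  · intro i h1 h2
    rw [← flatten_ofFn_getD Q r i h2]
    have hcard : (Finset.univ.filter fun a : Fin c => a < r).card = r := by
      have := Fin.card_Iio r
      rwa [show Finset.Iio r = Finset.univ.filter fun i => i < r by ext; simp] at this
    simp [piece, hQ, hcard]

theorem getD_append_replicate (s : List Bool) (n i : ℕ) :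
    (s ++ List.replicate n false).getD i false = s.getD i false := by
  by_cases h : i < s.length
  · rw [List.getD_append _ _ _ _ h]
  · rw [List.getD_append_right _ _ _ _ (by omega), List.getD_eq_default s _ (by omega)]
    by_cases h' : i - s.length < n
    · rw [List.getD_eq_getElem _ _ (by simpa using h')]; simp
    · rw [List.getD_eq_default _ _ (by simpa using h')]

/-- A supersequence of a concatenation can be cut accordingly. -/
theorem exists_cut {n : ℕ} (L : Fin (n + 1) → List Bool) (s : List Bool)
    (h : (List.ofFn L).flatten.Sublist s) :
    ∃ C : Fin (n + 1) → List Bool, (List.ofFn C).flatten = s ∧ ∀ j, (L j).Sublist (C j) := by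
  induction n generalizing s with
  | zero =>
    refine ⟨fun _ => s, by simp, fun j => ?_⟩
    refine Fin.cases (by simpa using h) (fun i => i.elim0) j
  | succ n ih =>
    rw [List.ofFn_succ, List.flatten_cons, List.append_sublist_iff] at h
    obtain ⟨r₁, r₂, rfl, h1, h2⟩ := h
    obtain ⟨C, c1, c2⟩ := ih _ r₂ h2
    refine ⟨Fin.cons r₁ C, by simp [List.ofFn_succ] at c1 ⊢; exact c1, fun j => ?_⟩
    refine Fin.cases (by simpa using h1) (fun j => by simpa using c2 j) j

section field

variable {f : (ZMod 2)[X]} {ℓ : ℕ}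

/-- The symbols of a message. -/
def messageSymbols {k : ℕ} (f : (ZMod 2)[X]) (ℓ : ℕ) (u : Fin k → Bool) :
    Fin (numBlocks k ℓ) → AdjoinRoot f := fun j => symbol f (block ℓ u j)

theorem flatten_block {k : ℕ} (h0 : 1 ≤ ℓ) (u : Fin k → Bool) :
    (List.ofFn fun j : Fin (numBlocks k ℓ) => List.ofFn (block ℓ u j)).flatten =
      List.ofFn u ++ List.replicate (numBlocks k ℓ * ℓ - k) false := by
  have h := flatten_piece (List.ofFn u) 0 ℓ (numBlocks k ℓ)
  rw [piece_zero _ _ (by simpa using le_numBlocks_mul h0), List.length_ofFn] at h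
  rw [← h]
  simp only [zero_add]
  rfl

/-- The transmitted message is decoded in some possible case. -/
theorem message_mem_decodedStrings {k c : ℕ} (h0 : 1 ≤ ℓ) (hk : ℓ ≤ k)
    (E : Matrix (Fin (numBlocks k ℓ)) (Fin c) (AdjoinRoot f)) (u : Fin k → Bool) (s : List Bool)
    (hs : (List.ofFn u).Sublist s) :
    (fun j : Fin (numBlocks k ℓ) => block ℓ u (j : ℕ)) ∈
      decodedStrings k ℓ c f E (Matrix.vecMul (messageSymbols f ℓ u) E) s := by
  have hB := one_le_numBlocks h0 hk
  have hkB := le_numBlocks_mul (k := k) h0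
  have hks := hs.length_le
  rw [List.length_ofFn] at hks
  set pad := List.replicate (numBlocks k ℓ * ℓ - k) false with hpad
  -- The zeros padding the message are matched with the zeros read beyond the end of `s`.
  have hsub : (List.ofFn fun j : Fin (numBlocks k ℓ) => List.ofFn (block ℓ u j)).flatten.Sublist
      (s ++ pad) := by
    rw [flatten_block h0]
    exact hs.append (List.Sublist.refl _)
  obtain ⟨C, c1, c2⟩ : ∃ C : Fin (numBlocks k ℓ) → List Bool, (List.ofFn C).flatten = s ++ pad ∧
      ∀ j : Fin (numBlocks k ℓ), (List.ofFn (block ℓ u j)).Sublist (C j) := by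
    obtain ⟨n, hn⟩ : ∃ n, numBlocks k ℓ = n + 1 := ⟨numBlocks k ℓ - 1, by omega⟩
    generalize numBlocks k ℓ = B at *
    subst hn
    exact exists_cut (fun j : Fin (n + 1) => List.ofFn (block ℓ u j)) _ hsub
  have hC : ∀ j, ℓ ≤ (C j).length := fun j => by simpa using (c2 j).length_le
  have hd : ∀ j, (C j).length = ℓ + ((C j).length - ℓ) := fun j => by have := hC j; omega
  -- With `d j` the excess length of the piece `C j`, chunk `j` starts where the first `j` pieces
  -- end.
  have hchunk : ∀ j, chunk ℓ s (fun j => (C j).length - ℓ) j = C j := by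
    intro j
    apply List.ext_getElem
    · simp; exact (hd j).symm
    · intro i h1 h2
      rw [← flatten_ofFn_getD C j i h2, c1, getD_append_replicate]
      simp only [chunk, List.getElem_ofFn]
      congr 1
      rw [Finset.sum_congr rfl fun a _ => hd a, Finset.sum_add_distrib]
      have hcard : (Finset.univ.filter fun a : Fin (numBlocks k ℓ) => a < j).card = j := by
        have := Fin.card_Iio j
        rwa [show Finset.Iio j = Finset.univ.filter fun i => i < j by ext; simp] at this
      simp [hcard]
  refine ⟨fun j => (C j).length - ℓ, ?_, fun j hj => ?_, rfl, fun j _ => ?_⟩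
  · have h1 := congrArg List.length c1
    rw [List.length_flatten, List.map_ofFn, List.sum_ofFn] at h1
    simp only [Function.comp_def, List.length_append, hpad, List.length_replicate] at h1
    rw [Finset.sum_congr rfl fun a _ => hd a, Finset.sum_add_distrib] at h1
    simp only [Finset.sum_const, Finset.card_univ, Fintype.card_fin, smul_eq_mul] at h1
    change ∑ j, ((C j).length - ℓ) = _
    omega
  · rw [hchunk]
    refine (c2 j).eq_of_length ?_
    have := hC j
    simp only at hj
    simp; omega
  · rw [hchunk]
    exact c2 j

/-- The positions below `a` at which nothing is inserted. -/
def keptPositions (S : Finset ℕ) (a : ℕ) : List ℕ := (List.range a).filter (· ∉ S)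

theorem map_getD_range (y : List Bool) : (List.range y.length).map (y.getD · false) = y := by
  apply List.ext_getElem
  · simp
  · intro i h1 h2
    simp [h2]

theorem InsertedAt.map_keptPositions {S : Finset ℕ} {x y : List Bool} (h : InsertedAt S x y) :
    (keptPositions S y.length).map (y.getD · false) = x ∧ y.length = x.length + S.card := by
  obtain ⟨hS, hx⟩ := h
  have hz : y.zipIdx = (List.range y.length).map fun i => (y.getD i false, i) := by
    apply List.ext_getElem
    · simp
    · intro i h1 h2
      have : i < y.length := by simpa using h1
      simp [this]
  have h1 : (keptPositions S y.length).map (y.getD · false) = x := by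
    rw [← hx, hz, List.filter_map, List.map_map, keptPositions]
    rfl
  refine ⟨h1, ?_⟩
  have h2 : (keptPositions S y.length).length = y.length - S.card := by
    rw [keptPositions, ← List.toFinset_card_of_nodup (List.nodup_range.filter _)]
    rw [show ((List.range y.length).filter (· ∉ S)).toFinset = Finset.range y.length \ S by
      ext; simp]
    rw [Finset.card_sdiff_of_subset hS, Finset.card_range]
  have h3 := Finset.card_le_card hS
  rw [Finset.card_range] at h3
  rw [← h1, List.length_map, h2]
  omega

/-- `y` is cut at a position `a` that separates the message bits from the parity bits, and the
reversed second part is fed to the repetition decoder. The received systematic part is `y.take a`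
followed by bits left over from the parity part, so `a` may be smaller than its length; the leftover
bits later count as inserted ones. -/
theorem exists_received {k c δ : ℕ} (hf : Irreducible f) (hd : f.natDegree = ℓ)
    (E : Matrix (Fin (numBlocks k ℓ)) (Fin c) (AdjoinRoot f)) (u : Fin k → Bool) (S : Finset ℕ)
    (hS : S.card ≤ δ) (y : List Bool) (hy : InsertedAt S (encode δ k ℓ c f E u) y) :
    ∃ (a : ℕ) (p rest : List Bool),
      (repDecodeT δ (c * ℓ) 0 0 [] y.reverse).val = some (p, rest) ∧
      (fun r : Fin c => ev f (piece p (r * ℓ) ℓ)) = Matrix.vecMul (messageSymbols f ℓ u) E ∧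
      rest.length ≤ k + δ ∧ a ≤ rest.length ∧
      (keptPositions S a).map (rest.reverse.getD · false) = List.ofFn u := by
  obtain ⟨h1, h2⟩ := hy.map_keptPositions
  set Q : Fin c → List Bool := fun r =>
    List.ofFn (bits f ℓ (Matrix.vecMul (messageSymbols f ℓ u) E r)) with hQ
  set p := (List.ofFn Q).flatten with hp
  have hpl : p.length = c * ℓ := by
    rw [hp, List.length_flatten, List.map_ofFn, List.sum_ofFn]
    simp [hQ]
  have henc : encode δ k ℓ c f E u = List.ofFn u ++ p.flatMap (List.replicate (δ + 1)) := by
    rw [List.flatMap, hp, List.map_flatten, List.flatten_flatten, List.map_ofFn, List.map_ofFn]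
    rfl
  rw [henc] at h1 h2
  rw [keptPositions, List.map_eq_append_iff] at h1
  obtain ⟨l₁, l₂, h3, h4, h5⟩ := h1
  rw [List.filter_eq_append_iff] at h3
  obtain ⟨r₁, r₂, h6, h7, h8⟩ := h3
  have ha : r₁.length ≤ y.length := by
    have := congrArg List.length h6
    simp at this; omega
  have hr₁ : r₁ = List.range r₁.length := by
    have := congrArg (List.take r₁.length) h6
    rwa [List.take_left, List.take_range, min_eq_left ha, eq_comm] at this
  set a := r₁.length with haa
  have hmap := map_getD_range y
  rw [h6, List.map_append] at hmap
  have hy1 : r₁.map (y.getD · false) = y.take a := by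
    conv_rhs => rw [← hmap]
    rw [List.take_left' (by simp [haa])]
  have hy2 : r₂.map (y.getD · false) = y.drop a := by
    conv_rhs => rw [← hmap]
    rw [List.drop_left' (by simp [haa])]
  have hsub2 : (p.flatMap (List.replicate (δ + 1))).Sublist (y.drop a) := by
    rw [← h5, ← h8, ← hy2]
    exact List.filter_sublist.map _
  have hsub1 : (List.ofFn u).Sublist (y.take a) := by
    rw [← h4, ← h7, ← hy1]
    exact List.filter_sublist.map _
  have hl1 := hsub1.length_le
  rw [List.length_ofFn, List.length_take, min_eq_left ha] at hl1
  rw [List.length_append, List.length_ofFn] at h2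
  have hrev : (p.reverse.flatMap (List.replicate (δ + 1))) =
      (p.flatMap (List.replicate (δ + 1))).reverse := by
    rw [List.reverse_flatMap]
    simp [Function.comp_def]
  have hrevl : (p.reverse.flatMap (List.replicate (δ + 1))).length =
      (p.flatMap (List.replicate (δ + 1))).length := by
    rw [hrev, List.length_reverse]
  obtain ⟨e, e1, e2⟩ := repDecodeT_of_sublist δ p.reverse (y.take a).reverse (y.drop a).reverse []
    (by rw [hrev]; exact hsub2.reverse) (by
      rw [hrevl, List.length_reverse, List.length_drop]; omega)
  rw [← List.reverse_append, List.take_append_drop, List.length_reverse, hpl, List.reverse_reverse,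
    List.append_nil] at e1
  rw [hrevl, List.length_reverse, List.length_drop] at e2
  refine ⟨a, p, _, e1, ?_, ?_, ?_, ?_⟩
  · funext r
    rw [hp, piece_flatten Q (fun r => by simp [hQ]), hQ, ev_ofFn_bits hf hd]
  · simp [ha]; omega
  · simp [ha]
  · rw [← h4, ← h7, keptPositions, ← hr₁]
    refine List.map_congr_left fun i hi => ?_
    have hi : i < a := by
      have := List.mem_of_mem_filter hi
      rw [hr₁] at this
      simpa using this
    rw [List.reverse_append, List.reverse_reverse,
      List.getD_append _ _ _ _ (by simp; omega)]
    simp [hi]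

theorem sublist_of_keptPositions {k a : ℕ} {u : Fin k → Bool} {S : Finset ℕ} {s : List Bool}
    (has : a ≤ s.length) (h : (keptPositions S a).map (s.getD · false) = List.ofFn u) :
    (List.ofFn u).Sublist s := by
  have hsub : (keptPositions S a).Sublist (List.range s.length) :=
    List.filter_sublist.trans (List.range_sublist.2 has)
  have := hsub.map (s.getD · false)
  rwa [map_getD_range, h] at this

/-- If decoding fails, then some possible case leads to a wrong string. -/
theorem exists_wrong_of_decode_eq_none {k c δ : ℕ} (hf : Irreducible f) (hd : f.natDegree = ℓ)
    (h0 : 1 ≤ ℓ) (hk : ℓ ≤ k) (E : Matrix (Fin (numBlocks k ℓ)) (Fin c) (AdjoinRoot f))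
    (u : Fin k → Bool) (S : Finset ℕ) (hS : S.card ≤ δ) (y : List Bool)
    (hy : InsertedAt S (encode δ k ℓ c f E u) y) (hfail : decode δ k ℓ c f E y = none) :
    ∃ (a : ℕ) (s : List Bool), k ≤ s.length ∧ s.length ≤ k + δ ∧ a ≤ s.length ∧
      (keptPositions S a).map (s.getD · false) = List.ofFn u ∧
      ∃ Y ∈ decodedStrings k ℓ c f E (Matrix.vecMul (messageSymbols f ℓ u) E) s,
        Y ≠ fun j : Fin (numBlocks k ℓ) => block ℓ u (j : ℕ) := by
  obtain ⟨a, p, rest, h1, h2, h3, h4, h5⟩ := exists_received hf hd E u S hS y hy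
  have h6 := sublist_of_keptPositions (by simpa using h4) h5
  have h7 := h6.length_le
  rw [List.length_ofFn] at h7
  refine ⟨a, rest.reverse, h7, by simpa using h3, by simpa using h4, h5, ?_⟩
  by_contra! hno
  have h8 := message_mem_decodedStrings h0 hk E u rest.reverse h6
  rw [← h2] at h8 hno
  rw [decode_eq_some h1 (by simpa using h7) h3 h8 hno] at hfail
  simp at hfail

/-- The transmitted blocks are always among the decoded strings, so if the decoded string is unique
it is the right one. -/
theorem decode_eq_none_or {k c δ : ℕ} (hf : Irreducible f) (hd : f.natDegree = ℓ)
    (h0 : 1 ≤ ℓ) (hk : ℓ ≤ k) (E : Matrix (Fin (numBlocks k ℓ)) (Fin c) (AdjoinRoot f))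
    (u : Fin k → Bool) (S : Finset ℕ) (hS : S.card ≤ δ) (y : List Bool)
    (hy : InsertedAt S (encode δ k ℓ c f E u) y) :
    decode δ k ℓ c f E y = none ∨ decode δ k ℓ c f E y = some (List.ofFn u) := by
  obtain ⟨a, p, rest, h1, h2, h3, h4, h5⟩ := exists_received hf hd E u S hS y hy
  have h6 := sublist_of_keptPositions (by simpa using h4) h5
  have h7 := h6.length_le
  rw [List.length_ofFn] at h7
  have h8 := message_mem_decodedStrings h0 hk E u rest.reverse h6
  rw [← h2] at h8
  by_cases huniq : ∀ Y' ∈ decodedStrings k ℓ c f E (fun r => ev f (piece p (r * ℓ) ℓ)) rest.reverse,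
      Y' = fun j : Fin (numBlocks k ℓ) => block ℓ u (j : ℕ)
  · right
    rw [decode_eq_some h1 (by simpa using h7) h3 h8 huniq, flatten_block h0]
    simp
  · left
    refine decode_eq_none h1 ?_
    rintro ⟨-, -, hex⟩
    exact huniq fun Y' hY' => hex.unique hY' h8

end field

end

end GC

namespace GC

noncomputable section

/-! ### Counting the messages with a wrong possible case -/

/-- A system of equations `h i + h (σ i) = τ i` along a strictly increasing partial map `σ` is
solvable at all positions that are not fixed by `σ`. -/
theorem exists_shift_solution {k : ℕ} (σ : Fin k → Option (Fin k))
    (hσ : ∀ i j a b, i < j → σ i = some a → σ j = some b → a < b) (τ : Fin k → Bool) :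
    ∃ h : Fin k → Bool, ∀ i, σ i ≠ some i → xor (h i) ((σ i).elim false h) = τ i := by
  classical
  -- At fixed positions the equation would degenerate to `0 = τ i`; replacing it there by the
  -- coordinate itself makes the system square and uniquely solvable. Injectivity suffices by
  -- finiteness.
  let L : (Fin k → Bool) → Fin k → Bool := fun h i =>
    if σ i = some i then h i else xor (h i) ((σ i).elim false h)
  have hL : Function.Injective L := by
    intro h h' hh
    by_contra hne
    have hA : ∀ i, h i ≠ h' i → ∃ a, σ i = some a ∧ a ≠ i ∧ h a ≠ h' a := by
      intro i hi
      have h1 := congrFun hh i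
      simp only [L] at h1
      by_cases hs : σ i = some i
      · simp only [hs, if_true] at h1
        exact absurd h1 hi
      · simp only [hs, if_false] at h1
        rcases ha : σ i with _ | a
        · simp only [ha, Option.elim_none, Bool.xor_false] at h1
          exact absurd h1 hi
        · refine ⟨a, rfl, fun h => hs (by rw [ha, h]), fun h => ?_⟩
          simp only [ha, Option.elim_some, h] at h1
          exact hi (by simpa using h1)
    -- On the positions where `h` and `h'` differ, `σ` is defined and moves every point to another
    -- such position. It moves all of them up: if `i` went down to `a'`, then by induction `a'` goes
    -- up, against monotonicity. This contradicts the existence of a largest such position.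
    have hup : ∀ n : ℕ, ∀ i : Fin k, (i : ℕ) = n → h i ≠ h' i → ∀ a, σ i = some a → i < a := by
      intro n
      induction n using Nat.strong_induction_on with
      | _ n ih =>
        intro i hin hi a ha
        obtain ⟨a', ha', hne', hd⟩ := hA i hi
        obtain rfl : a' = a := by rw [ha] at ha'; exact (Option.some.inj ha').symm
        by_contra hlt
        have hlt' : a' < i := lt_of_le_of_ne (not_lt.1 hlt) hne'
        obtain ⟨b, hb, -, -⟩ := hA a' hd
        have h1 := ih a' (by omega) a' rfl hd b hb
        exact absurd (hσ a' i b a' hlt' hb ha) (not_lt.2 h1.le)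
    obtain ⟨i₀, hi₀⟩ := Function.ne_iff.1 hne
    obtain ⟨i, hi, hmax⟩ := (Finset.univ.filter fun i => h i ≠ h' i).exists_max_image id
      ⟨i₀, by simpa using hi₀⟩
    have hi' : h i ≠ h' i := by simpa using hi
    obtain ⟨a, ha, -, hd⟩ := hA i hi'
    exact absurd (hup i i rfl hi' a ha) (not_lt.2 (hmax a (by simpa using hd)))
  obtain ⟨h, hh⟩ := (Finite.injective_iff_surjective.1 hL) τ
  refine ⟨h, fun i hi => ?_⟩
  have := congrFun hh i
  simpa [L, hi] using this

theorem symbol_xor (f : (ZMod 2)[X]) {ℓ : ℕ} (a b : Fin ℓ → Bool) :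
    symbol f (fun i => xor (a i) (b i)) = symbol f a + symbol f b := by
  rw [symbol, symbol, symbol, ← Finset.sum_add_distrib]
  refine Finset.sum_congr rfl fun i _ => ?_
  cases a i <;> cases b i <;> simp [add_self_adjoinRoot]

/-- The number of insertions assumed in the blocks before block `j`. -/
def shift {B : ℕ} (d : Fin B → ℕ) (j : Fin B) : ℕ :=
  ∑ a ∈ Finset.univ.filter (fun a : Fin B => a < j), d a

theorem shift_mono {B : ℕ} (d : Fin B → ℕ) {i j : Fin B} (h : i ≤ j) : shift d i ≤ shift d j := by
  refine Finset.sum_le_sum_of_subset fun a ha => ?_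
  simp only [Finset.mem_filter, Finset.mem_univ, true_and] at ha ⊢
  exact ha.trans_le h

theorem shift_add_le_shift {B : ℕ} (d : Fin B → ℕ) {i j : Fin B} (h : i < j) :
    shift d i + d i ≤ shift d j := by
  have hi : i ∉ Finset.univ.filter (fun a : Fin B => a < i) := by simp
  rw [shift, add_comm, ← Finset.sum_insert hi]
  refine Finset.sum_le_sum_of_subset fun a ha => ?_
  simp only [Finset.mem_insert, Finset.mem_filter, Finset.mem_univ, true_and] at ha ⊢
  rcases ha with rfl | ha
  · exact h
  · exact ha.trans h

theorem shift_add_le_sum {B : ℕ} (d : Fin B → ℕ) (i : Fin B) : shift d i + d i ≤ ∑ j, d j := by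
  have hi : i ∉ Finset.univ.filter (fun a : Fin B => a < i) := by simp
  rw [shift, add_comm, ← Finset.sum_insert hi]
  exact Finset.sum_le_sum_of_subset (Finset.subset_univ _)

theorem shift_last {B : ℕ} (d : Fin B → ℕ) (j : Fin B) (hj : (j : ℕ) + 1 = B) (hd : d j = 0) :
    shift d j = ∑ j, d j := by
  rw [shift]
  refine Finset.sum_subset (Finset.subset_univ _) fun a _ ha => ?_
  simp only [Finset.mem_filter, Finset.mem_univ, true_and] at ha
  obtain rfl : a = j := by ext; omega
  exact hd

section field

variable {f : (ZMod 2)[X]} {k ℓ c : ℕ}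

/-- The messages `u` for which the received systematic part `s` (with the bits of `u` at the
positions `ι` and the bits of `v` elsewhere) has a wrong decoded string in the case `d`. -/
def wrongSet (f : (ZMod 2)[X]) (E : Matrix (Fin (numBlocks k ℓ)) (Fin c) (AdjoinRoot f)) (m : ℕ)
    (ι : Fin k → ℕ) (v : ℕ → Bool) (d : Fin (numBlocks k ℓ) → ℕ) : Set (Fin k → Bool) :=
  {u | ∃ s : List Bool, s.length = k + m ∧ (∀ i, s.getD (ι i) false = u i) ∧
    (∀ p < k + m, (∀ i, ι i ≠ p) → s.getD p false = v p) ∧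
    ∃ Y : Fin (numBlocks k ℓ) → Fin ℓ → Bool,
      IsPossible f E (Matrix.vecMul (messageSymbols f ℓ u) E) s d Y ∧
      Y ≠ fun j : Fin (numBlocks k ℓ) => block ℓ u (j : ℕ)}

theorem IsPossible.getD {B : ℕ} {E : Matrix (Fin B) (Fin c) (AdjoinRoot f)}
    {p : Fin c → AdjoinRoot f} {s : List Bool} {d : Fin B → ℕ} {Y : Fin B → Fin ℓ → Bool}
    (h : IsPossible f E p s d Y) (j : Fin B) (hj : d j = 0) (t : Fin ℓ) :
    Y j t = s.getD (j * ℓ + t + shift d j) false := by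
  have h1 := h.1 j hj
  have h2 := congrArg (fun l => l.getD t false) h1
  simp only [chunk] at h2
  rw [List.getD_eq_getElem _ _ (by simp), List.getD_eq_getElem _ _ (by simp; omega)] at h2
  simp only [List.getElem_ofFn] at h2
  rw [h2, shift]
  congr 1
  omega

theorem block_eq_of_lt (u : Fin k → Bool) (j : ℕ) (t : Fin ℓ) (h : j * ℓ + t < k) :
    block ℓ u j t = u ⟨j * ℓ + t, h⟩ := by
  simp [block, h]

theorem block_eq_of_ge (u : Fin k → Bool) (j : ℕ) (t : Fin ℓ) (h : k ≤ j * ℓ + t) :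
    block ℓ u j t = false := by
  simp [block, h]

theorem last_block (h0 : 1 ≤ ℓ) (j : Fin (numBlocks k ℓ)) (h : k < (j + 1) * ℓ) :
    (j : ℕ) + 1 = numBlocks k ℓ := by
  have h1 := numBlocks_mul_lt (k := k) h0
  by_contra hne
  have h2 : (j : ℕ) + 2 ≤ numBlocks k ℓ := by have := j.2; omega
  have h3 := Nat.mul_le_mul_right ℓ h2
  have h4 : ((j : ℕ) + 2) * ℓ = (j + 1) * ℓ + ℓ := by ring
  omega

/-- Both strings satisfy the same parities, and in characteristic two their sum is their difference.
-/
theorem vecMul_symbol_add (E : Matrix (Fin (numBlocks k ℓ)) (Fin c) (AdjoinRoot f))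
    {u : Fin k → Bool} {s : List Bool} {d : Fin (numBlocks k ℓ) → ℕ}
    {Y : Fin (numBlocks k ℓ) → Fin ℓ → Bool}
    (hY : IsPossible f E (Matrix.vecMul (messageSymbols f ℓ u) E) s d Y) :
    Matrix.vecMul (fun j => symbol f (Y j) + symbol f (block ℓ u (j : ℕ))) E = 0 := by
  have h1 : (fun j : Fin (numBlocks k ℓ) => symbol f (Y j) + symbol f (block ℓ u (j : ℕ))) =
      (fun j => symbol f (Y j)) + messageSymbols f ℓ u := rfl
  rw [h1, Matrix.add_vecMul, hY.2.1]
  funext r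
  exact add_self_adjoinRoot _

/-- For each prescription `τ` of differences on `M`, choose a message `H τ` whose shifted difference
is `τ` on `M` and zero on the other unaffected blocks. The map `(u, τ) ↦ u + H τ` is injective. If
two pairs collide, the sum of their error vectors is supported on `M` and the erasures, hence on at
most `c` blocks, and has zero parities. So it vanishes, which forces the two prescriptions, and then
the two messages, to agree. -/
theorem card_wrongSet_mul_le (hf : Irreducible f) (hd : f.natDegree = ℓ) (h0 : 1 ≤ ℓ)
    (E : Matrix (Fin (numBlocks k ℓ)) (Fin c) (AdjoinRoot f)) (hE : IsSystematicMDS E) (m : ℕ)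
    (ι : Fin k → ℕ) (hι : StrictMono ι) (v : ℕ → Bool) (d : Fin (numBlocks k ℓ) → ℕ)
    (hsum : ∑ j, d j = m) (M : Finset (Fin (numBlocks k ℓ)))
    (hM : ∀ j ∈ M, d j = 0 ∧ (j + 1) * ℓ ≤ k ∧
      ∀ i : Fin k, (i : ℕ) / ℓ = j → ι i ≠ i + shift d j)
    (hcard : M.card + (Finset.univ.filter fun j => d j ≠ 0).card ≤ c) :
    (wrongSet f E m ι v d).ncard * (2 ^ ℓ) ^ M.card ≤ 2 ^ k := by
  classical
  have hblk : ∀ i : Fin k, (i : ℕ) / ℓ < numBlocks k ℓ := fun i => by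
    have := le_numBlocks_mul (k := k) h0
    exact Nat.div_lt_of_lt_mul (by rw [mul_comm]; have := i.2; omega)
  let blk : Fin k → Fin (numBlocks k ℓ) := fun i => ⟨i / ℓ, hblk i⟩
  -- `σ i` is the message bit that the case `d` takes for bit `i`; it is undefined if block `i / ℓ`
  -- is erased or if an inserted bit is read instead.
  let σ : Fin k → Option (Fin k) := fun i =>
    if d (blk i) = 0 then
      if h : ∃ i', ι i' = i + shift d (blk i) then some h.choose else none
    else none
  have hσ1 : ∀ i a, σ i = some a → ι a = i + shift d (blk i) := by
    intro i a h
    simp only [σ] at h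
    split_ifs at h with h1 h2
    rw [← Option.some.inj h]
    exact h2.choose_spec
  have hσ2 : ∀ i a, d (blk i) = 0 → ι a = i + shift d (blk i) → σ i = some a := by
    intro i a h1 h2
    have hex : ∃ i', ι i' = i + shift d (blk i) := ⟨a, h2⟩
    simp only [σ, h1, if_true, dif_pos hex]
    rw [← hι.injective (hex.choose_spec.trans h2.symm)]
  have hσ3 : ∀ i, (∀ a, ι a ≠ i + shift d (blk i)) → σ i = none := by
    intro i h
    have hex : ¬ ∃ i', ι i' = i + shift d (blk i) := fun ⟨a, ha⟩ => h a ha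
    simp only [σ, dif_neg hex, ite_self]
  have hσ : ∀ i j a b, i < j → σ i = some a → σ j = some b → a < b := by
    intro i j a b hij ha hb
    rw [← hι.lt_iff_lt, hσ1 i a ha, hσ1 j b hb]
    have : shift d (blk i) ≤ shift d (blk j) := shift_mono d (Nat.div_le_div_right hij.le)
    have : (i : ℕ) < j := hij
    omega
  let T : (M → Fin ℓ → Bool) → Fin k → Bool := fun τ i =>
    if h : blk i ∈ M then τ ⟨blk i, h⟩ ⟨i % ℓ, Nat.mod_lt _ h0⟩ else false
  choose H hH using fun τ => exists_shift_solution σ hσ (T τ)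
  let Φ : wrongSet f E m ι v d × (M → Fin ℓ → Bool) → Fin k → Bool :=
    fun x i => xor (x.1.1 i) (H x.2 i)
  have hΦ : Function.Injective Φ := by
    rintro ⟨⟨u₁, s₁, l₁, k₁, v₁, Y₁, p₁, q₁⟩, τ₁⟩ ⟨⟨u₂, s₂, l₂, k₂, v₂, Y₂, p₂, q₂⟩, τ₂⟩ heq
    have hx : ∀ i, xor (u₁ i) (u₂ i) = xor (H τ₁ i) (H τ₂ i) := by
      intro i
      have := congrFun heq i
      simp only [Φ] at this
      revert this
      cases u₁ i <;> cases u₂ i <;> cases H τ₁ i <;> cases H τ₂ i <;> simp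
    -- The inserted bits have the same values `v` for both messages, so they cancel, and only the
    -- linear part of the difference remains.
    have key : ∀ j, d j = 0 → ∀ t : Fin ℓ,
        xor (xor (Y₁ j t) (block ℓ u₁ j t)) (xor (Y₂ j t) (block ℓ u₂ j t)) =
          if h : j ∈ M then xor (τ₁ ⟨j, h⟩ t) (τ₂ ⟨j, h⟩ t) else false := by
      intro j hj t
      by_cases hi : (j : ℕ) * ℓ + t < k
      · set i : Fin k := ⟨j * ℓ + t, hi⟩ with hidef
        have hbi : blk i = j := by
          ext
          simp only [blk, hidef]
          rw [mul_comm, Nat.mul_add_div (by omega), Nat.div_eq_of_lt t.2, add_zero]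
        have hmod : (⟨i % ℓ, Nat.mod_lt _ h0⟩ : Fin ℓ) = t := by
          ext
          simp only [hidef]
          rw [mul_comm, Nat.mul_add_mod, Nat.mod_eq_of_lt t.2]
        have hT : ∀ τ, T τ i = if h : j ∈ M then τ ⟨j, h⟩ t else false := by
          intro τ
          simp only [T, hbi, hmod]
        rw [block_eq_of_lt u₁ j t hi, block_eq_of_lt u₂ j t hi, p₁.getD j hj, p₂.getD j hj]
        have hpos : (j : ℕ) * ℓ + t + shift d j = i + shift d (blk i) := by rw [hbi]
        rw [hpos]
        have hR : (if h : j ∈ M then xor (τ₁ ⟨j, h⟩ t) (τ₂ ⟨j, h⟩ t) else false) =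
            xor (T τ₁ i) (T τ₂ i) := by
          rw [hT, hT]; split_ifs <;> simp
        rw [hR]
        have hxi := hx i
        by_cases hex : ∃ a, ι a = i + shift d (blk i)
        · obtain ⟨a, ha⟩ := hex
          have hσa := hσ2 i a (by rw [hbi]; exact hj) ha
          rw [← ha, k₁, k₂]
          by_cases hai : a = i
          · subst hai
            have hjM : j ∉ M := fun h => (hM j h).2.2 i (congrArg Fin.val hbi) (by rw [ha, hbi])
            rw [hT, hT, dif_neg hjM, dif_neg hjM]
            change xor (xor (u₁ i) (u₁ i)) (xor (u₂ i) (u₂ i)) = _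
            simp
          · have hne : σ i ≠ some i := by rw [hσa]; simpa using hai
            have e1 := hH τ₁ i hne
            have e2 := hH τ₂ i hne
            have hxa := hx a
            rw [hσa, Option.elim_some] at e1 e2
            rw [← e1, ← e2]
            revert hxa hxi
            change xor (u₁ i) (u₂ i) = _ → _ → xor (xor (u₁ a) (u₁ i)) (xor (u₂ a) (u₂ i)) = _
            cases u₁ i <;> cases u₂ i <;> cases u₁ a <;> cases u₂ a <;> cases H τ₁ i <;>
              cases H τ₂ i <;> cases H τ₁ a <;> cases H τ₂ a <;> simp
        · have hno : ∀ a, ι a ≠ i + shift d (blk i) := fun a ha => hex ⟨a, ha⟩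
          have hσn := hσ3 i hno
          have hlt : (i : ℕ) + shift d (blk i) < k + m := by
            have := shift_add_le_sum d (blk i)
            have := i.2
            omega
          rw [v₁ _ hlt hno, v₂ _ hlt hno]
          have hne : σ i ≠ some i := by rw [hσn]; simp
          have e1 := hH τ₁ i hne
          have e2 := hH τ₂ i hne
          rw [hσn, Option.elim_none] at e1 e2
          rw [← e1, ← e2]
          revert hxi
          change xor (u₁ i) (u₂ i) = _ → xor (xor (v _) (u₁ i)) (xor (v _) (u₂ i)) = _
          cases u₁ i <;> cases u₂ i <;> cases H τ₁ i <;> cases H τ₂ i <;>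
            cases v (i + shift d (blk i)) <;> simp
      · push Not at hi
        have hk1 : k < ((j : ℕ) + 1) * ℓ := by have := t.2; rw [Nat.succ_mul]; omega
        -- In the padded part of the last block, all `m` assumed insertions lie before it if it is
        -- unaffected; both the message block and the received string give zeros there.
        have hjl := last_block h0 j hk1
        have hsh : shift d j = m := (shift_last d j hjl hj).trans hsum
        rw [block_eq_of_ge u₁ j t hi, block_eq_of_ge u₂ j t hi, p₁.getD j hj, p₂.getD j hj,
          List.getD_eq_default _ _ (by omega), List.getD_eq_default _ _ (by omega),
          dif_neg fun h => absurd (hM j h).2.1 (by omega)]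
        rfl
    let D : Fin (numBlocks k ℓ) → AdjoinRoot f := fun j =>
      (symbol f (Y₁ j) + symbol f (block ℓ u₁ (j : ℕ))) +
        (symbol f (Y₂ j) + symbol f (block ℓ u₂ (j : ℕ)))
    have hDx : ∀ j, D j = symbol f fun t =>
        xor (xor (Y₁ j t) (block ℓ u₁ j t)) (xor (Y₂ j t) (block ℓ u₂ j t)) := by
      intro j
      rw [symbol_xor f (fun t => xor (Y₁ j t) (block ℓ u₁ j t)), symbol_xor, symbol_xor]
    have hDE : Matrix.vecMul D E = 0 := by
      have : D = (fun j => symbol f (Y₁ j) + symbol f (block ℓ u₁ (j : ℕ))) +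
        fun j => symbol f (Y₂ j) + symbol f (block ℓ u₂ (j : ℕ)) := rfl
      rw [this, Matrix.add_vecMul, vecMul_symbol_add E p₁, vecMul_symbol_add E p₂, add_zero]
    have hfalse : symbol f (fun _ : Fin ℓ => false) = 0 := by simp [symbol]
    have hD : D = 0 := by
      refine hE.eq_zero D (M ∪ Finset.univ.filter fun j => d j ≠ 0) Finset.univ ?_
        (fun r _ => congrFun hDE r) ?_
      · intro j hj
        simp only [Finset.mem_union, Finset.mem_filter, Finset.mem_univ, true_and, not_or,
          not_not] at hj
        rw [hDx]
        simp only [key j hj.2, hj.1, dif_neg, not_false_eq_true]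
        exact hfalse
      · rw [Finset.card_univ, Fintype.card_fin]
        exact (Finset.card_union_le _ _).trans hcard
    have hτ : τ₁ = τ₂ := by
      funext ⟨j, hj⟩
      have h1 := congrFun hD j
      rw [hDx] at h1
      simp only [key j (hM j hj).1, hj, dif_pos, Pi.zero_apply] at h1
      rw [← hfalse] at h1
      have h2 := (symbol_bijective hf hd).1 h1
      funext t
      simpa using congrFun h2 t
    subst hτ
    have hu : u₁ = u₂ := by
      funext i
      have := hx i
      simpa using this
    subst hu
    rfl
  have h1 := Nat.card_le_card_of_injective Φ hΦ
  rw [Nat.card_prod, Nat.card_coe_set_eq] at h1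
  simpa using h1

end field

end

end GC

/-! ### Displaced blocks: actual insertions against assumed ones -/

namespace GC

noncomputable section

theorem strictMono_add_le {k : ℕ} {ι : Fin k → ℕ} (hι : StrictMono ι) (n : ℕ) (i j : Fin k)
    (h : (j : ℕ) = i + n) : ι i + n ≤ ι j := by
  induction n generalizing j with
  | zero => rw [show i = j by ext; omega]; simp
  | succ n ih =>
    have hj : (i : ℕ) + n < k := by have := j.2; omega
    have h1 := ih ⟨i + n, hj⟩ rfl
    have h2 : ι ⟨i + n, hj⟩ < ι j := hι (by rw [Fin.lt_def]; simp; omega)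
    omega

/-- The number of insertions before the first bit of block `j`, if the bits are received at the
positions `ι` and there are `m` insertions. -/
def offset {k : ℕ} (ℓ m : ℕ) (ι : Fin k → ℕ) (j : ℕ) : ℕ :=
  if h : j * ℓ < k then ι ⟨j * ℓ, h⟩ - j * ℓ else m

section offset

variable {k ℓ m : ℕ} {ι : Fin k → ℕ}

theorem le_of_strictMono (hι : StrictMono ι) (i : Fin k) : (i : ℕ) ≤ ι i := by
  have := strictMono_add_le hι i ⟨0, by have := i.2; omega⟩ i (by simp)
  omega

theorem le_add_of_strictMono (hι : StrictMono ι) (hm : ∀ i, ι i < k + m) (i : Fin k) :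
    ι i ≤ i + m := by
  have h1 := strictMono_add_le hι (k - 1 - i) i ⟨k - 1, by have := i.2; omega⟩
    (by simp; have := i.2; omega)
  have h2 := hm ⟨k - 1, by have := i.2; omega⟩
  have := i.2
  omega

theorem offset_eq {j : ℕ} (h : j * ℓ < k) : offset ℓ m ι j = ι ⟨j * ℓ, h⟩ - j * ℓ := dif_pos h

theorem offset_of_le {j : ℕ} (h : k ≤ j * ℓ) : offset ℓ m ι j = m := dif_neg (by omega)

theorem offset_le (hι : StrictMono ι) (hm : ∀ i, ι i < k + m) (j : ℕ) : offset ℓ m ι j ≤ m := by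
  by_cases h : j * ℓ < k
  · have := le_add_of_strictMono hι hm ⟨j * ℓ, h⟩
    rw [offset_eq h]
    simp only at this
    omega
  · rw [offset_of_le (by omega)]

theorem offset_mono (hι : StrictMono ι) (hm : ∀ i, ι i < k + m) {i j : ℕ} (hij : i ≤ j) :
    offset ℓ m ι i ≤ offset ℓ m ι j := by
  by_cases h : j * ℓ < k
  · have h1 := Nat.mul_le_mul_right ℓ hij
    have h2 : i * ℓ < k := by omega
    have h3 := strictMono_add_le hι (j * ℓ - i * ℓ) ⟨i * ℓ, h2⟩ ⟨j * ℓ, h⟩ (by simp; omega)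
    have h4 := le_of_strictMono hι ⟨i * ℓ, h2⟩
    rw [offset_eq h, offset_eq h2]
    simp only at h4
    omega
  · rw [offset_of_le (j := j) (by omega)]
    exact offset_le hι hm i

/-- `ι i - i` does not decrease; having equal values at both ends of the block, it is constant on
it. -/
theorem eq_add_offset (hι : StrictMono ι) (hm : ∀ i, ι i < k + m) (h0 : 1 ≤ ℓ) {j : ℕ}
    (hj : offset ℓ m ι j = offset ℓ m ι (j + 1)) (i : Fin k) (hi : (i : ℕ) / ℓ = j) :
    ι i = i + offset ℓ m ι j := by
  have h1 : j * ℓ ≤ i := by rw [← hi]; exact Nat.div_mul_le_self _ _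
  have h2 : (i : ℕ) < (j + 1) * ℓ := by
    rw [← hi, Nat.succ_mul]; exact Nat.lt_div_mul_add h0
  have h3 : j * ℓ < k := by have := i.2; omega
  have h4 := strictMono_add_le hι (i - j * ℓ) ⟨j * ℓ, h3⟩ i (by simp; omega)
  have h5 := le_of_strictMono hι ⟨j * ℓ, h3⟩
  simp only at h5
  refine le_antisymm ?_ (by rw [offset_eq h3]; omega)
  rw [hj]
  by_cases h : (j + 1) * ℓ < k
  · have h6 := strictMono_add_le hι ((j + 1) * ℓ - i) i ⟨(j + 1) * ℓ, h⟩ (by simp; omega)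
    rw [offset_eq h]
    omega
  · rw [offset_of_le (by omega)]
    exact le_add_of_strictMono hι hm i

/-- The blocks in which insertions take place. -/
def jumps {k : ℕ} (B ℓ m : ℕ) (ι : Fin k → ℕ) : Finset (Fin B) :=
  Finset.univ.filter fun j => offset ℓ m ι j ≠ offset ℓ m ι (j + 1)

/-- The increments of the offset telescope to at most `m`, and each jump contributes at least one.
-/
theorem card_jumps_le (hι : StrictMono ι) (hm : ∀ i, ι i < k + m) (B : ℕ) :
    (jumps B ℓ m ι).card ≤ m := by
  have h1 : (jumps B ℓ m ι).card ≤
      ∑ j : Fin B, (offset ℓ m ι (j + 1) - offset ℓ m ι j) := by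
    rw [jumps, Finset.card_eq_sum_ones, Finset.sum_filter]
    refine Finset.sum_le_sum fun j _ => ?_
    have := offset_mono hι hm (ℓ := ℓ) (Nat.le_succ j)
    rw [Nat.succ_eq_add_one] at this
    split_ifs <;> omega
  rw [Fin.sum_univ_eq_sum_range fun j => offset ℓ m ι (j + 1) - offset ℓ m ι j] at h1
  rw [Finset.sum_range_tsub (fun i j hij => offset_mono hι hm hij)] at h1
  exact h1.trans ((Nat.sub_le _ _).trans (offset_le hι hm B))

theorem offset_eq_of_no_jump {B : ℕ} (i n : ℕ) (hB : i + n ≤ B)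
    (h : ∀ j : Fin B, i ≤ j → (j : ℕ) < i + n → j ∉ jumps B ℓ m ι) :
    offset ℓ m ι i = offset ℓ m ι (i + n) := by
  induction n with
  | zero => rfl
  | succ n ih =>
    rw [ih (by omega) fun j h1 h2 => h j h1 (by omega)]
    have := h ⟨i + n, by omega⟩ (by simp) (by simp)
    simpa [jumps, Nat.add_assoc] using this

/-- The blocks which are entirely displaced. -/
def moved {B : ℕ} (ℓ m : ℕ) (ι : Fin k → ℕ) (d : Fin B → ℕ) : Finset (Fin B) :=
  Finset.univ.filter fun j => j ∉ jumps B ℓ m ι ∧ d j = 0 ∧ offset ℓ m ι j ≠ shift d j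

/-- A block reaching beyond the message is the last one. Without actual or assumed insertions in it,
both the actual and the assumed shift equal `m`, so it is not displaced. -/
theorem le_of_mem_moved (h0 : 1 ≤ ℓ) {d : Fin (numBlocks k ℓ) → ℕ} (hsum : ∑ j, d j = m)
    {j : Fin (numBlocks k ℓ)} (hj : j ∈ moved ℓ m ι d) : ((j : ℕ) + 1) * ℓ ≤ k := by
  by_contra hlt
  push Not at hlt
  have hl := last_block h0 j hlt
  simp only [moved, jumps, Finset.mem_filter, Finset.mem_univ, true_and, not_not] at hj
  obtain ⟨h1, h2, h3⟩ := hj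
  rw [offset_of_le hlt.le] at h1
  exact h3 (by rw [h1, shift_last d j hl h2, hsum])

theorem ne_of_mem_moved (hι : StrictMono ι) (hm : ∀ i, ι i < k + m) (h0 : 1 ≤ ℓ)
    {d : Fin (numBlocks k ℓ) → ℕ} {j : Fin (numBlocks k ℓ)} (hj : j ∈ moved ℓ m ι d) (i : Fin k)
    (hi : (i : ℕ) / ℓ = j) : ι i ≠ i + shift d j := by
  simp only [moved, jumps, Finset.mem_filter, Finset.mem_univ, true_and, not_not] at hj
  rw [eq_add_offset hι hm h0 hj.1 i hi]
  have := hj.2.2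
  omega

end offset

section field

variable {f : (ZMod 2)[X]} {k ℓ c m : ℕ} {ι : Fin k → ℕ}

theorem card_affected_le {B : ℕ} (d : Fin B → ℕ) (hsum : ∑ j, d j = m) :
    (Finset.univ.filter fun j => d j ≠ 0).card ≤ m := by
  rw [← hsum, Finset.card_eq_sum_ones, Finset.sum_filter]
  refine Finset.sum_le_sum fun j _ => ?_
  split_ifs <;> omega

/-- An unaffected block without insertions that is not displaced is read correctly. Hence the
nonzero error vector is supported on the displaced blocks, the at most `m` blocks with insertions
and the at most `m` erased ones; being annihilated by `E`, it has weight at least `c + 1`. -/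
theorem card_moved_ge (hf : Irreducible f) (hd : f.natDegree = ℓ) (hι : StrictMono ι)
    (hm : ∀ i, ι i < k + m) (h0 : 1 ≤ ℓ) (E : Matrix (Fin (numBlocks k ℓ)) (Fin c) (AdjoinRoot f))
    (hE : IsSystematicMDS E) (v : ℕ → Bool) (d : Fin (numBlocks k ℓ) → ℕ)
    (hsum : ∑ j, d j = m) (hne : (wrongSet f E m ι v d).Nonempty) :
    c + 1 ≤ (moved ℓ m ι d).card + 2 * m := by
  obtain ⟨u, s, hs, hu, -, Y, hY, hYu⟩ := hne
  by_contra hlt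
  push Not at hlt
  apply hYu
  have hD := hE.eq_zero (fun j => symbol f (Y j) + symbol f (block ℓ u (j : ℕ)))
    (moved ℓ m ι d ∪ (jumps _ ℓ m ι ∪ Finset.univ.filter fun j => d j ≠ 0)) Finset.univ ?_
    (fun r _ => congrFun (vecMul_symbol_add E hY) r) ?_
  · funext j
    apply (symbol_bijective hf hd).1
    have h1 := congrFun hD j
    simp only [Pi.zero_apply] at h1
    have h2 := add_self_adjoinRoot (symbol f (block ℓ u (j : ℕ)))
    linear_combination h1 - h2
  · intro j hj
    simp only [moved, Finset.mem_union, Finset.mem_filter, Finset.mem_univ, true_and, not_or,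
      not_and, not_not] at hj
    obtain ⟨h1, h2, h3⟩ := hj
    have h4 := h1 h2 h3
    have h5 : offset ℓ m ι j = offset ℓ m ι (j + 1) := by simpa [jumps] using h2
    have hb : Y j = block ℓ u (j : ℕ) := by
      funext t
      rw [hY.getD j h3]
      by_cases hi : (j : ℕ) * ℓ + t < k
      · rw [block_eq_of_lt u j t hi, ← hu]
        congr 1
        rw [eq_add_offset hι hm h0 h5 _ (by
          simp only
          rw [mul_comm, Nat.mul_add_div (by omega), Nat.div_eq_of_lt t.2, add_zero]), h4]
      · push Not at hi
        have hl := last_block h0 j (by have := t.2; rw [Nat.succ_mul]; omega)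
        rw [block_eq_of_ge u j t hi, shift_last d j hl h3, hsum,
          List.getD_eq_default _ _ (by omega)]
    simp only [hb]
    exact add_self_adjoinRoot _
  · rw [Finset.card_univ, Fintype.card_fin]
    have h1 := Finset.card_union_le (moved ℓ m ι d)
      (jumps _ ℓ m ι ∪ Finset.univ.filter fun j => d j ≠ 0)
    have h2 := Finset.card_union_le (jumps (numBlocks k ℓ) ℓ m ι)
      (Finset.univ.filter fun j => d j ≠ 0)
    have h3 := card_jumps_le hι hm (ℓ := ℓ) (numBlocks k ℓ)
    have h4 := card_affected_le d hsum
    omega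

/-- The blocks in the neighbourhood of the insertions and of the first block. -/
def nearJumps {k : ℕ} (B ℓ m c : ℕ) (ι : Fin k → ℕ) : Finset (Fin B) :=
  Finset.univ.filter fun j => (j : ℕ) ≤ c ∨
    ∃ i ∈ jumps B ℓ m ι, (i : ℕ) ≤ j + c ∧ (j : ℕ) ≤ i + c

theorem card_nearJumps_le (hι : StrictMono ι) (hm : ∀ i, ι i < k + m) (B : ℕ) :
    (nearJumps B ℓ m c ι).card ≤ (m + 1) * (2 * c + 1) := by
  classical
  have h1 : (nearJumps B ℓ m c ι).map Fin.valEmbedding ⊆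
      Finset.range (c + 1) ∪ (jumps B ℓ m ι).biUnion fun i => Finset.Icc (i - c : ℕ) (i + c) := by
    intro x hx
    simp only [nearJumps, Finset.mem_map, Finset.mem_filter, Finset.mem_univ, true_and] at hx
    obtain ⟨j, hj, rfl⟩ := hx
    simp only [Finset.mem_union, Finset.mem_range, Finset.mem_biUnion, Finset.mem_Icc,
      Fin.valEmbedding_apply]
    rcases hj with hj | ⟨i, hi, h1, h2⟩
    · left; omega
    · exact Or.inr ⟨i, hi, by omega, by omega⟩
  have h2 := Finset.card_le_card h1
  rw [Finset.card_map] at h2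
  have h3 := Finset.card_union_le (Finset.range (c + 1))
    ((jumps B ℓ m ι).biUnion fun i => Finset.Icc (i - c : ℕ) (i + c))
  have h4 := Finset.card_biUnion_le_card_mul (jumps B ℓ m ι)
    (fun i => Finset.Icc (i - c : ℕ) (i + c)) (2 * c + 1) fun i _ => by
      rw [Nat.card_Icc]; omega
  have h5 := Nat.mul_le_mul_right (2 * c + 1) (card_jumps_le hι hm (ℓ := ℓ) B)
  rw [Finset.card_range] at h3
  nlinarith

/-- Suppose that block `j` is erased, far from all insertions and from the first block. The actual
offset is constant around `j`, whereas the assumed shift increases at `j`, so the two disagree on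
one side of `j`. That side contributes `c` displaced or erased blocks, unless it is cut short by the
end of the message, where the total number of insertions gives a contradiction. -/
theorem near_of_card_lt (h0 : 1 ≤ ℓ)
    (d : Fin (numBlocks k ℓ) → ℕ) (hsum : ∑ j, d j = m)
    (hlt : (moved ℓ m ι d).card + (Finset.univ.filter fun j => d j ≠ 0).card < c)
    (j : Fin (numBlocks k ℓ)) (hj : d j ≠ 0) : j ∈ nearJumps (numBlocks k ℓ) ℓ m c ι := by
  classical
  by_contra hnear
  simp only [nearJumps, Finset.mem_filter, Finset.mem_univ, true_and, not_or, not_exists,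
    not_and, not_le] at hnear
  obtain ⟨hjc, hno⟩ := hnear
  have hno' : ∀ i : Fin (numBlocks k ℓ), (j : ℕ) ≤ i + c → (i : ℕ) ≤ j + c →
      i ∉ jumps (numBlocks k ℓ) ℓ m ι := fun i h1 h2 hi => by
    have := hno i hi h2; omega
  have hcard : ∀ a : ℕ, a + c ≤ numBlocks k ℓ → (∀ i : Fin (numBlocks k ℓ), a ≤ i →
      (i : ℕ) < a + c → i ∉ jumps (numBlocks k ℓ) ℓ m ι ∧ offset ℓ m ι i ≠ shift d i) →
      False := by
    intro a ha h
    have h1 : (Finset.univ.filter fun i : Fin (numBlocks k ℓ) => a ≤ i ∧ (i : ℕ) < a + c) ⊆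
        moved ℓ m ι d ∪ Finset.univ.filter fun j => d j ≠ 0 := by
      intro i hi
      simp only [Finset.mem_filter, Finset.mem_univ, true_and] at hi
      have := h i hi.1 hi.2
      by_cases hdi : d i = 0 <;> simp [moved, hdi, this]
    have h2 := (Finset.card_le_card h1).trans (Finset.card_union_le _ _)
    have h3 : Finset.Ico a (a + c) ⊆ (Finset.univ.filter fun i : Fin (numBlocks k ℓ) =>
        a ≤ i ∧ (i : ℕ) < a + c).map Fin.valEmbedding := by
      intro x hx
      simp only [Finset.mem_Ico] at hx
      simp only [Finset.mem_map, Finset.mem_filter, Finset.mem_univ, true_and,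
        Fin.valEmbedding_apply]
      exact ⟨⟨x, by omega⟩, hx, rfl⟩
    have h4 := Finset.card_le_card h3
    rw [Finset.card_map, Nat.card_Ico] at h4
    omega
  have hj2 := j.2
  have hright : ∀ n : ℕ, n ≤ c + 1 → (j : ℕ) + n ≤ numBlocks k ℓ →
      offset ℓ m ι j = offset ℓ m ι (j + n) := fun n hn hB =>
    offset_eq_of_no_jump _ _ hB fun i h1 h2 => hno' i (by omega) (by omega)
  by_cases hcase : shift d j < offset ℓ m ι j
  -- The assumed shift is too small at `j`, hence also on the `c` blocks before it.
  · refine hcard (j - c) (by omega) fun i h1 h2 => ⟨hno' i (by omega) (by omega), ?_⟩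
    have h3 : offset ℓ m ι i = offset ℓ m ι j := by
      obtain ⟨n, hn⟩ : ∃ n, (j : ℕ) = i + n := ⟨j - i, by omega⟩
      rw [hn]
      exact offset_eq_of_no_jump _ _ (by omega) fun i' h1 h2 => hno' i' (by omega) (by omega)
    have h4 := shift_mono d (show i ≤ j by rw [Fin.le_def]; omega)
    omega
  · by_cases hB : (j : ℕ) + 1 + c ≤ numBlocks k ℓ
    -- The assumed shift is at least the offset at `j`, hence larger on the `c` blocks after it.
    · refine hcard (j + 1) hB fun i h1 h2 => ⟨hno' i (by omega) (by omega), ?_⟩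
      obtain ⟨n, hn⟩ : ∃ n, (i : ℕ) = j + n := ⟨i - j, by omega⟩
      have h3 : offset ℓ m ι j = offset ℓ m ι i := by
        rw [hn]; exact hright n (by omega) (by omega)
      have h4 := shift_add_le_shift d (show j < i by rw [Fin.lt_def]; omega)
      omega
    -- Near the end the offset at `j` is already `m`, which leaves no insertion to be assumed in
    -- block `j`.
    · obtain ⟨n, hn⟩ : ∃ n, numBlocks k ℓ = j + n := ⟨numBlocks k ℓ - j, by omega⟩
      have h3 := hright n (by omega) (by omega)
      rw [← hn, offset_of_le (le_numBlocks_mul h0)] at h3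
      have h4 := shift_add_le_sum d j
      omega

/-- The distributions of `m` insertions among `B` blocks. -/
def distributions (B m : ℕ) : Finset (Fin B → ℕ) :=
  ((casesT B m).val.map fun ds (j : Fin B) => ds.getD j 0).toFinset

theorem mem_distributions {B : ℕ} {d : Fin B → ℕ} (hsum : ∑ j, d j = m) :
    d ∈ distributions B m := by
  rw [distributions, List.mem_toFinset, List.mem_map]
  refine ⟨List.ofFn d, (mem_casesT B m _).2 ⟨by simp, by rw [List.sum_ofFn, hsum]⟩, ?_⟩
  funext j
  simp [j.2]

theorem sum_of_mem_distributions {B : ℕ} {d : Fin B → ℕ} (h : d ∈ distributions B m) :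
    ∑ j, d j = m := by
  rw [distributions, List.mem_toFinset, List.mem_map] at h
  obtain ⟨ds, hds, rfl⟩ := h
  obtain ⟨rfl, h2⟩ := (mem_casesT B m _).1 hds
  rw [← h2, ← List.sum_ofFn]
  congr 1
  apply List.ext_getElem <;> simp

theorem card_distributions_le (B m : ℕ) : (distributions B m).card ≤ B ^ m :=
  (List.toFinset_card_le _).trans (by rw [List.length_map]; exact casesT_length_le B m)

end field

end

end GC

/-! ### Summing over cases, cuts and inserted values -/

namespace GC

noncomputable section

section

variable {f : (ZMod 2)[X]} {k ℓ c m : ℕ} {ι : Fin k → ℕ}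

/-- The dichotomy: either displaced blocks and erasures number at least `c`, and enough displaced
blocks are available for the strong bound, or the case is one of the few near the insertions and the
weaker bound must do. -/
theorem ncard_wrongSet_mul_le (hf : Irreducible f) (hd : f.natDegree = ℓ) (h0 : 1 ≤ ℓ)
    (E : Matrix (Fin (numBlocks k ℓ)) (Fin c) (AdjoinRoot f)) (hE : IsSystematicMDS E)
    (hι : StrictMono ι) (hm : ∀ i, ι i < k + m) (v : ℕ → Bool) (d : Fin (numBlocks k ℓ) → ℕ)
    (hsum : ∑ j, d j = m) :
    (wrongSet f E m ι v d).ncard * (2 ^ ℓ) ^ (c - m) ≤ 2 ^ k ∨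
      ((∀ j, d j ≠ 0 → j ∈ nearJumps (numBlocks k ℓ) ℓ m c ι) ∧
        (wrongSet f E m ι v d).ncard * (2 ^ ℓ) ^ (c + 1 - 2 * m) ≤ 2 ^ k) := by
  have hpow : 0 < 2 ^ ℓ := by positivity
  have hW := card_affected_le d hsum
  have hM : ∀ j ∈ moved ℓ m ι d, d j = 0 ∧ ((j : ℕ) + 1) * ℓ ≤ k ∧
      ∀ i : Fin k, (i : ℕ) / ℓ = j → ι i ≠ i + shift d j := fun j hj =>
    ⟨(Finset.mem_filter.1 hj).2.2.1, le_of_mem_moved h0 hsum hj, ne_of_mem_moved hι hm h0 hj⟩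
  by_cases hlt : (moved ℓ m ι d).card + (Finset.univ.filter fun j => d j ≠ 0).card < c
  · refine Or.inr ⟨near_of_card_lt h0 d hsum hlt, ?_⟩
    rcases (wrongSet f E m ι v d).eq_empty_or_nonempty with he | hne
    · simp [he]
    · have h1 := card_moved_ge hf hd hι hm h0 E hE v d hsum hne
      refine le_trans (Nat.mul_le_mul_left _ (Nat.pow_le_pow_right hpow ?_))
        (card_wrongSet_mul_le hf hd h0 E hE m ι hι v d hsum _ hM hlt.le)
      omega
  · by_cases hcm : c ≤ m
    · left
      rw [Nat.sub_eq_zero_of_le hcm, pow_zero, mul_one]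
      refine (Set.ncard_le_ncard (Set.subset_univ _)).trans ?_
      rw [Set.ncard_univ, Nat.card_eq_fintype_card]
      simp
    -- Exactly as many displaced blocks as the MDS property allows beside the erasures; there are at
    -- least `c - m` of them.
    obtain ⟨M, hMs, hMc⟩ := Finset.exists_subset_card_eq (s := moved ℓ m ι d)
      (n := c - (Finset.univ.filter fun j => d j ≠ 0).card) (by omega)
    left
    refine le_trans (Nat.mul_le_mul_left _ (Nat.pow_le_pow_right hpow ?_))
      (card_wrongSet_mul_le hf hd h0 E hE m ι hι v d hsum M (fun j hj => hM j (hMs hj)) ?_)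
    · omega
    · omega

theorem card_near_distributions_le (N : Finset (Fin (numBlocks k ℓ))) :
    ((distributions (numBlocks k ℓ) m).filter fun d => ∀ j, d j ≠ 0 → j ∈ N).card ≤
      (m + 1) ^ N.card := by
  classical
  refine (Finset.card_le_card (t := Fintype.piFinset fun j =>
    if j ∈ N then Finset.range (m + 1) else {0}) fun d hd => ?_).trans ?_
  · rw [Finset.mem_filter] at hd
    rw [Fintype.mem_piFinset]
    intro j
    split_ifs with h
    · rw [Finset.mem_range, ← sum_of_mem_distributions hd.1]
      exact Nat.lt_succ_of_le (Finset.single_le_sum (f := d) (fun _ _ => Nat.zero_le _)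
        (Finset.mem_univ j))
    · rw [Finset.mem_singleton]
      by_contra h'
      exact h (hd.2 j h')
  · rw [Fintype.card_piFinset]
    simp only [apply_ite Finset.card, Finset.card_range, Finset.card_singleton]
    rw [Finset.prod_ite, Finset.prod_const, Finset.prod_const_one, mul_one]
    simp

theorem sum_ncard_wrongSet_le (hf : Irreducible f) (hd : f.natDegree = ℓ) (h0 : 1 ≤ ℓ)
    (E : Matrix (Fin (numBlocks k ℓ)) (Fin c) (AdjoinRoot f)) (hE : IsSystematicMDS E)
    (hι : StrictMono ι) (hm : ∀ i, ι i < k + m) (v : ℕ → Bool) :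
    ((∑ d ∈ distributions (numBlocks k ℓ) m, (wrongSet f E m ι v d).ncard : ℕ) : ℝ) ≤
      (numBlocks k ℓ : ℝ) ^ m * (2 ^ k / (2 ^ ℓ) ^ (c - m)) +
        (m + 1 : ℝ) ^ ((m + 1) * (2 * c + 1)) * (2 ^ k / (2 ^ ℓ) ^ (c + 1 - 2 * m)) := by
  classical
  set N := nearJumps (numBlocks k ℓ) ℓ m c ι
  have h1 : ∀ d ∈ distributions (numBlocks k ℓ) m, ((wrongSet f E m ι v d).ncard : ℝ) ≤
      2 ^ k / (2 ^ ℓ) ^ (c - m) +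
        if ∀ j, d j ≠ 0 → j ∈ N then (2 : ℝ) ^ k / (2 ^ ℓ) ^ (c + 1 - 2 * m) else 0 := by
    intro d hdm
    have hp : (0 : ℝ) ≤ 2 ^ k / (2 ^ ℓ) ^ (c - m) := by positivity
    have hp' : (0 : ℝ) ≤ 2 ^ k / (2 ^ ℓ) ^ (c + 1 - 2 * m) := by positivity
    rcases ncard_wrongSet_mul_le hf hd h0 E hE hι hm v d (sum_of_mem_distributions hdm) with
      h | ⟨hN, h⟩
    · have h' : ((wrongSet f E m ι v d).ncard : ℝ) ≤ 2 ^ k / (2 ^ ℓ) ^ (c - m) := by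
        rw [le_div_iff₀ (by positivity)]; exact_mod_cast h
      refine h'.trans (le_add_of_nonneg_right ?_)
      split_ifs <;> simp [hp']
    · have h' : ((wrongSet f E m ι v d).ncard : ℝ) ≤ 2 ^ k / (2 ^ ℓ) ^ (c + 1 - 2 * m) := by
        rw [le_div_iff₀ (by positivity)]; exact_mod_cast h
      rw [if_pos hN]
      exact h'.trans (le_add_of_nonneg_left hp)
  push_cast
  refine (Finset.sum_le_sum h1).trans ?_
  rw [Finset.sum_add_distrib, Finset.sum_const, ← Finset.sum_filter, Finset.sum_const,
    nsmul_eq_mul, nsmul_eq_mul]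
  refine add_le_add (mul_le_mul_of_nonneg_right ?_ (by positivity))
    (mul_le_mul_of_nonneg_right ?_ (by positivity))
  · exact_mod_cast card_distributions_le _ m
  · refine le_trans (b := ((m + 1 : ℝ) ^ N.card)) ?_ (pow_le_pow_right₀
      (by linarith [(Nat.cast_nonneg m : (0:ℝ) ≤ m)]) (card_nearJumps_le hι hm _))
    exact_mod_cast card_near_distributions_le N

/-- The messages for which some values of the bits inserted at the positions `S` make the decoder
fail. -/
def failSet (δ k ℓ c : ℕ) (f : (ZMod 2)[X])
    (E : Matrix (Fin (numBlocks k ℓ)) (Fin c) (AdjoinRoot f)) (S : Finset ℕ) :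
    Set (Fin k → Bool) :=
  {u | ∃ y, InsertedAt S (encode δ k ℓ c f E u) y ∧ decode δ k ℓ c f E y = none}

/-- A union bound: `δ + 1` cuts `a` between message and parity bits, `δ + 1` numbers `m` of extra
bits in the systematic part, at most `2 ^ δ` values of these bits, and the cases counted by `N`. -/
theorem ncard_failSet_le {δ : ℕ} (hf : Irreducible f) (hd : f.natDegree = ℓ) (h0 : 1 ≤ ℓ)
    (hk : ℓ ≤ k) (E : Matrix (Fin (numBlocks k ℓ)) (Fin c) (AdjoinRoot f)) (S : Finset ℕ)
    (hS : S.card ≤ δ) (N : ℕ) (hN : ∀ m ≤ δ, ∀ ι : Fin k → ℕ, StrictMono ι →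
      (∀ i, ι i < k + m) → ∀ v,
        ∑ d ∈ distributions (numBlocks k ℓ) m, (wrongSet f E m ι v d).ncard ≤ N) :
    (failSet δ k ℓ c f E S).ncard ≤ (δ + 1) * ((δ + 1) * (2 ^ δ * N)) := by
  classical
  let ι : ℕ → Fin k → ℕ := fun a i => (keptPositions S a).getD i 0
  let P : ℕ → ℕ → Finset ℕ := fun a m => Finset.range (k + m) \ Finset.univ.image (ι a)
  let G : ℕ → ℕ → Finset ℕ → (Fin (numBlocks k ℓ) → ℕ) → Set (Fin k → Bool) := fun a m T d =>
    wrongSet f E m (ι a) (fun p => decide (p ∈ T)) d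
  -- The guard ensures that `ι a` lists exactly `k` positions, is strictly increasing and stays
  -- inside the received systematic part.
  let G' : ℕ → ℕ → Set (Fin k → Bool) := fun a m =>
    if (keptPositions S a).length = k ∧ a ≤ k + m then
      ⋃ T ∈ (P a m).powerset, ⋃ d ∈ distributions (numBlocks k ℓ) m, G a m T d
    else ∅
  have hmono : ∀ a, (keptPositions S a).length = k → StrictMono (ι a) := by
    intro a ha i j hij
    have hp : (keptPositions S a).Pairwise (· < ·) := List.pairwise_lt_range.filter _
    have h1 : (i : ℕ) < (keptPositions S a).length := by rw [ha]; exact i.2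
    have h2 : (j : ℕ) < (keptPositions S a).length := by rw [ha]; exact j.2
    simp only [ι, List.getD_eq_getElem _ _ h1, List.getD_eq_getElem _ _ h2]
    exact List.pairwise_iff_getElem.1 hp i j h1 h2 hij
  have hlt : ∀ a, (keptPositions S a).length = k → ∀ i, ι a i < a := by
    intro a ha i
    have h1 : (i : ℕ) < (keptPositions S a).length := by rw [ha]; exact i.2
    have h2 : (keptPositions S a)[(i : ℕ)] ∈ keptPositions S a := List.getElem_mem h1
    simp only [ι, List.getD_eq_getElem _ _ h1]
    exact List.mem_range.1 (List.mem_filter.1 h2).1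
  have hsub : failSet δ k ℓ c f E S ⊆
      ⋃ a ∈ Finset.Icc k (k + δ), ⋃ m ∈ Finset.range (δ + 1), G' a m := by
    rintro u ⟨y, hy, hfail⟩
    obtain ⟨a, s, h1, h2, h3, h4, Y, ⟨d, hdsum, hpos⟩, hYu⟩ :=
      exists_wrong_of_decode_eq_none hf hd h0 hk E u S hS y hy hfail
    have ha : (keptPositions S a).length = k := by simpa using congrArg List.length h4
    have hak : k ≤ a := by
      have := List.length_filter_le (· ∉ S) (List.range a)
      rw [List.length_range] at this
      unfold keptPositions at ha
      omega
    obtain ⟨m, hm⟩ : ∃ m, s.length = k + m := ⟨s.length - k, by omega⟩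
    simp only [Set.mem_iUnion]
    refine ⟨a, Finset.mem_Icc.2 ⟨hak, by omega⟩, m, Finset.mem_range.2 (by omega), ?_⟩
    simp only [G']
    rw [if_pos ⟨ha, by omega⟩]
    simp only [Set.mem_iUnion]
    -- The values of the extra bits are encoded by the set of extra positions that carry a one.
    refine ⟨(P a m).filter fun p => s.getD p false = true,
      Finset.mem_powerset.2 (Finset.filter_subset _ _), d, mem_distributions (by omega), s, hm,
      ?_, ?_, Y, hpos, hYu⟩
    · intro i
      have h5 : (i : ℕ) < (keptPositions S a).length := by rw [ha]; exact i.2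
      have h6 := congrArg (fun l => l.getD (i : ℕ) false) h4
      simpa [ι, h5, i.2] using h6
    · intro p hp hpi
      have : p ∈ P a m := by
        simp only [P, Finset.mem_sdiff, Finset.mem_range, Finset.mem_image, Finset.mem_univ,
          true_and, not_exists]
        exact ⟨hp, hpi⟩
      simp [this]
  have hG' : ∀ a ∈ Finset.Icc k (k + δ), ∀ m ∈ Finset.range (δ + 1),
      (G' a m).ncard ≤ 2 ^ δ * N := by
    intro a ha m hm
    rw [Finset.mem_range] at hm
    simp only [G']
    split_ifs with h
    · have hPc : (P a m).card ≤ δ := by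
        have h1 := Finset.card_sdiff_of_subset (s := Finset.univ.image (ι a))
          (t := Finset.range (k + m)) (by
            intro x hx
            obtain ⟨i, -, rfl⟩ := Finset.mem_image.1 hx
            exact Finset.mem_range.2 ((hlt a h.1 i).trans_le h.2))
        rw [Finset.card_image_of_injective _ (hmono a h.1).injective, Finset.card_range,
          Finset.card_univ, Fintype.card_fin] at h1
        have : (P a m).card = k + m - k := h1
        omega
      refine (Finset.set_ncard_biUnion_le _ _).trans ?_
      refine (Finset.sum_le_card_nsmul _ _ N fun T hT => ?_).trans ?_
      · refine (Finset.set_ncard_biUnion_le _ _).trans ?_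
        exact hN m (by omega) (ι a) (hmono a h.1) (fun i => (hlt a h.1 i).trans_le h.2) _
      · rw [Finset.card_powerset, smul_eq_mul]
        exact Nat.mul_le_mul_right _ (Nat.pow_le_pow_right (by norm_num) hPc)
    · simp
  refine (Set.ncard_le_ncard hsub).trans ?_
  refine (Finset.set_ncard_biUnion_le _ _).trans ?_
  refine (Finset.sum_le_card_nsmul _ _ ((δ + 1) * (2 ^ δ * N)) fun a ha => ?_).trans ?_
  · refine (Finset.set_ncard_biUnion_le _ _).trans ?_
    refine (Finset.sum_le_card_nsmul _ _ _ fun m hm => hG' a ha m hm).trans ?_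
    rw [Finset.card_range, smul_eq_mul]
  · rw [Nat.card_Icc, smul_eq_mul]
    apply Nat.mul_le_mul_right
    omega

end

end

end GC

/-! ### Failure probability and running time as real bounds -/

namespace GC

noncomputable section

section

variable {f : (ZMod 2)[X]} {k ℓ c δ : ℕ}

/-- Message and positions are independent, so the positions may be drawn first; given `S`, the
failure probability is the proportion of messages in `failSet`. -/
theorem failureProb_le (E : Matrix (Fin (numBlocks k ℓ)) (Fin c) (AdjoinRoot f)) (ε : ℝ)
    (h : ∀ S : Finset ℕ, S.card ≤ δ → ((failSet δ k ℓ c f E S).ncard : ℝ) ≤ ε * 2 ^ k)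
    (π : PMF (Finset ℕ)) (hπ : ∀ S ∈ π.support, S.card ≤ δ) :
    failureProb δ k ℓ c f E π ≤ ENNReal.ofReal ε := by
  classical
  have hcomm : ((PMF.uniformOfFintype (Fin k → Bool)).bind fun u => π.map fun S => (u, S)) =
      π.bind fun S => (PMF.uniformOfFintype (Fin k → Bool)).map fun u => (u, S) := by
    simp only [PMF.map]
    exact PMF.bind_comm _ _ _
  rw [failureProb, hcomm, PMF.toOuterMeasure_bind_apply]
  calc _ ≤ ∑' S, π S * ENNReal.ofReal ε := by
        refine ENNReal.tsum_le_tsum fun S => ?_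
        by_cases hS : S ∈ π.support
        · gcongr
          rw [PMF.toOuterMeasure_map_apply, PMF.toOuterMeasure_uniformOfFintype_apply]
          have h1 := h S (hπ S hS)
          have h2 : Fintype.card ((fun u => (u, S)) ⁻¹' {ω : (Fin k → Bool) × Finset ℕ |
              ∃ y, InsertedAt ω.2 (encode δ k ℓ c f E ω.1) y ∧ decode δ k ℓ c f E y = none}) =
              (failSet δ k ℓ c f E S).ncard := by
            rw [← Nat.card_eq_fintype_card]; rfl
          rw [h2]
          have h3 : ((failSet δ k ℓ c f E S).ncard : ℝ≥0∞) ≤ ENNReal.ofReal ε * 2 ^ k := by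
            rw [← ENNReal.ofReal_natCast, show (2 : ℝ≥0∞) ^ k = ENNReal.ofReal (2 ^ k) by
              rw [ENNReal.ofReal_pow (by norm_num)]; norm_num,
              ← ENNReal.ofReal_mul' (by positivity)]
            exact ENNReal.ofReal_le_ofReal h1
          have h4 : ((Fintype.card (Fin k → Bool) : ℕ) : ℝ≥0∞) = 2 ^ k := by simp
          rw [h4]
          exact ENNReal.div_le_of_le_mul h3
        · rw [(PMF.apply_eq_zero_iff _ _).2 hS, zero_mul, zero_mul]
    _ = ENNReal.ofReal ε := by rw [ENNReal.tsum_mul_right, PMF.tsum_coe, one_mul]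

theorem numBlocks_le (h0 : 1 ≤ ℓ) (hk : ℓ ≤ k) : (numBlocks k ℓ : ℝ) ≤ 2 * ((k : ℝ) / ℓ) := by
  have h1 : (numBlocks k ℓ : ℝ) * ℓ ≤ 2 * k := by exact_mod_cast numBlocks_mul_le h0 hk
  have h2 : (0 : ℝ) < ℓ := by exact_mod_cast h0
  rw [← mul_div_assoc, le_div_iff₀ h2]
  exact h1

theorem ncard_failSet_le_of_pow_le (hf : Irreducible f) (hd : f.natDegree = ℓ) (h0 : 1 ≤ ℓ)
    (hk : ℓ ≤ k) (hc : δ < c) (E : Matrix (Fin (numBlocks k ℓ)) (Fin c) (AdjoinRoot f))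
    (hE : IsSystematicMDS E) (A : ℝ)
    (hA : (2 : ℝ) ^ (ℓ * δ) ≤ A * 2 ^ ℓ * ((k : ℝ) / ℓ) ^ δ) (S : Finset ℕ) (hS : S.card ≤ δ) :
    ((failSet δ k ℓ c f E S).ncard : ℝ) ≤
      (δ + 1) * ((δ + 1) * (2 ^ δ * (2 ^ δ + (δ + 1) ^ ((δ + 1) * (2 * c + 1)) * A))) *
        (((k : ℝ) / ℓ) ^ δ / 2 ^ (ℓ * (c - δ))) * 2 ^ k := by
  set x : ℝ := (k : ℝ) / ℓ with hx
  set q : ℝ := 2 ^ ℓ with hq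
  have hℓ : (0 : ℝ) < ℓ := by exact_mod_cast h0
  have hx1 : 1 ≤ x := by rw [hx, one_le_div hℓ]; exact_mod_cast hk
  have hq1 : 1 ≤ q := one_le_pow₀ (by norm_num)
  have hq0 : 0 < q := by linarith
  rw [pow_mul, ← hq] at hA
  rw [pow_mul (2 : ℝ) ℓ (c - δ), ← hq]
  have hxδ : 0 < x ^ δ := by positivity
  have hA0 : 0 < A := by
    have : 0 < A * q * x ^ δ := lt_of_lt_of_le (by positivity) hA
    by_contra hn
    have : A * q * x ^ δ ≤ 0 := by
      rw [mul_assoc]; exact mul_nonpos_of_nonpos_of_nonneg (by linarith) (by positivity)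
    linarith
  set N₀ : ℝ := (δ + 1 : ℝ) ^ ((δ + 1) * (2 * c + 1)) with hN₀
  have hδ1 : (1 : ℝ) ≤ δ + 1 := by linarith [(Nat.cast_nonneg δ : (0:ℝ) ≤ δ)]
  -- The only use of the growth hypothesis: `q ^ (c - δ)` exceeds `q ^ (c + 1 - 2 * δ)` at most by
  -- the factor `q ^ (δ - 1) ≤ A * x ^ δ`. The truncated subtraction does no harm, since `δ + (c + 1
  -- - 2 * δ)` is still at least `c - δ + 1`.
  have hkey : (2 : ℝ) ^ k / q ^ (c + 1 - 2 * δ) ≤ A * (x ^ δ * (2 ^ k / q ^ (c - δ))) := by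
    have h1 : q ^ (c - δ) * q ≤ q ^ δ * q ^ (c + 1 - 2 * δ) := by
      rw [← pow_succ, ← pow_add]
      exact pow_le_pow_right₀ hq1 (by omega)
    have h2 : q ^ (c - δ) ≤ A * x ^ δ * q ^ (c + 1 - 2 * δ) := by
      refine le_of_mul_le_mul_right (h1.trans ?_) hq0
      calc q ^ δ * q ^ (c + 1 - 2 * δ) ≤ (A * q * x ^ δ) * q ^ (c + 1 - 2 * δ) := by gcongr
        _ = _ := by ring
    rw [div_le_iff₀ (by positivity)]
    calc (2 : ℝ) ^ k = 2 ^ k / q ^ (c - δ) * q ^ (c - δ) := by field_simp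
      _ ≤ 2 ^ k / q ^ (c - δ) * (A * x ^ δ * q ^ (c + 1 - 2 * δ)) := by gcongr
      _ = _ := by ring
  have hB1 : (1 : ℝ) ≤ numBlocks k ℓ := by exact_mod_cast one_le_numBlocks h0 hk
  set X : ℝ := (2 ^ δ + N₀ * A) * (x ^ δ / q ^ (c - δ)) * 2 ^ k with hX
  have hX0 : 0 ≤ X := by positivity
  have hfloor := Nat.floor_le hX0
  have h := ncard_failSet_le hf hd h0 hk E S hS ⌊X⌋₊ fun m hm ι hι hιm v => by
    refine Nat.le_floor ((sum_ncard_wrongSet_le hf hd h0 E hE hι hιm v).trans ?_)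
    have h1 : (numBlocks k ℓ : ℝ) ^ m * (2 ^ k / q ^ (c - m)) ≤
        (2 ^ δ * x ^ δ) * (2 ^ k / q ^ (c - δ)) := by
      have h2 : (numBlocks k ℓ : ℝ) ^ m ≤ 2 ^ δ * x ^ δ := by
        rw [← mul_pow]
        exact (pow_le_pow_right₀ hB1 hm).trans
          (pow_le_pow_left₀ (by linarith) (numBlocks_le h0 hk) δ)
      gcongr
    have h2 : (m + 1 : ℝ) ^ ((m + 1) * (2 * c + 1)) * (2 ^ k / q ^ (c + 1 - 2 * m)) ≤
        N₀ * (2 ^ k / q ^ (c + 1 - 2 * δ)) := by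
      have h3 : (m + 1 : ℝ) ^ ((m + 1) * (2 * c + 1)) ≤ N₀ := by
        have hmδ : (m : ℝ) ≤ δ := by exact_mod_cast hm
        refine (pow_le_pow_left₀ (by positivity)
          (show (m + 1 : ℝ) ≤ δ + 1 by linarith) _).trans
          (pow_le_pow_right₀ hδ1 ?_)
        gcongr
      gcongr
    refine (add_le_add h1 h2).trans ?_
    calc _ ≤ (2 ^ δ * x ^ δ) * (2 ^ k / q ^ (c - δ)) +
        N₀ * (A * (x ^ δ * (2 ^ k / q ^ (c - δ)))) := by gcongr
      _ = X := by rw [hX]; ring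
  have h' : ((failSet δ k ℓ c f E S).ncard : ℝ) ≤ (δ + 1) * ((δ + 1) * (2 ^ δ * (⌊X⌋₊ : ℝ))) := by
    exact_mod_cast h
  refine h'.trans ?_
  calc (δ + 1 : ℝ) * ((δ + 1) * (2 ^ δ * (⌊X⌋₊ : ℝ))) ≤
      (δ + 1 : ℝ) * ((δ + 1) * (2 ^ δ * X)) := by gcongr
    _ = _ := by rw [hX]; ring

theorem encodeT_cost_le (hf : Irreducible f) (hd : f.natDegree = ℓ) (h0 : 1 ≤ ℓ) (hk : ℓ ≤ k)
    (E : Matrix (Fin (numBlocks k ℓ)) (Fin c) (AdjoinRoot f)) (u : Fin k → Bool) :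
    ((encodeT δ k ℓ (lowBits f ℓ) (matrixBits f ℓ E) (List.ofFn u)).cost : ℝ) ≤
      ((100 + 2 * δ) * (c + 1)) * ((k : ℝ) * ℓ) := by
  exact_mod_cast (encodeT_spec hf hd h0 hk δ c E u).2

/-- The main term is the number of cases times the cost of one case, `(k / ℓ) ^ δ * (k * ℓ)`; the
integer exponent covers `δ = 0`. Everything else, including the enumeration of the cases, is at most
a constant times this. -/
theorem decodeT_cost_le (hf : Irreducible f) (hd : f.natDegree = ℓ) (h0 : 1 ≤ ℓ) (hk : ℓ ≤ k)
    (hc : δ < c) (E : Matrix (Fin (numBlocks k ℓ)) (Fin c) (AdjoinRoot f))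
    (hE : IsSystematicMDS E) (y : List Bool) (hy : y.length ≤ k + c * (δ + 1) * ℓ + δ) :
    ((decodeT δ k ℓ c (lowBits f ℓ) (matrixBits f ℓ E) y).cost : ℝ) ≤
      (4 * (1 + c * (δ + 1) + δ) + 4 * c + 16 * 4 ^ (δ + 1) +
        2 ^ δ * (2 * (100 * (c + 1) + 300 * (δ + 1) ^ 3) + 9) + 16) *
        ((k : ℝ) ^ (δ + 1) / (ℓ : ℝ) ^ ((δ : ℤ) - 1)) := by
  have hcost := (decodeT_val_cost hf hd h0 hk hc E hE y).2
  have hℓ : (1 : ℝ) ≤ ℓ := by exact_mod_cast h0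
  have hℓ0 : (0 : ℝ) < ℓ := by linarith
  have hkℓ : (ℓ : ℝ) ≤ k := by exact_mod_cast hk
  have hT : (k : ℝ) ^ (δ + 1) / (ℓ : ℝ) ^ ((δ : ℤ) - 1) = ((k : ℝ) / ℓ) ^ δ * (k * ℓ) := by
    rw [zpow_sub₀ hℓ0.ne', zpow_natCast, zpow_one, div_pow]
    field_simp
    ring
  rw [hT]
  have hx1 : 1 ≤ (k : ℝ) / ℓ := by rw [one_le_div hℓ0]; exact hkℓ
  have hB := numBlocks_le h0 hk
  have hB1 : (1 : ℝ) ≤ numBlocks k ℓ := by exact_mod_cast one_le_numBlocks h0 hk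
  have hBℓ : (numBlocks k ℓ : ℝ) * ℓ ≤ 2 * k := by exact_mod_cast numBlocks_mul_le h0 hk
  have hcost' : ((decodeT δ k ℓ c (lowBits f ℓ) (matrixBits f ℓ E) y).cost : ℝ) ≤
      4 * y.length + c * (ℓ + 2) + c + 16 * (numBlocks k ℓ + 1) ^ (δ + 1) +
      numBlocks k ℓ ^ δ * ((100 * (c + 1) + 300 * (δ + 1) ^ 3) * (numBlocks k ℓ * ℓ ^ 2) +
        numBlocks k ℓ * (ℓ + 2) + 3) + numBlocks k ℓ * (ℓ + 2) + k + 9 := by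
    exact_mod_cast hcost
  have hy' : (y.length : ℝ) ≤ k + c * (δ + 1) * ℓ + δ := by exact_mod_cast hy
  set B : ℝ := (numBlocks k ℓ : ℝ)
  set x : ℝ := (k : ℝ) / ℓ with hx
  set P : ℝ := x ^ δ with hP
  have hP1 : 1 ≤ P := one_le_pow₀ hx1
  set K : ℝ := (k : ℝ)
  set l : ℝ := (ℓ : ℝ)
  have hK1 : 1 ≤ K := by linarith
  have hKl : K ≤ K * l := le_mul_of_one_le_right (by linarith) hℓ
  have hlK : l ≤ K * l := le_mul_of_one_le_left (by linarith) hK1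
  have hQ1 : 1 ≤ K * l := hK1.trans hKl
  have hQP : K * l ≤ P * (K * l) := le_mul_of_one_le_left (by linarith) hP1
  have hBδ : B ^ δ ≤ 2 ^ δ * P := by
    rw [hP, ← mul_pow]; exact pow_le_pow_left₀ (by linarith) hB δ
  have e1 : (B + 1) ^ (δ + 1) ≤ 4 ^ (δ + 1) * (P * (K * l)) := by
    have h1 : (B + 1) ^ (δ + 1) ≤ (4 * x) ^ (δ + 1) :=
      pow_le_pow_left₀ (by linarith) (by linarith) _
    have h2 : x ≤ K * l := (div_le_self (by linarith) hℓ).trans hKl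
    rw [mul_pow, pow_succ x] at h1
    refine h1.trans ?_
    gcongr
  have e2 : B * l ^ 2 ≤ 2 * (K * l) := by nlinarith
  have e3 : B * (l + 2) ≤ 6 * (K * l) := by nlinarith
  have hD : (0 : ℝ) ≤ 100 * (c + 1) + 300 * (δ + 1) ^ 3 := by positivity
  set D : ℝ := 100 * (c + 1) + 300 * (δ + 1) ^ 3
  have e4 : B ^ δ * (D * (B * l ^ 2) + B * (l + 2) + 3) ≤
      (2 ^ δ * P) * ((2 * D + 9) * (K * l)) := by
    have h1 : D * (B * l ^ 2) ≤ D * (2 * (K * l)) := mul_le_mul_of_nonneg_left e2 hD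
    have h2 : D * (B * l ^ 2) + B * (l + 2) + 3 ≤ (2 * D + 9) * (K * l) := by linarith
    have h3 : 0 ≤ (2 * D + 9) * (K * l) := by positivity
    calc _ ≤ B ^ δ * ((2 * D + 9) * (K * l)) := by gcongr
      _ ≤ _ := by gcongr
  have hQ : 1 ≤ P * (K * l) := hQ1.trans hQP
  have hc0 : (0 : ℝ) ≤ c := Nat.cast_nonneg c
  have hδ0 : (0 : ℝ) ≤ δ := Nat.cast_nonneg δ
  have e5 : 4 * (y.length : ℝ) ≤ 4 * (1 + c * (δ + 1) + δ) * (P * (K * l)) := by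
    have h1 : c * (δ + 1) * l ≤ c * (δ + 1) * (P * (K * l)) := by
      gcongr; linarith
    have h2 : (δ : ℝ) * 1 ≤ δ * (P * (K * l)) := by gcongr
    linarith
  have e6 : c * (l + 2) + c ≤ 4 * c * (P * (K * l)) := by
    have : (c : ℝ) * (l + 3) ≤ c * (4 * (P * (K * l))) := by gcongr; linarith
    linarith
  calc _ ≤ _ := hcost'
    _ ≤ 4 * (1 + c * (δ + 1) + δ) * (P * (K * l)) + 4 * c * (P * (K * l)) +
        16 * (4 ^ (δ + 1) * (P * (K * l))) + (2 ^ δ * P) * ((2 * D + 9) * (K * l)) +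
        6 * (P * (K * l)) + P * (K * l) + 9 * (P * (K * l)) := by linarith
    _ = _ := by ring

end

end

end GC

/-! ### Cauchy codes and their scalings -/

namespace GC

noncomputable section

section cauchy

variable {F : Type*} [Field F] {B c : ℕ}

/-- The parity part of a systematic generalized Reed-Solomon code. -/
def cauchyMatrix (x : Fin B → F) (y : Fin c → F) : Matrix (Fin B) (Fin c) F :=
  Matrix.of fun j r => (x j - y r)⁻¹

/-- Clearing denominators turns the parity at `y r` into the value of a polynomial of degree less
than the weight of `U`. If the codeword had weight at most `c`, this polynomial would have more
zeros than its degree allows, but at `x j₀` it does not vanish. -/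
theorem isSystematicMDS_cauchyMatrix {x : Fin B → F} {y : Fin c → F}
    (hx : Function.Injective x) (hy : Function.Injective y) (hxy : ∀ j r, x j ≠ y r) :
    IsSystematicMDS (cauchyMatrix x y) := by
  classical
  intro U hU
  by_contra hlt
  push Not at hlt
  set T : Finset (Fin B) := Finset.univ.filter fun j => U j ≠ 0 with hT
  set R : Finset (Fin c) := Finset.univ.filter fun r => Matrix.vecMul U (cauchyMatrix x y) r = 0
    with hR
  have hTc : hammingNorm U = T.card := by rw [hT]; unfold hammingNorm; congr
  have hRc : R.card + hammingNorm (Matrix.vecMul U (cauchyMatrix x y)) = c := by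
    have h1 := Finset.card_filter_add_card_filter_not (s := (Finset.univ : Finset (Fin c)))
      (fun r => Matrix.vecMul U (cauchyMatrix x y) r = 0)
    rw [Finset.card_univ, Fintype.card_fin] at h1
    refine Eq.trans ?_ h1
    rw [hR]
    unfold hammingNorm
    congr
  obtain ⟨j₀, hj₀⟩ := Function.ne_iff.1 hU
  have hj₀T : j₀ ∈ T := by simpa [hT] using hj₀
  let p : F[X] := ∑ j ∈ T, Polynomial.C (U j) *
    ∏ i ∈ T.erase j, (Polynomial.C (x i) - Polynomial.X)
  have hdeg : p.degree < (R.image y).card := by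
    rw [Finset.card_image_of_injective _ hy]
    refine lt_of_lt_of_le (b := (T.card : WithBot ℕ)) ?_ (by
      have : T.card ≤ R.card := by omega
      exact_mod_cast this)
    refine (Polynomial.degree_sum_le _ _).trans_lt ?_
    rw [Finset.sup_lt_iff (WithBot.bot_lt_coe _)]
    intro j hj
    refine (Polynomial.degree_mul_le _ _).trans_lt ?_
    refine (add_le_add Polynomial.degree_C_le (Polynomial.degree_prod_le _ _)).trans_lt ?_
    refine (add_le_add le_rfl (Finset.sum_le_card_nsmul _ _ 1 fun i _ => ?_)).trans_lt ?_
    · refine (Polynomial.degree_sub_le _ _).trans (max_le ?_ Polynomial.degree_X_le)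
      exact Polynomial.degree_C_le.trans (by norm_num)
    · rw [Finset.card_erase_of_mem hj, zero_add, nsmul_one]
      have : 0 < T.card := Finset.card_pos.2 ⟨j, hj⟩
      have h2 : T.card - 1 < T.card := by omega
      exact_mod_cast h2
  have heval : ∀ z ∈ R.image y, p.eval z = 0 := by
    intro z hz
    obtain ⟨r, hr, rfl⟩ := Finset.mem_image.1 hz
    have h1 : Matrix.vecMul U (cauchyMatrix x y) r = 0 := (Finset.mem_filter.1 hr).2
    have h2 : p.eval (y r) = (∏ i ∈ T, (x i - y r)) * Matrix.vecMul U (cauchyMatrix x y) r := by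
      simp only [p, Matrix.vecMul, dotProduct, cauchyMatrix, Matrix.of_apply]
      rw [Polynomial.eval_finsetSum, Finset.mul_sum,
        ← Finset.sum_subset (Finset.subset_univ T)]
      · refine Finset.sum_congr rfl fun j hj => ?_
        rw [← Finset.mul_prod_erase _ _ hj, Polynomial.eval_mul, Polynomial.eval_prod]
        have := sub_ne_zero.2 (hxy j r)
        simp only [Polynomial.eval_C, Polynomial.eval_sub, Polynomial.eval_X]
        field_simp
      · intro j _ hj
        have : U j = 0 := by simpa [hT] using hj
        simp [this]
    rw [h2, h1, mul_zero]
  have hp : p = 0 := Polynomial.eq_zero_of_degree_lt_of_eval_finset_eq_zero _ hdeg heval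
  have h1 : p.eval (x j₀) = U j₀ * ∏ i ∈ T.erase j₀, (x i - x j₀) := by
    simp only [p]
    rw [Polynomial.eval_finsetSum, Finset.sum_eq_single j₀]
    · simp [Polynomial.eval_prod]
    · intro j hj hne
      rw [Polynomial.eval_mul, Polynomial.eval_prod,
        Finset.prod_eq_zero (Finset.mem_erase.2 ⟨hne.symm, hj₀T⟩), mul_zero]
      simp
    · exact fun h => absurd hj₀T h
  rw [hp, Polynomial.eval_zero] at h1
  rcases mul_eq_zero.1 h1.symm with h2 | h2
  · exact hj₀ h2
  · obtain ⟨i, hi, h3⟩ := Finset.prod_eq_zero_iff.1 h2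
    exact (Finset.mem_erase.1 hi).1 (hx (sub_eq_zero.1 h3))

theorem exists_isSystematicMDS [Fintype F] (h : B + c ≤ Fintype.card F) :
    ∃ E : Matrix (Fin B) (Fin c) F, IsSystematicMDS E := by
  obtain ⟨z⟩ : Nonempty (Fin (B + c) ↪ F) :=
    Function.Embedding.nonempty_of_card_le (by rw [Fintype.card_fin]; exact h)
  refine ⟨cauchyMatrix (fun j => z (Fin.castAdd c j)) (fun r => z (Fin.natAdd B r)),
    isSystematicMDS_cauchyMatrix (fun a b hab => ?_) (fun a b hab => ?_) fun j r hjr => ?_⟩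
  · exact Fin.castAdd_injective _ _ (z.injective hab)
  · exact Fin.natAdd_injective _ _ (z.injective hab)
  · have := congrArg Fin.val (z.injective hjr)
    simp at this
    have := j.2
    omega

/-- The parities of the code whose message symbols are multiplied by `w`. -/
def scaleRows (w : Fin B → Fˣ) (E : Matrix (Fin B) (Fin c) F) : Matrix (Fin B) (Fin c) F :=
  Matrix.of fun j r => (w j : F) * E j r

theorem vecMul_scaleRows (w : Fin B → Fˣ) (E : Matrix (Fin B) (Fin c) F) (U : Fin B → F) :
    Matrix.vecMul U (scaleRows w E) = Matrix.vecMul (fun j => U j * w j) E := by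
  funext r
  simp only [Matrix.vecMul, dotProduct, scaleRows, Matrix.of_apply, mul_assoc]

theorem IsSystematicMDS.scaleRows {E : Matrix (Fin B) (Fin c) F} (hE : IsSystematicMDS E)
    (w : Fin B → Fˣ) : IsSystematicMDS (scaleRows w E) := by
  intro U hU
  have h1 := hE (fun j => U j * w j) fun h => hU (funext fun j => by
    simpa using congrFun h j)
  rw [vecMul_scaleRows]
  convert h1 using 2
  unfold hammingNorm
  congr 1
  ext j
  simp

/-- If any scaling works, `D` has at least `c` nonzero symbols. Fix `c` of them: the scalars there
are determined by the others, since two solutions agreeing elsewhere differ by a vector on `c`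
blocks with zero parities. So the `c` scalars can be varied freely to inject `(q - 1) ^ c` copies of
the solution set into all scalings. -/
theorem card_scale_mul_le [Fintype F] [DecidableEq F] {E : Matrix (Fin B) (Fin c) F}
    (hE : IsSystematicMDS E) (D : Fin B → F) (hD : D ≠ 0) :
    (Finset.univ.filter fun w : Fin B → Fˣ => Matrix.vecMul D (scaleRows w E) = 0).card *
      (Fintype.card F - 1) ^ c ≤ (Fintype.card F - 1) ^ B := by
  classical
  set G := Finset.univ.filter fun w : Fin B → Fˣ => Matrix.vecMul D (scaleRows w E) = 0 with hG
  set T : Finset (Fin B) := Finset.univ.filter fun j => D j ≠ 0 with hT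
  rcases G.eq_empty_or_nonempty with he | ⟨w₀, hw₀⟩
  · simp [he]
  have hTc : c ≤ T.card := by
    by_contra hlt
    push Not at hlt
    have h1 := (hE.scaleRows w₀).eq_zero D T Finset.univ (fun j hj => by simpa [hT] using hj)
      (fun r _ => congrFun (Finset.mem_filter.1 hw₀).2 r) (by simpa using hlt.le)
    exact hD h1
  obtain ⟨Z, hZT, hZc⟩ := Finset.exists_subset_card_eq hTc
  let Φ : G × (Z → Fˣ) → Fin B → Fˣ := fun a j => if h : j ∈ Z then a.2 ⟨j, h⟩ else a.1.1 j
  have hΦ : Function.Injective Φ := by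
    rintro ⟨⟨w₁, h₁⟩, z₁⟩ ⟨⟨w₂, h₂⟩, z₂⟩ heq
    have hout : ∀ j ∉ Z, w₁ j = w₂ j := fun j hj => by
      simpa [Φ, hj] using congrFun heq j
    have hz : z₁ = z₂ := by
      funext ⟨j, hj⟩
      simpa [Φ, hj] using congrFun heq j
    have e1 := (Finset.mem_filter.1 h₁).2
    have e2 := (Finset.mem_filter.1 h₂).2
    rw [vecMul_scaleRows] at e1 e2
    have h3 := hE.eq_zero ((fun j => D j * (w₁ j : F)) - fun j => D j * (w₂ j : F)) Z Finset.univ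
      (fun j hj => by simp [hout j hj])
      (fun r _ => by rw [Matrix.sub_vecMul, e1, e2]; simp) (by simp [hZc])
    have hw : w₁ = w₂ := by
      funext j
      by_cases hj : j ∈ Z
      · have h4 := congrFun h3 j
        have h5 : D j ≠ 0 := (Finset.mem_filter.1 (hZT hj)).2
        simp only [Pi.sub_apply, Pi.zero_apply, sub_eq_zero] at h4
        exact Units.ext (mul_left_cancel₀ h5 h4)
      · exact hout j hj
    subst hw hz
    rfl
  have h := Fintype.card_le_of_injective Φ hΦ
  rw [Fintype.card_prod, Fintype.card_coe, Fintype.card_fun, Fintype.card_fun, Fintype.card_coe,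
    Fintype.card_fin, Fintype.card_units, hZc] at h
  exact h

end cauchy

end

end GC

/-! ### Decodable strings counted independently of the code -/

namespace GC

noncomputable section

section strings

theorem exists_sublist_eraseIdx {α : Type*} {x s : List α} (h : x.Sublist s)
    (hlt : x.length < s.length) : ∃ i < s.length, x.Sublist (s.eraseIdx i) := by
  induction h with
  | slnil => simp at hlt
  | cons a h ih => exact ⟨0, by simp, by simpa using h⟩
  | cons_cons a h ih =>
    obtain ⟨i, hi, h'⟩ := ih (by simpa using hlt)
    exact ⟨i + 1, by simpa using hi, by simpa using h'⟩

/-- The strings obtained from `x` by `m` insertions. -/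
def insertions (x : List Bool) : ℕ → Finset (List Bool)
  | 0 => {x}
  | m + 1 => (insertions x m ×ˢ (Finset.univ ×ˢ Finset.range (x.length + m + 1))).image
      fun a => a.1.insertIdx a.2.2 a.2.1

theorem mem_insertions {x s : List Bool} {m : ℕ} (h : x.Sublist s) (hs : s.length = x.length + m) :
    s ∈ insertions x m := by
  induction m generalizing s with
  | zero => simp [insertions, h.eq_of_length (by omega)]
  | succ m ih =>
    obtain ⟨i, hi, h'⟩ := exists_sublist_eraseIdx h (by omega)
    have h1 := ih h' (by rw [List.length_eraseIdx_of_lt hi]; omega)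
    rw [insertions, Finset.mem_image]
    refine ⟨(s.eraseIdx i, s[i], i), ?_, List.insertIdx_eraseIdx_getElem hi⟩
    simp only [Finset.mem_product, Finset.mem_univ, true_and, Finset.mem_range]
    exact ⟨h1, by omega⟩

theorem card_insertions_le (x : List Bool) (m : ℕ) :
    (insertions x m).card ≤ (2 * (x.length + m)) ^ m := by
  induction m with
  | zero => simp [insertions]
  | succ m ih =>
    rw [insertions]
    refine Finset.card_image_le.trans ?_
    rw [Finset.card_product, Finset.card_product, Finset.card_range, Finset.card_univ,
      Fintype.card_bool, pow_succ]
    refine Nat.mul_le_mul (ih.trans (Nat.pow_le_pow_left (by omega) m)) (by omega)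

/-- The strings obtained from `s` by `m` deletions. -/
def deletions (s : List Bool) : ℕ → Finset (List Bool)
  | 0 => {s}
  | m + 1 => (Finset.range s.length).biUnion fun i => deletions (s.eraseIdx i) m

theorem mem_deletions {x s : List Bool} {m : ℕ} (h : x.Sublist s) (hs : s.length = x.length + m) :
    x ∈ deletions s m := by
  induction m generalizing s with
  | zero => simp [deletions, h.eq_of_length (by omega)]
  | succ m ih =>
    obtain ⟨i, hi, h'⟩ := exists_sublist_eraseIdx h (by omega)
    rw [deletions, Finset.mem_biUnion]
    exact ⟨i, Finset.mem_range.2 hi, ih h' (by rw [List.length_eraseIdx_of_lt hi]; omega)⟩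

theorem card_deletions_le (s : List Bool) (m : ℕ) : (deletions s m).card ≤ s.length ^ m := by
  induction m generalizing s with
  | zero => simp [deletions]
  | succ m ih =>
    rw [deletions]
    refine (Finset.card_biUnion_le_card_mul _ _ (s.length ^ m) fun i _ => ?_).trans ?_
    · exact (ih _).trans (Nat.pow_le_pow_left (List.length_eraseIdx_le _ _) m)
    · rw [Finset.card_range, pow_succ, mul_comm]

theorem length_of_mem_insertions {x s : List Bool} {m : ℕ} (h : s ∈ insertions x m) :
    s.length ≤ x.length + m := by
  induction m generalizing s with
  | zero => simp [insertions] at h; simp [h]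
  | succ m ih =>
    rw [insertions, Finset.mem_image] at h
    obtain ⟨⟨t, b, i⟩, ht, rfl⟩ := h
    have : t.length ≤ x.length + m := ih (Finset.mem_product.1 ht).1
    have := List.length_insertIdx_le_succ (l := t) (i := i) (x := b)
    simp only
    omega

/-- The blocks that can be taken for those of `x` after at most `δ` insertions. -/
def candidates (B ℓ δ : ℕ) (x : List Bool) : Finset (Fin B → Fin ℓ → Bool) :=
  (Finset.range (δ + 1)).biUnion fun m => (insertions x m).biUnion fun s =>
    (deletions s m).image fun z j t => z.getD ((j : ℕ) * ℓ + t) false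

theorem card_candidates_le (B ℓ δ : ℕ) (x : List Bool) (hx : 1 ≤ x.length) :
    (candidates B ℓ δ x).card ≤ (δ + 1) * ((2 * (x.length + δ)) ^ δ * (x.length + δ) ^ δ) := by
  refine (Finset.card_biUnion_le_card_mul _ _ ((2 * (x.length + δ)) ^ δ * (x.length + δ) ^ δ)
    fun m hm => ?_).trans (by rw [Finset.card_range])
  have hm' : m ≤ δ := by have := Finset.mem_range.1 hm; omega
  refine (Finset.card_biUnion_le_card_mul _ _ ((x.length + δ) ^ δ) fun s hs => ?_).trans
    (Nat.mul_le_mul_right _ ?_)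
  · refine Finset.card_image_le.trans ((card_deletions_le s m).trans ?_)
    refine (Nat.pow_le_pow_left (length_of_mem_insertions hs) m).trans ?_
    refine (Nat.pow_le_pow_left (by omega) m).trans (Nat.pow_le_pow_right (by omega) hm')
  · refine (card_insertions_le x m).trans ?_
    refine (Nat.pow_le_pow_left (by omega) m).trans (Nat.pow_le_pow_right (by omega) hm')

/-- `x` and the concatenated blocks of `Y` have the same length and a common supersequence `s`, so
equally many insertions and deletions lead from one to the other. -/
theorem mem_candidates {B ℓ δ : ℕ} {x s : List Bool} {Y : Fin B → Fin ℓ → Bool}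
    (hx : x.length = B * ℓ) (hxs : x.Sublist s) (hs : s.length ≤ x.length + δ)
    (hY : (List.ofFn fun j => List.ofFn (Y j)).flatten.Sublist s) : Y ∈ candidates B ℓ δ x := by
  have hl : (List.ofFn fun j => List.ofFn (Y j)).flatten.length = B * ℓ := by
    rw [List.length_flatten, List.map_ofFn, List.sum_ofFn]; simp
  have h1 := hxs.length_le
  obtain ⟨m, hm⟩ : ∃ m, s.length = x.length + m := ⟨s.length - x.length, by omega⟩
  rw [candidates, Finset.mem_biUnion]
  refine ⟨m, Finset.mem_range.2 (by omega), Finset.mem_biUnion.2 ⟨s, mem_insertions hxs hm,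
    Finset.mem_image.2 ⟨_, mem_deletions hY (by omega), ?_⟩⟩⟩
  funext j t
  have h2 := flatten_ofFn_getD (fun j => List.ofFn (Y j)) j t (by simp)
  have hcard : (Finset.univ.filter fun a : Fin B => a < j).card = j := by
    have := Fin.card_Iio j
    rwa [show Finset.Iio j = Finset.univ.filter fun i => i < j by ext; simp] at this
  simpa [hcard] using h2

theorem flatten_chunkT (ns : List ℕ) (s : List Bool) (o : ℕ) :
    (chunkT ns (s.drop o)).val.flatten = piece s o ns.sum := by
  rw [chunkT_val_aux]
  induction ns generalizing o with
  | nil => simp [piece]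
  | cons n ns ih =>
    rw [List.sum_cons, piece_add, ← ih]
    simp [List.ofFn_succ, add_assoc]

theorem flatten_chunk {B : ℕ} (ℓ : ℕ) (d : Fin B → ℕ) (s : List Bool) :
    (List.ofFn (chunk ℓ s d)).flatten = piece s 0 (B * ℓ + ∑ j, d j) := by
  have h := flatten_chunkT (List.ofFn fun j => ℓ + d j) s 0
  rw [List.drop_zero, chunkT_ofFn] at h
  rw [h, List.sum_ofFn, Finset.sum_add_distrib]
  simp

theorem flatten_ofFn_sublist {α : Type*} {B : ℕ} {L C : Fin B → List α}
    (h : ∀ j, (L j).Sublist (C j)) : (List.ofFn L).flatten.Sublist (List.ofFn C).flatten := by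
  induction B with
  | zero => simp
  | succ B ih =>
    rw [List.ofFn_succ, List.ofFn_succ, List.flatten_cons, List.flatten_cons]
    exact (h 0).append (ih fun j => h j.succ)

end strings

section field

variable {f : (ZMod 2)[X]} {k ℓ c δ : ℕ}

/-- In every possible case each symbol is a subsequence of its chunk, and the chunks together make
up the zero-padded `s`. Neither `p` nor `E` enters the resulting set of candidates. -/
theorem mem_candidates_of_mem_decodedStrings (h0 : 1 ≤ ℓ)
    {E : Matrix (Fin (numBlocks k ℓ)) (Fin c) (AdjoinRoot f)} {p : Fin c → AdjoinRoot f}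
    {u : Fin k → Bool} {s : List Bool} (hs : s.length ≤ k + δ) (hus : (List.ofFn u).Sublist s)
    {Y : Fin (numBlocks k ℓ) → Fin ℓ → Bool} (hY : Y ∈ decodedStrings k ℓ c f E p s) :
    Y ∈ candidates (numBlocks k ℓ) ℓ δ
      (List.ofFn u ++ List.replicate (numBlocks k ℓ * ℓ - k) false) := by
  obtain ⟨d, hd, h1, -, h2⟩ := hY
  have hkB := le_numBlocks_mul (k := k) h0
  have hks := hus.length_le
  rw [List.length_ofFn] at hks
  have hsub : (List.ofFn fun j => List.ofFn (Y j)).flatten.Sublist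
      (s ++ List.replicate (numBlocks k ℓ * ℓ - k) false) := by
    have h3 := flatten_ofFn_sublist (L := fun j => List.ofFn (Y j)) (C := chunk ℓ s d) fun j => by
      by_cases hj : d j = 0
      · rw [h1 j hj]
      · exact h2 j hj
    rw [flatten_chunk, piece_zero _ _ (by omega)] at h3
    rwa [show numBlocks k ℓ * ℓ + ∑ j, d j - s.length = numBlocks k ℓ * ℓ - k by omega] at h3
  exact mem_candidates (by simp; omega) (hus.append (List.Sublist.refl _)) (by simp; omega) hsub

end field

end

end GC

/-! ### A suitable code by averaging -/

namespace GC

noncomputable section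

section field

variable {f : (ZMod 2)[X]} {k ℓ c δ : ℕ}

/-- Double counting of bad pairs of a scaling and a message. For a fixed message, a scaling is bad
only if it annihilates the difference to one of the wrong candidates, whose number does not depend
on the scaling. Some scaling is then at most as bad as the average, for all sets of positions
simultaneously. -/
theorem exists_ncard_iUnion_failSet_le (hf : Irreducible f) (hd : f.natDegree = ℓ) (h0 : 1 ≤ ℓ)
    (hk : ℓ ≤ k) (hq : numBlocks k ℓ + c < 2 ^ ℓ) (δ : ℕ) :
    ∃ E : Matrix (Fin (numBlocks k ℓ)) (Fin c) (AdjoinRoot f), IsSystematicMDS E ∧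
      {u | ∃ S : Finset ℕ, S.card ≤ δ ∧ u ∈ failSet δ k ℓ c f E S}.ncard * (2 ^ ℓ - 1) ^ c ≤
        2 ^ k * ((δ + 1) * ((2 * (numBlocks k ℓ * ℓ + δ)) ^ δ * (numBlocks k ℓ * ℓ + δ) ^ δ)) := by
  classical
  have : Fact (Irreducible f) := ⟨hf⟩
  let _ : Fintype (AdjoinRoot f) := Fintype.ofBijective _ (symbol_bijective hf hd)
  have hF : Fintype.card (AdjoinRoot f) = 2 ^ ℓ := by
    rw [← Fintype.card_of_bijective (symbol_bijective hf hd)]; simp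
  obtain ⟨E, hE⟩ := exists_isSystematicMDS (F := AdjoinRoot f) (B := numBlocks k ℓ) (c := c)
    (by rw [hF]; exact hq.le)
  set N := (δ + 1) * ((2 * (numBlocks k ℓ * ℓ + δ)) ^ δ * (numBlocks k ℓ * ℓ + δ) ^ δ) with hN
  set Q := 2 ^ ℓ - 1 with hQ
  have hkB := le_numBlocks_mul (k := k) h0
  have hQ1 : 1 ≤ Q := by
    have : 2 ^ 1 ≤ 2 ^ ℓ := Nat.pow_le_pow_right (by norm_num) h0
    omega
  let bad : (Fin (numBlocks k ℓ) → (AdjoinRoot f)ˣ) → (Fin k → Bool) → Prop := fun w u =>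
    ∃ S : Finset ℕ, S.card ≤ δ ∧ u ∈ failSet δ k ℓ c f (scaleRows w E) S
  have hu : ∀ u : Fin k → Bool,
      (Finset.univ.filter fun w => bad w u).card * Q ^ c ≤ N * Q ^ numBlocks k ℓ := by
    intro u
    set x := List.ofFn u ++ List.replicate (numBlocks k ℓ * ℓ - k) false with hx
    have hxl : x.length = numBlocks k ℓ * ℓ := by simp [hx]; omega
    let D : (Fin (numBlocks k ℓ) → Fin ℓ → Bool) → Fin (numBlocks k ℓ) → AdjoinRoot f :=
      fun Y j => symbol f (Y j) + symbol f (block ℓ u (j : ℕ))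
    have hsub : (Finset.univ.filter fun w => bad w u) ⊆
        ((candidates (numBlocks k ℓ) ℓ δ x).erase fun j => block ℓ u (j : ℕ)).biUnion fun Y =>
          Finset.univ.filter fun w : Fin (numBlocks k ℓ) → (AdjoinRoot f)ˣ =>
            Matrix.vecMul (D Y) (scaleRows w E) = 0 := by
      intro w hw
      obtain ⟨S, hS, y, hy, hfail⟩ := (Finset.mem_filter.1 hw).2
      obtain ⟨a, s, h1, h2, h3, h4, Y, hY, hYu⟩ :=
        exists_wrong_of_decode_eq_none hf hd h0 hk (scaleRows w E) u S hS y hy hfail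
      refine Finset.mem_biUnion.2 ⟨Y, Finset.mem_erase.2 ⟨hYu,
        mem_candidates_of_mem_decodedStrings h0 h2 (sublist_of_keptPositions h3 h4) hY⟩,
        Finset.mem_filter.2 ⟨Finset.mem_univ _, ?_⟩⟩
      obtain ⟨d, -, hpos⟩ := hY
      exact vecMul_symbol_add (scaleRows w E) hpos
    have h1 := (Finset.card_le_card hsub).trans Finset.card_biUnion_le
    refine (Nat.mul_le_mul_right _ h1).trans ?_
    rw [Finset.sum_mul]
    refine (Finset.sum_le_card_nsmul _ _ (Q ^ numBlocks k ℓ) fun Y hY => ?_).trans ?_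
    · have h2 := card_scale_mul_le hE (D Y) fun h => (Finset.mem_erase.1 hY).1 <| by
        funext j
        apply (symbol_bijective hf hd).1
        have h3 := congrFun h j
        simp only [D, Pi.zero_apply] at h3
        have h4 := add_self_adjoinRoot (symbol f (block ℓ u (j : ℕ)))
        linear_combination h3 - h4
      rw [hF] at h2
      exact h2
    · rw [smul_eq_mul]
      refine Nat.mul_le_mul_right _ ((Finset.card_erase_le).trans ?_)
      have h2 := card_candidates_le (numBlocks k ℓ) ℓ δ x (by omega)
      rwa [hxl] at h2
  have hsum : ∑ w, (Finset.univ.filter fun u => bad w u).card * Q ^ c ≤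
      ∑ _w : Fin (numBlocks k ℓ) → (AdjoinRoot f)ˣ, 2 ^ k * N := by
    rw [Finset.sum_const, Finset.card_univ, Fintype.card_fun, Fintype.card_units, hF,
      Fintype.card_fin, ← Finset.sum_mul]
    have hswap : ∑ w, (Finset.univ.filter fun u => bad w u).card =
        ∑ u, (Finset.univ.filter fun w => bad w u).card := by
      simp only [Finset.card_filter]
      exact Finset.sum_comm
    rw [hswap, Finset.sum_mul]
    refine (Finset.sum_le_card_nsmul _ _ _ fun u _ => hu u).trans ?_
    rw [Finset.card_univ, Fintype.card_fun, Fintype.card_bool, Fintype.card_fin, smul_eq_mul,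
      smul_eq_mul]
    exact le_of_eq (by ring)
  obtain ⟨w, -, hw⟩ := Finset.exists_le_of_sum_le (Finset.univ_nonempty) hsum
  refine ⟨scaleRows w E, hE.scaleRows w, ?_⟩
  have : {u | ∃ S : Finset ℕ, S.card ≤ δ ∧ u ∈ failSet δ k ℓ c f (scaleRows w E) S}.ncard =
      (Finset.univ.filter fun u => bad w u).card := by
    rw [← Set.ncard_coe_finset]
    congr 1
    ext u
    simp [bad]
  rw [this]
  exact hw

/-- Take `n`-th powers in `ℓ ≤ n * 2 ^ (ℓ / n)`. This turns the factor `ℓ ^ (2 * δ)` in the number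
of candidates into a constant times `q`. -/
theorem pow_le_pow_self_mul_two_pow (n ℓ : ℕ) : ℓ ^ n ≤ n ^ n * 2 ^ ℓ := by
  rcases Nat.eq_zero_or_pos n with rfl | hn
  · simpa using Nat.one_le_two_pow
  have h1 : ℓ ≤ n * 2 ^ (ℓ / n) := by
    have h2 : ℓ / n < 2 ^ (ℓ / n) := Nat.lt_two_pow_self
    have h3 := Nat.lt_mul_div_succ ℓ hn
    exact h3.le.trans (Nat.mul_le_mul_left n h2)
  calc ℓ ^ n ≤ (n * 2 ^ (ℓ / n)) ^ n := Nat.pow_le_pow_left h1 n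
    _ = n ^ n * 2 ^ (ℓ / n * n) := by rw [mul_pow, ← pow_mul]
    _ ≤ n ^ n * 2 ^ ℓ :=
      Nat.mul_le_mul_left _ (Nat.pow_le_pow_right (by norm_num) (Nat.div_mul_le_self _ _))

/-- Averaging gives the fraction `O(k ^ (2 * δ) / q ^ c)`; the hypothesis `hA` says that the blocks
are so long that this is within the desired bound. -/
theorem exists_ncard_failSet_le (hf : Irreducible f) (hd : f.natDegree = ℓ) (h0 : 1 ≤ ℓ)
    (hk : ℓ ≤ k) (hc : δ < c) (hq : numBlocks k ℓ + c < 2 ^ ℓ)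
    (hA : (2 : ℝ) ^ ℓ * ((k : ℝ) / ℓ) ^ δ ≤ (2 : ℝ) ^ (ℓ * δ)) :
    ∃ E : Matrix (Fin (numBlocks k ℓ)) (Fin c) (AdjoinRoot f), IsSystematicMDS E ∧
      ∀ S : Finset ℕ, S.card ≤ δ → ((failSet δ k ℓ c f E S).ncard : ℝ) ≤
        2 ^ c * (δ + 1) * (2 * (2 + δ)) ^ (2 * δ) * (2 * δ) ^ (2 * δ) *
          (((k : ℝ) / ℓ) ^ δ / 2 ^ (ℓ * (c - δ))) * 2 ^ k := by
  obtain ⟨E, hE, h⟩ := exists_ncard_iUnion_failSet_le hf hd h0 hk hq δ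
  refine ⟨E, hE, fun S hS => ?_⟩
  have h1 : (failSet δ k ℓ c f E S).ncard * (2 ^ ℓ - 1) ^ c ≤
      2 ^ k * ((δ + 1) * ((2 * (numBlocks k ℓ * ℓ + δ)) ^ δ * (numBlocks k ℓ * ℓ + δ) ^ δ)) :=
    (Nat.mul_le_mul_right _ (Set.ncard_le_ncard (show failSet δ k ℓ c f E S ⊆
      {u | ∃ S : Finset ℕ, S.card ≤ δ ∧ u ∈ failSet δ k ℓ c f E S} from
        fun u hu => ⟨S, hS, hu⟩))).trans h
  have h2 : (2 ^ ℓ) ^ c ≤ 2 ^ c * (2 ^ ℓ - 1) ^ c := by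
    rw [← mul_pow]
    refine Nat.pow_le_pow_left ?_ c
    have : 2 ^ 1 ≤ 2 ^ ℓ := Nat.pow_le_pow_right (by norm_num) h0
    omega
  have h3 : (2 * (numBlocks k ℓ * ℓ + δ)) ^ δ * (numBlocks k ℓ * ℓ + δ) ^ δ ≤
      (2 * (2 + δ)) ^ (2 * δ) * k ^ (2 * δ) := by
    have h4 : numBlocks k ℓ * ℓ + δ ≤ (2 + δ) * k := by
      have := numBlocks_mul_le h0 hk
      have : δ * 1 ≤ δ * k := Nat.mul_le_mul_left δ (h0.trans hk)
      linarith
    calc _ ≤ (2 * (2 + δ) * k) ^ δ * (2 * (2 + δ) * k) ^ δ := by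
          refine Nat.mul_le_mul (Nat.pow_le_pow_left ?_ δ) (Nat.pow_le_pow_left ?_ δ) <;> nlinarith
      _ = _ := by rw [← pow_add, ← two_mul, mul_pow]
  have h5 : (failSet δ k ℓ c f E S).ncard * (2 ^ ℓ) ^ c ≤
      2 ^ c * (2 ^ k * ((δ + 1) * ((2 * (2 + δ)) ^ (2 * δ) * k ^ (2 * δ)))) := by
    calc _ ≤ (failSet δ k ℓ c f E S).ncard * (2 ^ c * (2 ^ ℓ - 1) ^ c) := Nat.mul_le_mul_left _ h2
      _ = 2 ^ c * ((failSet δ k ℓ c f E S).ncard * (2 ^ ℓ - 1) ^ c) := by ring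
      _ ≤ _ := by
        refine Nat.mul_le_mul_left _ (h1.trans ?_)
        gcongr
  have h6 : ((failSet δ k ℓ c f E S).ncard : ℝ) * (2 ^ ℓ) ^ c ≤
      2 ^ c * (2 ^ k * ((δ + 1) * ((2 * (2 + δ)) ^ (2 * δ) * (k : ℝ) ^ (2 * δ)))) := by
    exact_mod_cast h5
  have h7 : (ℓ : ℝ) ^ (2 * δ) ≤ (2 * δ) ^ (2 * δ) * 2 ^ ℓ := by
    exact_mod_cast pow_le_pow_self_mul_two_pow (2 * δ) ℓ
  have hℓ : (0 : ℝ) < ℓ := by exact_mod_cast h0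
  set x : ℝ := (k : ℝ) / ℓ with hx
  have hkx : (k : ℝ) = x * ℓ := by rw [hx]; field_simp
  have hx0 : 0 ≤ x := by positivity
  rw [pow_mul] at hA
  rw [pow_mul (2 : ℝ) ℓ (c - δ)]
  set q : ℝ := 2 ^ ℓ
  have hq0 : 0 < q := by positivity
  -- Of the two factors `x ^ δ` in `k ^ (2 * δ)`, one is kept; the other, together with the `q` that
  -- bounds `ℓ ^ (2 * δ)`, is absorbed into `q ^ δ` by `hA`.
  have h8 : (k : ℝ) ^ (2 * δ) ≤ (2 * δ) ^ (2 * δ) * (x ^ δ * q ^ δ) := by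
    calc (k : ℝ) ^ (2 * δ) = x ^ δ * x ^ δ * (ℓ : ℝ) ^ (2 * δ) := by
          rw [hkx, mul_pow, two_mul δ, pow_add x]
      _ ≤ x ^ δ * x ^ δ * ((2 * δ) ^ (2 * δ) * q) := by gcongr
      _ = (2 * δ) ^ (2 * δ) * (x ^ δ * (q * x ^ δ)) := by ring
      _ ≤ _ := by gcongr
  have h9 : q ^ c = q ^ (c - δ) * q ^ δ := by rw [← pow_add]; congr 1; omega
  refine le_of_mul_le_mul_right (h6.trans ?_) (show 0 < q ^ c by positivity)
  calc _ ≤ 2 ^ c * (2 ^ k * ((δ + 1) * ((2 * (2 + δ)) ^ (2 * δ) *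
        ((2 * δ) ^ (2 * δ) * (x ^ δ * q ^ δ))))) := by gcongr
    _ = _ := by rw [h9]; field_simp

end field

end

end GC

/-! ### Assembly of the bounds -/

theorem theorem3 (δ c : ℕ) (hc : δ < c) :
    -- all block lengths
    (∃ C : ℝ, ∀ k ℓ : ℕ, 1 ≤ ℓ → ℓ ≤ k → GC.numBlocks k ℓ + c < 2 ^ ℓ →
      ∀ f : (ZMod 2)[X], Irreducible f → f.natDegree = ℓ →
        (∀ E : Matrix (Fin (GC.numBlocks k ℓ)) (Fin c) (AdjoinRoot f), GC.IsSystematicMDS E →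
          -- redundancy
          (∀ u : Fin k → Bool,
            (GC.encode δ k ℓ c f E u).length = k + c * (δ + 1) * ℓ) ∧
          -- encoding complexity
          (∀ u : Fin k → Bool,
            (GC.encodeT δ k ℓ (GC.lowBits f ℓ) (GC.matrixBits f ℓ E) (List.ofFn u)).val =
              GC.encode δ k ℓ c f E u ∧
            ((GC.encodeT δ k ℓ (GC.lowBits f ℓ) (GC.matrixBits f ℓ E) (List.ofFn u)).cost : ℝ) ≤
              C * ((k : ℝ) * ℓ)) ∧
          -- decoding complexity
          (∀ y : List Bool, y.length ≤ k + c * (δ + 1) * ℓ + δ →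
            (GC.decodeT δ k ℓ c (GC.lowBits f ℓ) (GC.matrixBits f ℓ E) y).val =
              GC.decode δ k ℓ c f E y ∧
            ((GC.decodeT δ k ℓ c (GC.lowBits f ℓ) (GC.matrixBits f ℓ E) y).cost : ℝ) ≤
              C * ((k : ℝ) ^ (δ + 1) / (ℓ : ℝ) ^ ((δ : ℤ) - 1))) ∧
          -- the decoder never returns a wrong message
          (∀ (u : Fin k → Bool) (S : Finset ℕ) (y : List Bool), S.card ≤ δ →
            GC.InsertedAt S (GC.encode δ k ℓ c f E u) y →
            GC.decode δ k ℓ c f E y = none ∨ GC.decode δ k ℓ c f E y = some (List.ofFn u))) ∧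
        -- probability of decoding failure, for a suitable MDS code
        (∃ E : Matrix (Fin (GC.numBlocks k ℓ)) (Fin c) (AdjoinRoot f), GC.IsSystematicMDS E ∧
          ∀ π : PMF (Finset ℕ), (∀ S ∈ π.support, S.card ≤ δ) →
            GC.failureProb δ k ℓ c f E π ≤
              ENNReal.ofReal (C * (((k : ℝ) / ℓ) ^ δ / 2 ^ (ℓ * (c - δ)))))) ∧
    -- probability of decoding failure, for every MDS code, if the blocks are not too long
    (∀ A : ℝ, ∃ C : ℝ, ∀ k ℓ : ℕ, 1 ≤ ℓ → ℓ ≤ k → GC.numBlocks k ℓ + c < 2 ^ ℓ →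
      (2 : ℝ) ^ (ℓ * δ) ≤ A * 2 ^ ℓ * ((k : ℝ) / ℓ) ^ δ →
      ∀ f : (ZMod 2)[X], Irreducible f → f.natDegree = ℓ →
        ∀ E : Matrix (Fin (GC.numBlocks k ℓ)) (Fin c) (AdjoinRoot f), GC.IsSystematicMDS E →
          ∀ π : PMF (Finset ℕ), (∀ S ∈ π.support, S.card ≤ δ) →
            GC.failureProb δ k ℓ c f E π ≤
              ENNReal.ofReal (C * (((k : ℝ) / ℓ) ^ δ / 2 ^ (ℓ * (c - δ))))) := by
  have hC : ∀ {C C' : ℝ} {k ℓ : ℕ}, C ≤ C' →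
      C * (((k : ℝ) / ℓ) ^ δ / 2 ^ (ℓ * (c - δ))) ≤
        C' * (((k : ℝ) / ℓ) ^ δ / 2 ^ (ℓ * (c - δ))) := fun h =>
    mul_le_mul_of_nonneg_right h (by positivity)
  set N₀ : ℝ := (δ + 1 : ℝ) ^ ((δ + 1) * (2 * c + 1)) with hN₀
  refine ⟨?_, fun A => ⟨(δ + 1) * ((δ + 1) * (2 ^ δ * (2 ^ δ + N₀ * A))),
    fun k ℓ h0 hk hq hA f hf hd E hE π hπ => GC.failureProb_le E _ (fun S hS =>
      GC.ncard_failSet_le_of_pow_le hf hd h0 hk hc E hE A hA S hS) π hπ⟩⟩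
  set C₁ : ℝ := (100 + 2 * δ) * (c + 1) with hC₁
  set C₂ : ℝ := 4 * (1 + c * (δ + 1) + δ) + 4 * c + 16 * 4 ^ (δ + 1) +
    2 ^ δ * (2 * (100 * (c + 1) + 300 * (δ + 1) ^ 3) + 9) + 16 with hC₂
  set C₃ : ℝ := (δ + 1) * ((δ + 1) * (2 ^ δ * (2 ^ δ + N₀ * 1))) with hC₃
  set C₄ : ℝ := 2 ^ c * (δ + 1) * (2 * (2 + δ)) ^ (2 * δ) * (2 * δ) ^ (2 * δ) with hC₄
  have p₁ : 0 ≤ C₁ := by positivity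
  have p₂ : 0 ≤ C₂ := by positivity
  have p₃ : 0 ≤ C₃ := by positivity
  have p₄ : 0 ≤ C₄ := by positivity
  refine ⟨C₁ + C₂ + C₃ + C₄, fun k ℓ h0 hk hq f hf hd => ⟨fun E hE => ⟨fun u =>
    GC.encode_length δ k ℓ c f E u, fun u => ⟨(GC.encodeT_spec hf hd h0 hk δ c E u).1, ?_⟩,
    fun y hy => ⟨(GC.decodeT_val_cost hf hd h0 hk hc E hE y).1, ?_⟩, fun u S y hS hy =>
    GC.decode_eq_none_or hf hd h0 hk E u S hS y hy⟩, ?_⟩⟩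
  · exact (GC.encodeT_cost_le hf hd h0 hk E u).trans
      (mul_le_mul_of_nonneg_right (by linarith) (by positivity))
  · exact (GC.decodeT_cost_le hf hd h0 hk hc E hE y hy).trans
      (mul_le_mul_of_nonneg_right (by linarith) (by positivity))
  -- For short blocks every MDS code will do, with `A = 1`; for long ones the averaged code is
  -- taken. The two regimes cover all lengths.
  · by_cases hA : (2 : ℝ) ^ (ℓ * δ) ≤ 1 * 2 ^ ℓ * ((k : ℝ) / ℓ) ^ δ
    · have : Fact (Irreducible f) := ⟨hf⟩
      obtain ⟨E, hE, -⟩ := GC.exists_ncard_iUnion_failSet_le hf hd h0 hk hq δ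
      exact ⟨E, hE, fun π hπ => (GC.failureProb_le E _ (fun S hS =>
        GC.ncard_failSet_le_of_pow_le hf hd h0 hk hc E hE 1 hA S hS) π hπ).trans
        (ENNReal.ofReal_le_ofReal (hC (by linarith)))⟩
    · obtain ⟨E, hE, h⟩ := GC.exists_ncard_failSet_le hf hd h0 hk hc hq
        (by rw [one_mul] at hA; exact (not_le.1 hA).le)
      exact ⟨E, hE, fun π hπ => (GC.failureProb_le E _ h π hπ).trans
        (ENNReal.ofReal_le_ofReal (hC (by linarith)))⟩
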